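/- Let $\mathbb K=\mathbb R$ or $\mathbb C$. Let $Z\to M\xrightarrow{\pi}B$ be a smooth fibration of closed connected manifolds, $E\to M$ a smooth finite-rank $\mathbb K$-vector bundle and $F\to Z$ a smooth finite-rank $\mathbb K$-vector bundle such that every point of $B$ has an open neighbourhood $U$ with a local trivialization: a diffeomorphism $\Phi:U\times Z\to\pi^{-1}(U)$ over $U$ together with a smooth $\mathbb K$-vector bundle isomorphism $\Psi:U\times F\to E|_{\pi^{-1}(U)}$ over $\Phi$. Let $\mathcal E=\pi_*E\to B$ be the infinite-rank bundle with fibre $\mathcal E_b=\Gamma(E|_{Z_b})$ (smooth sections), $Z_b=\pi^{-1}(b)$; smooth sections of $\mathcal E$ over $U$ are smooth sections of $E$ over $\pi^{-1}(U)$, and a local trivialization represents them by families $\rho:U\to\Gamma(F)$. Let $\mathbb G=\mathrm{Diff}(Z,F)$ be the group of pairs $(\phi,f)$ with $\phi\in\mathrm{Diff}(Z)$ and $f:F\to F$ a smooth bundle map over $\phi$ that is a linear isomorphism on each fibre; it acts on $\Gamma(F)$ by $\sigma\mapsto f\circ\sigma\circ\phi^{-1}$. Its Lie algebra $\mathfrak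 g$ consists of the pairs $(V,s)$ with $V$ a smooth vector field on $Z$ and $s:F\to TF$ a smooth vector field on the total space of $F$, covering $V$ and linear on fibres (as a map to $TF\to TZ$). An element $(V,s)\in\mathfrak g$ acts on $\Gamma(F)$ by the Lie derivative $$L_{(V,s)}\sigma = d\sigma(V)-s\circ\sigma=\frac{d}{dt}\Big|_{t=0} f_t^{-1}\circ\sigma\circ\phi_t ,$$ where $(\phi_t,f_t)$ is any smooth path in $\mathbb G$ through the identity with velocity $(V,s)$ at $t=0$ (so $L_{(V,s)}$ is minus the derivative of the left action). A connection on $\mathcal E$ is a $\mathbb G$-connection if in every local trivialization as above it has the form $\nabla_X\rho=d\rho(X)+L_{\theta(X)}\rho$ for a smooth $\mathfrak g$-valued one-form $\theta$ on $U$, its connection one-form. Let $HM$ be a smooth complement of $VM=\ker\pi_*$ in $TM$, write $X^H$ for the horizontal lift of $X\in T_bB$, and let $\nabla^E$ be a smooth ($\mathbb K$-linear) connection on $E$. The Bismut connection on $\mathcal E$ is $(\nabla_Xr)(b)(z)=(\nabla^E_{X^H}\tilde r)(z)$ for $X\in T_bB$, $z\in Z_b$, where $\tilde r$ is the section of $E$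 corresponding to the section $r$ of $\mathcal E$. **Lemma.** The Bismut connection is a connection on $\mathcal E$, and it is a $\mathbb G$-connection. In every local trivialization over $U$, its connection one-form assigns to $X\in T_bB$, $b\in U$, the pair $(V,s)\in\mathfrak g$ described as follows. The field $V$ is the $Z$-component of $X^H$, i.e. $X^H=\Phi_*(X,V(z))$ at $\Phi(b,z)$. For every smooth curve $\gamma:(-\delta,\delta)\to U$ with $\dot\gamma(0)=X$ there is $\varepsilon\in(0,\delta]$ such that the parallel translation $\Vert_{0,t}$ of the Bismut connection along $\gamma$, read in the trivialization, exists for $|t|<\varepsilon$ and is a smooth path $(\phi_t,f_t)$ in $\mathbb G$ starting at the identity: for each $\sigma\in\Gamma(F)$ the family $t\mapsto f_t\circ\sigma\circ\phi_t^{-1}$ is the unique parallel family along $\gamma$ starting at $\sigma$, and each curve $t\mapsto\Phi(\gamma(t),\phi_t(z))$ is a horizontal lift of $\gamma$. Moreover $V=\dot\phi_t(0)$ and $s(v)=\frac{d}{dt}\big|_{t=0}f_t(v)=\frac{d}{dt}\big|_{t=0}\Vert_{0,t}v$ for all $v\in F$. -/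

import Mathlib

open Bundle Set Filter Topology
open scoped Manifold ContDiff

noncomputable section

namespace PushforwardBundle

/-! ### The model: a `𝕂`-vector bundle `F → Z`, its automorphism group and its Lie algebra

`𝕂` is `ℝ` or `ℂ`.  A smooth `𝕂`-vector bundle over a real manifold is a smooth real vector bundle
whose fibres and trivializations are `𝕂`-linear. -/

section Model

variable (𝕂 : Type*) [RCLike 𝕂]
  (EZ : Type*) [NormedAddCommGroup EZ] [NormedSpace ℝ EZ]
  {Z : Type*} [TopologicalSpace Z] [ChartedSpace EZ Z] [IsManifold 𝓘(ℝ, EZ) ∞ Z]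
  (FF : Type*) [NormedAddCommGroup FF] [NormedSpace ℝ FF] [NormedSpace 𝕂 FF]
  (F : Z → Type*) [TopologicalSpace (TotalSpace FF F)] [∀ z, TopologicalSpace (F z)]
  [∀ z, AddCommGroup (F z)] [∀ z, Module ℝ (F z)] [∀ z, Module 𝕂 (F z)]
  [FiberBundle FF F] [VectorBundle ℝ FF F] [ContMDiffVectorBundle ∞ FF F 𝓘(ℝ, EZ)]

/-- The group `𝔾 = Diff(Z, F)`: pairs `(φ, f)` with `φ` a diffeomorphism of `Z` and `f : F → F` a
smooth bundle map over `φ` which is a linear isomorphism on each fibre. -/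
structure BundleAut where
  /-- the diffeomorphism `φ` of the base -/
  base : Diffeomorph 𝓘(ℝ, EZ) 𝓘(ℝ, EZ) Z Z ∞
  /-- the restriction of `f` to the fibre over `z` -/
  fib : ∀ z, F z ≃ₗ[𝕂] F (base z)
  smooth_fib : ContMDiff (𝓘(ℝ, EZ).prod 𝓘(ℝ, FF)) (𝓘(ℝ, EZ).prod 𝓘(ℝ, FF)) ∞
    (fun v : TotalSpace FF F => (⟨base v.1, fib v.1 v.2⟩ : TotalSpace FF F))

/-- The Lie algebra `𝔤` of `𝔾`: pairs `(V, s)` with `V` a smooth vector field on `Z` and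
`s : F → TF` a smooth vector field on the total space of `F` which covers `V` and is linear on
fibres, for the vector bundle structure of `TF → TZ`. -/
structure BundleAutLie where
  /-- the vector field on the base -/
  V : ∀ z : Z, TangentSpace 𝓘(ℝ, EZ) z
  /-- the vector field on the total space -/
  s : ∀ v : TotalSpace FF F, TangentSpace (𝓘(ℝ, EZ).prod 𝓘(ℝ, FF)) v
  smooth_V : ContMDiff 𝓘(ℝ, EZ) 𝓘(ℝ, EZ).tangent ∞
    (fun z => (⟨z, V z⟩ : TangentBundle 𝓘(ℝ, EZ) Z))
  smooth_s : ContMDiff (𝓘(ℝ, EZ).prod 𝓘(ℝ, FF)) (𝓘(ℝ, EZ).prod 𝓘(ℝ, FF)).tangent ∞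
    (fun v => (⟨v, s v⟩ : TangentBundle (𝓘(ℝ, EZ).prod 𝓘(ℝ, FF)) (TotalSpace FF F)))
  covers : ∀ v : TotalSpace FF F,
    mfderiv (𝓘(ℝ, EZ).prod 𝓘(ℝ, FF)) 𝓘(ℝ, EZ) (fun y : TotalSpace FF F => y.proj) v (s v)
      = V v.proj
  -- in a trivialization of `F`, the fibre coordinate of `s v` is linear in `v ∈ F z`
  linear : ∀ z : Z, IsLinearMap 𝕂 (fun v : F z =>
    (mfderiv (𝓘(ℝ, EZ).prod 𝓘(ℝ, FF)) 𝓘(ℝ, FF)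
      (fun y : TotalSpace FF F => (trivializationAt FF F z y).2) ⟨z, v⟩ (s ⟨z, v⟩) : FF))

variable {𝕂 EZ FF F}

/-- An element of `𝔾` as a map `f` of the total space of `F`. -/
def BundleAut.toFun (g : BundleAut 𝕂 EZ FF F) (v : TotalSpace FF F) : TotalSpace FF F :=
  ⟨g.base v.1, g.fib v.1 v.2⟩

/-- The action of `𝔾` on sections of `F`: `σ ↦ f ∘ σ ∘ φ⁻¹`. -/
def BundleAut.act (g : BundleAut 𝕂 EZ FF F) (σ : ∀ z, F z) (z : Z) : F z :=
  g.base.apply_symm_apply z ▸ g.fib (g.base.symm z) (σ (g.base.symm z))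

/-- The action is characterized by `(g • σ)(φ z) = f (σ z)`. -/
theorem BundleAut.act_apply (g : BundleAut 𝕂 EZ FF F) (σ : ∀ z, F z) (z : Z) :
    g.act σ (g.base z) = g.fib z (σ z) := by
  have key : ∀ (y : Z) (hy : y = z) (h : g.base y = g.base z),
      (h ▸ g.fib y (σ y) : F (g.base z)) = g.fib z (σ z) := by
    intro y hy h
    subst hy
    rfl
  exact key _ (g.base.symm_apply_apply z) _

variable (EZ FF) in
/-- The canonical identification of the fibre `F z` with the vertical tangent space of the total
space of `F` at `v ∈ F z`: the velocity of `t ↦ v + t w` at `t = 0`. -/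
def vertLift {z : Z} (v w : F z) :
    TangentSpace (𝓘(ℝ, EZ).prod 𝓘(ℝ, FF)) (⟨z, v⟩ : TotalSpace FF F) :=
  mfderiv 𝓘(ℝ, ℝ) (𝓘(ℝ, EZ).prod 𝓘(ℝ, FF))
    (fun t : ℝ => (⟨z, v + t • w⟩ : TotalSpace FF F)) 0 (1 : ℝ)

/-- `τ = L_ξ σ` is the Lie derivative of the section `σ` along `ξ = (V, s) ∈ 𝔤`:
`τ = dσ(V) - s ∘ σ`, an equation between vertical tangent vectors of `F`.
This is the derivative at `t = 0` of `f_t⁻¹ ∘ σ ∘ φ_t` for a path `(φ_t, f_t)` in `𝔾` through the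
identity with velocity `ξ`, that is, minus the derivative of the action on `σ`. -/
def BundleAutLie.IsLieDeriv (ξ : BundleAutLie 𝕂 EZ FF F) (σ τ : ∀ z, F z) : Prop :=
  ∀ z, vertLift EZ FF (σ z) (τ z) =
    mfderiv 𝓘(ℝ, EZ) (𝓘(ℝ, EZ).prod 𝓘(ℝ, FF))
      (fun y => (⟨y, σ y⟩ : TotalSpace FF F)) z (ξ.V z) - ξ.s ⟨z, σ z⟩

end Model

/-! ### The family `E → M → B` and the infinite-rank bundle `𝓔 = pr_* E → B` -/

section Family

variable {𝕂 : Type*} [RCLike 𝕂]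
  {EB : Type*} [NormedAddCommGroup EB] [NormedSpace ℝ EB]
  {B : Type*} [TopologicalSpace B] [ChartedSpace EB B] [IsManifold 𝓘(ℝ, EB) ∞ B]
  {EM : Type*} [NormedAddCommGroup EM] [NormedSpace ℝ EM]
  {M : Type*} [TopologicalSpace M] [ChartedSpace EM M] [IsManifold 𝓘(ℝ, EM) ∞ M]
  {EZ : Type*} [NormedAddCommGroup EZ] [NormedSpace ℝ EZ]
  {Z : Type*} [TopologicalSpace Z] [ChartedSpace EZ Z] [IsManifold 𝓘(ℝ, EZ) ∞ Z]
  {FE : Type*} [NormedAddCommGroup FE] [NormedSpace ℝ FE] [NormedSpace 𝕂 FE]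
  {E : M → Type*} [TopologicalSpace (TotalSpace FE E)] [∀ m, TopologicalSpace (E m)]
  [∀ m, AddCommGroup (E m)] [∀ m, Module ℝ (E m)] [∀ m, Module 𝕂 (E m)]
  [FiberBundle FE E] [VectorBundle ℝ FE E] [ContMDiffVectorBundle ∞ FE E 𝓘(ℝ, EM)]
  {FF : Type*} [NormedAddCommGroup FF] [NormedSpace ℝ FF] [NormedSpace 𝕂 FF]
  {F : Z → Type*} [TopologicalSpace (TotalSpace FF F)] [∀ z, TopologicalSpace (F z)]
  [∀ z, AddCommGroup (F z)] [∀ z, Module ℝ (F z)] [∀ z, Module 𝕂 (F z)]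
  [FiberBundle FF F] [VectorBundle ℝ FF F] [ContMDiffVectorBundle ∞ FF F 𝓘(ℝ, EZ)]

/-- The fibre `Z_b = pr⁻¹(b)`. -/
abbrev Fiber (pr : M → B) (b : B) : Type _ := {m : M // pr m = b}

variable (𝕂 EB EM EZ FE E FF F) in
/-- A local trivialization over an open set `U ⊆ B` of `E → M → B` with model `F → Z`:
a diffeomorphism `Φ : U × Z → pr⁻¹(U)` over `U`, together with a smooth vector bundle isomorphism
`Ψ : U × F → E|_{pr⁻¹(U)}` over `Φ`.  Restricted to the fibres over `b ∈ U` it identifies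
`𝓔_b = Γ(E_b)` with `Γ(F)`.  Values over points outside `U` are irrelevant. -/
structure LocalTriv (pr : M → B) (U : Set B) where
  isOpen_U : IsOpen U
  /-- the diffeomorphism `U × Z → pr⁻¹(U)` -/
  Φ : B → Z → M
  /-- the `Z`-component of the inverse of `Φ` -/
  ζ : M → Z
  /-- the isomorphism of bundles over `Φ` -/
  Ψ : ∀ b z, F z →ₗ[𝕂] E (Φ b z)
  pr_Φ : ∀ b ∈ U, ∀ z, pr (Φ b z) = b
  ζ_Φ : ∀ b ∈ U, ∀ z, ζ (Φ b z) = z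
  Φ_ζ : ∀ m, pr m ∈ U → Φ (pr m) (ζ m) = m
  smooth_Φ : ContMDiffOn (𝓘(ℝ, EB).prod 𝓘(ℝ, EZ)) 𝓘(ℝ, EM) ∞
    (fun p : B × Z => Φ p.1 p.2) (U ×ˢ univ)
  smooth_ζ : ContMDiffOn 𝓘(ℝ, EM) 𝓘(ℝ, EZ) ∞ ζ (pr ⁻¹' U)
  bijective_Ψ : ∀ b ∈ U, ∀ z, Function.Bijective (Ψ b z)
  smooth_Ψ : ContMDiffOn (𝓘(ℝ, EB).prod (𝓘(ℝ, EZ).prod 𝓘(ℝ, FF))) (𝓘(ℝ, EM).prod 𝓘(ℝ, FE)) ∞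
    (fun p : B × TotalSpace FF F => (⟨Φ p.1 p.2.1, Ψ p.1 p.2.1 p.2.2⟩ : TotalSpace FE E))
    (U ×ˢ univ)

variable (EB EM) in
/-- A smooth complement `HM` of the vertical bundle `VM = ker pr_*` in `TM`.  Smoothness of the
subbundle is expressed by smoothness of the projection `TM → TM` onto `HM` along `VM`. -/
structure HorizontalBundle (pr : M → B) where
  /-- the horizontal space at `m` -/
  H : ∀ m : M, Submodule ℝ (TangentSpace 𝓘(ℝ, EM) m)
  isCompl : ∀ m, IsCompl (H m) (mfderiv 𝓘(ℝ, EM) 𝓘(ℝ, EB) pr m).ker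
  smooth : ContMDiff 𝓘(ℝ, EM).tangent 𝓘(ℝ, EM).tangent ∞
    (fun v : TangentBundle 𝓘(ℝ, EM) M =>
      (⟨v.1, (H v.1).projection _ (isCompl v.1) v.2⟩ : TangentBundle 𝓘(ℝ, EM) M))

/-- The horizontal lift `X^H ∈ HM_m` of `X ∈ T_b B`, where `pr m = b`: the vector `Y ∈ HM_m` with
`pr_* Y = X` (unique because `HM_m` is a complement of `ker pr_*`; it exists since `pr` is a
submersion). -/
def HorizontalBundle.lift {pr : M → B} (H : HorizontalBundle EB EM pr) (m : M)
    (X : TangentBundle 𝓘(ℝ, EB) B) : TangentSpace 𝓘(ℝ, EM) m :=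
  Classical.epsilon fun Y => Y ∈ H.H m ∧ tangentMap 𝓘(ℝ, EM) 𝓘(ℝ, EB) pr ⟨m, Y⟩ = X

variable (EM FE) in
/-- Membership in the fibre `𝓔_b`: smooth sections of `E_b = E|_{Z_b}`, i.e. sections over `Z_b`
that extend near each point of `Z_b` to a smooth section of `E`. -/
def IsSmoothOnFiber {pr : M → B} (b : B) (σ : ∀ m : Fiber pr b, E m.1) : Prop :=
  ∀ m : Fiber pr b, ∃ (W : Set M) (r : ∀ m, E m), IsOpen W ∧ m.1 ∈ W ∧
    ContMDiffOn 𝓘(ℝ, EM) (𝓘(ℝ, EM).prod 𝓘(ℝ, FE)) ∞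
      (fun m => (⟨m, r m⟩ : TotalSpace FE E)) W ∧
    ∀ m' : Fiber pr b, m'.1 ∈ W → σ m' = r m'.1

variable (EB E) in
/-- The type of a covariant derivative on `𝓔`.  A section `r` of `𝓔` over `W ⊆ B` is the same as a
section of `E` over `pr⁻¹(W)`; `D r b X` is `∇_X r ∈ 𝓔_b` for `X ∈ T_b B`. -/
abbrev CovDerivOp (pr : M → B) : Type _ :=
  (∀ m, E m) → ∀ b, TangentSpace 𝓘(ℝ, EB) b → ∀ m : Fiber pr b, E m.1

variable (EM FE E) in
/-- `r` is a smooth section of `𝓔` over `W`: a smooth section of `E` over `pr⁻¹(W)`. -/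
def IsSmoothSectionOn (pr : M → B) (W : Set B) (r : ∀ m, E m) : Prop :=
  ContMDiffOn 𝓘(ℝ, EM) (𝓘(ℝ, EM).prod 𝓘(ℝ, FE)) ∞
    (fun m => (⟨m, r m⟩ : TotalSpace FE E)) (pr ⁻¹' W)

variable (𝕂 EM FE) in
/-- `D` is a (smooth) connection on the infinite-rank bundle `𝓔 → B`. -/
structure IsConnection {pr : M → B} (D : CovDerivOp EB E pr) : Prop where
  congr : ∀ {W : Set B}, IsOpen W → ∀ {r r' : ∀ m, E m},
    IsSmoothSectionOn EM FE E pr W r → IsSmoothSectionOn EM FE E pr W r' →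
    (∀ m, pr m ∈ W → r m = r' m) → ∀ b ∈ W, D r b = D r' b
  mem_fiber : ∀ {W : Set B}, IsOpen W → ∀ {r : ∀ m, E m}, IsSmoothSectionOn EM FE E pr W r →
    ∀ b ∈ W, ∀ X, IsSmoothOnFiber EM FE b (D r b X)
  smooth : ∀ {W : Set B}, IsOpen W → ∀ {r : ∀ m, E m}, IsSmoothSectionOn EM FE E pr W r →
    ∀ X : ∀ b, TangentSpace 𝓘(ℝ, EB) b,
    ContMDiffOn 𝓘(ℝ, EB) 𝓘(ℝ, EB).tangent ∞
      (fun b => (⟨b, X b⟩ : TangentBundle 𝓘(ℝ, EB) B)) W →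
    IsSmoothSectionOn EM FE E pr W (fun m => D r (pr m) (X (pr m)) ⟨m, rfl⟩)
  vec_add : ∀ {W : Set B}, IsOpen W → ∀ {r : ∀ m, E m}, IsSmoothSectionOn EM FE E pr W r →
    ∀ b ∈ W, ∀ X Y, D r b (X + Y) = D r b X + D r b Y
  vec_smul : ∀ {W : Set B}, IsOpen W → ∀ {r : ∀ m, E m}, IsSmoothSectionOn EM FE E pr W r →
    ∀ b ∈ W, ∀ (c : ℝ) X, D r b (c • X) = c • D r b X
  add : ∀ {W : Set B}, IsOpen W → ∀ {r r' : ∀ m, E m},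
    IsSmoothSectionOn EM FE E pr W r → IsSmoothSectionOn EM FE E pr W r' →
    ∀ b ∈ W, ∀ X, D (r + r') b X = D r b X + D r' b X
  smul : ∀ {W : Set B}, IsOpen W → ∀ {r : ∀ m, E m}, IsSmoothSectionOn EM FE E pr W r →
    ∀ b ∈ W, ∀ (c : 𝕂) X, D (c • r) b X = c • D r b X
  leibniz : ∀ {W : Set B}, IsOpen W → ∀ {r : ∀ m, E m}, IsSmoothSectionOn EM FE E pr W r →
    ∀ h : B → ℝ, ContMDiffOn 𝓘(ℝ, EB) 𝓘(ℝ, ℝ) ∞ h W → ∀ b ∈ W, ∀ X (m : Fiber pr b),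
    D (fun m => h (pr m) • r m) b X m
      = mvfderiv 𝓘(ℝ, EB) h b X • r m.1 + h b • D r b X m

variable [∀ m, IsTopologicalAddGroup (E m)] [∀ m, ContinuousSMul ℝ (E m)] in
/-- The Bismut connection on `𝓔`: `(∇_X r)(b)(m) = ∇^E_{X^H} r (m)` for `X ∈ T_b B`, `m ∈ Z_b`. -/
def bismut {pr : M → B} (nablaE : CovariantDerivative 𝓘(ℝ, EM) FE E)
    (H : HorizontalBundle EB EM pr) : CovDerivOp EB E pr :=
  fun r b X m => nablaE r m.1 (H.lift m.1 ⟨b, X⟩)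

/-- `θ` is a smooth `𝔤`-valued one-form on `U ⊆ B` (values outside `U` are irrelevant). -/
structure IsOneForm (U : Set B)
    (θ : ∀ b : B, TangentSpace 𝓘(ℝ, EB) b → BundleAutLie 𝕂 EZ FF F) : Prop where
  add_V : ∀ b ∈ U, ∀ X Y z, (θ b (X + Y)).V z = (θ b X).V z + (θ b Y).V z
  smul_V : ∀ b ∈ U, ∀ (c : ℝ) X z, (θ b (c • X)).V z = c • (θ b X).V z
  add_s : ∀ b ∈ U, ∀ X Y v, (θ b (X + Y)).s v = (θ b X).s v + (θ b Y).s v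
  smul_s : ∀ b ∈ U, ∀ (c : ℝ) X v, (θ b (c • X)).s v = c • (θ b X).s v
  smooth : ContMDiffOn (𝓘(ℝ, EB).tangent.prod (𝓘(ℝ, EZ).prod 𝓘(ℝ, FF)))
    (𝓘(ℝ, EZ).prod 𝓘(ℝ, FF)).tangent ∞
    (fun p : TangentBundle 𝓘(ℝ, EB) B × TotalSpace FF F =>
      (⟨p.2, (θ p.1.1 p.1.2).s p.2⟩ :
        TangentBundle (𝓘(ℝ, EZ).prod 𝓘(ℝ, FF)) (TotalSpace FF F)))
    {p | p.1.1 ∈ U}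

namespace LocalTriv

variable {pr : M → B} {U : Set B} (T : LocalTriv 𝕂 EB EM EZ FE E FF F pr U)

/-- The section `r` of `𝓔` over `U` is represented in the trivialization by `ρ : U → Γ(F)`. -/
def Represents (ρ : B → ∀ z, F z) (r : ∀ m, E m) : Prop :=
  ∀ b ∈ U, ∀ z, r (T.Φ b z) = T.Ψ b z (ρ b z)

/-- In the trivialization `T`, the connection `D` on `𝓔` is `d + θ`, where `θ` is a `𝔤`-valued
one-form and `𝔤` acts on `Γ(F)` by Lie derivatives: if `r` is represented by `ρ`, then `∇_X r` is
represented at `b` by `w`, where `w z = d_X ρ(·, z) + (L_{θ(X)} ρ(b)) z`. -/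
def HasConnectionForm (D : CovDerivOp EB E pr)
    (θ : ∀ b : B, TangentSpace 𝓘(ℝ, EB) b → BundleAutLie 𝕂 EZ FF F) : Prop :=
  ∀ (r : ∀ m, E m) (ρ : B → ∀ z, F z), IsSmoothSectionOn EM FE E pr U r → T.Represents ρ r →
    ∀ (b : B) (hb : b ∈ U) (X : TangentSpace 𝓘(ℝ, EB) b),
      ∃ τ : ∀ z, F z, (θ b X).IsLieDeriv (ρ b) τ ∧
        ∀ (z : Z) (w : F z), T.Ψ b z w = D r b X ⟨T.Φ b z, T.pr_Φ b hb z⟩ →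
          vertLift EZ FF (ρ b z) (w - τ z) =
            mfderiv 𝓘(ℝ, EB) (𝓘(ℝ, EZ).prod 𝓘(ℝ, FF))
              (fun b' => (⟨z, ρ b' z⟩ : TotalSpace FF F)) b X

/-- The curve `t ↦ ρ t ∈ Γ(F) ≅ 𝓔_{γ t}`, `t ∈ (-ε, ε)`, of sections over the curve `γ` in `U` is
parallel for the connection `D` on `𝓔`.  In the trivialization, the covariant derivative along `γ`
is `dρ/dt + ∇_{γ'(t)} R`, where `R` is the section of `𝓔` over `U` with constant representative
`ρ t`. -/
structure IsParallel (D : CovDerivOp EB E pr) (γ : ℝ → B) (ε : ℝ) (ρ : ℝ → ∀ z, F z) : Prop where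
  smooth : ContMDiffOn (𝓘(ℝ, ℝ).prod 𝓘(ℝ, EZ)) (𝓘(ℝ, EZ).prod 𝓘(ℝ, FF)) ∞
    (fun p : ℝ × Z => (⟨p.2, ρ p.1 p.2⟩ : TotalSpace FF F)) (Ioo (-ε) ε ×ˢ univ)
  parallel : ∀ t ∈ Ioo (-ε) ε, ∀ (ht : γ t ∈ U) (R : ∀ m, E m),
    T.Represents (fun _ => ρ t) R → ∀ (z : Z) (w : F z),
    T.Ψ (γ t) z w = D R (γ t) (mfderiv 𝓘(ℝ, ℝ) 𝓘(ℝ, EB) γ t (1 : ℝ))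
      ⟨T.Φ (γ t) z, T.pr_Φ (γ t) ht z⟩ →
    mfderiv 𝓘(ℝ, ℝ) (𝓘(ℝ, EZ).prod 𝓘(ℝ, FF))
      (fun t' => (⟨z, ρ t' z⟩ : TotalSpace FF F)) t (1 : ℝ) = vertLift EZ FF (ρ t z) (-w)

/-- The smooth path `g t = ‖_{0,t}`, `t ∈ (-ε, ε)`, in `𝔾` is the parallel translation of the
connection `D` along `γ`, read in the trivialization: `g 0` is the identity, and for each smooth
section `σ` of `F` the curve `t ↦ g t • σ` is the one and only parallel curve starting at `σ`. -/
structure IsParallelTranslation (D : CovDerivOp EB E pr) (γ : ℝ → B) (ε : ℝ)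
    (g : ℝ → BundleAut 𝕂 EZ FF F) : Prop where
  smooth : ContMDiffOn (𝓘(ℝ, ℝ).prod (𝓘(ℝ, EZ).prod 𝓘(ℝ, FF))) (𝓘(ℝ, EZ).prod 𝓘(ℝ, FF)) ∞
    (fun p : ℝ × TotalSpace FF F => (g p.1).toFun p.2) (Ioo (-ε) ε ×ˢ univ)
  start : ∀ v, (g 0).toFun v = v
  parallel : ∀ σ : ∀ z, F z,
    ContMDiff 𝓘(ℝ, EZ) (𝓘(ℝ, EZ).prod 𝓘(ℝ, FF)) ∞ (fun z => (⟨z, σ z⟩ : TotalSpace FF F)) →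
    T.IsParallel D γ ε (fun t => (g t).act σ)
  unique : ∀ ρ : ℝ → ∀ z, F z, T.IsParallel D γ ε ρ →
    ∀ t ∈ Ioo (-ε) ε, ρ t = (g t).act (ρ 0)

end LocalTriv

variable (𝕂 EM EZ FE FF F) in
/-- A `𝔾`-connection on `𝓔`: a connection whose connection one-form in each local trivialization
with model `F → Z` takes values in `𝔤`. -/
def IsGConnection {pr : M → B} (D : CovDerivOp EB E pr) : Prop :=
  IsConnection 𝕂 EM FE D ∧
    ∀ (U : Set B) (T : LocalTriv 𝕂 EB EM EZ FE E FF F pr U),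
      ∃ θ : ∀ b : B, TangentSpace 𝓘(ℝ, EB) b → BundleAutLie 𝕂 EZ FF F,
        IsOneForm U θ ∧ T.HasConnectionForm D θ

end Family

end PushforwardBundle

end

noncomputable section

set_option linter.unusedSectionVars false

/-! ### Smooth dependence of solutions of ordinary differential equations on initial values -/

section Superposition

universe u

variable {E : Type u} [NormedAddCommGroup E] [NormedSpace ℝ E]
  {G : Type u} [NormedAddCommGroup G] [NormedSpace ℝ G]
  {K : Type*} [TopologicalSpace K] [CompactSpace K]

/-! In a local trivialization, the Bismut connection and its parallel translation are both governed
by one fibrewise linear vector field on the total space of `F`. Since `(pr, ζ)` inverts `Φ`, the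
horizontal lift decomposes as X^H = Φ_*(X, V) (`lift_eq_mfderiv_Φ`). In a fibre coordinate κ on `E`
one has κ(∇_Y r) = d(κ r)(Y) + A(Y) r with A tensorial (`covDefect_eq_connForm`). For Y = X^H the
first term splits into dρ(X) + dρ(V). If s is the field with projection V and fibre coordinate
-A(X^H)Ψ, the remaining terms form L_{(V,s)} ρ, so the connection is d + θ with θ(X) = (V, s)
(`hasConnectionForm_bismut`). Geometrically, s(v) is the ∇-horizontal lift of X^H at Ψ(v), carried
back to `F`; this is why one vector serves all coordinates κ (`exists_tangent_pull`). Smoothness of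
θ is a statement about smooth families of linear maps between finite-dimensional spaces, which can
be tested on a basis (`contMDiffAt_clmOf`).

A family ρ is parallel along γ exactly when ∂ρ/∂t = s ∘ ρ - dρ(V) (`parallel_iff`). This first-order
equation on `Z` is solved by characteristics: along t ↦ φ_t(y) the values ρ_t(φ_t(y)) form an
integral curve of s. Hence the flow (φ_t, f_t) of the time-dependent field θ(γ'(t)) gives the
solution f_t ∘ σ ∘ φ_t⁻¹, and uniqueness of integral curves gives uniqueness of the parallel family
(`isParallelTranslation_of_flow`). The velocity of this flow at time 0 is (V, s) by construction.

It remains to have a flow for a common time, although `F` is not compact. In a chart the fibre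
equation is linear, so it is replaced by the equation for its fundamental solution, whose initial
value is the identity operator whatever the vector (`exists_isFlowOn_nhds`). Compactness of `Z` and
uniqueness then glue the local flows (`exists_isFlowOn_univ`). Smooth dependence on initial values
comes from the inverse function theorem applied to the Picard equation α = x + t ∫ f ∘ α in the
Banach space of continuous paths on the unit interval (`exists_contDiffOn_picard_paths`), which
needs α ↦ f ∘ α to be smooth (`contDiff_superposition`). -/

/-- The superposition operator `α ↦ f ∘ α` on spaces of continuous functions. -/
def superposition (f : E → G) (hf : Continuous f) (α : C(K, E)) : C(K, G) := ⟨f ∘ α, hf.comp α.2⟩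

instance : NormedAddCommGroup C(K, E →L[ℝ] G) := ContinuousMap.instNormedAddCommGroup

instance : NormedSpace ℝ C(K, E →L[ℝ] G) := ContinuousMap.normedSpace

/-- The pointwise application `C(K, E →L G) → C(K, E) →L C(K, G)`. -/
def pointwiseApply : C(K, E →L[ℝ] G) →L[ℝ] C(K, E) →L[ℝ] C(K, G) :=
  LinearMap.mkContinuous₂
    (LinearMap.mk₂ ℝ (fun (A : C(K, E →L[ℝ] G)) (h : C(K, E)) =>
      (⟨fun k => A k (h k), A.2.clm_apply h.2⟩ : C(K, G)))
      (fun A A' h => by ext; simp) (fun c A h => by ext; simp)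
      (fun A h h' => by ext; simp) (fun c A h => by ext; simp)) 1
    (fun A h => by
      rw [one_mul, ContinuousMap.norm_le _ (by positivity)]
      intro k
      exact ((A k).le_opNorm _).trans
        (mul_le_mul (A.norm_coe_le_norm k) (h.norm_coe_le_norm k) (norm_nonneg _)
          ((norm_nonneg (A k)).trans (A.norm_coe_le_norm k))))

@[simp]
theorem pointwiseApply_apply (A : C(K, E →L[ℝ] G)) (h : C(K, E)) (k : K) :
    pointwiseApply A h k = A k (h k) := rfl

theorem continuous_superposition (f : E → G) (hf : Continuous f) :
    Continuous (superposition (K := K) f hf) :=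
  ContinuousMap.continuous_postcomp ⟨f, hf⟩

/-- The range of `α` is compact, so the modulus of continuity of the derivative of `f` near it is
uniform in `k`. The mean value inequality on a ball around each `α k` then bounds the remainder by
ε‖h‖ with one δ for all `k`. -/
theorem hasFDerivAt_superposition (f : E → G) (hf : ContDiff ℝ 1 f) (α : C(K, E)) :
    HasFDerivAt (superposition (K := K) f hf.continuous)
      (pointwiseApply (superposition (fderiv ℝ f) (hf.continuous_fderiv one_ne_zero) α)) α := by
  rw [hasFDerivAt_iff_isLittleO_nhds_zero, Asymptotics.isLittleO_iff]
  intro ε hε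
  have hcont : Continuous (fderiv ℝ f) := hf.continuous_fderiv one_ne_zero
  have hcomp : IsCompact (range α) := isCompact_range α.2
  obtain ⟨δ, hδ, hunif⟩ : ∃ δ > 0, ∀ x ∈ range α, ∀ y, dist x y < δ →
      dist (fderiv ℝ f x) (fderiv ℝ f y) < ε := by
    have h := hcomp.uniformContinuousAt_of_continuousAt (fderiv ℝ f)
      (fun x _ => hcont.continuousAt) (Metric.dist_mem_uniformity hε)
    obtain ⟨δ, hδ, h'⟩ := Metric.mem_uniformity_dist.1 h
    exact ⟨δ, hδ, fun x hx y hxy => h' hxy hx⟩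
  filter_upwards [Metric.ball_mem_nhds (0 : C(K, E)) hδ] with h hh
  rw [mem_ball_zero_iff] at hh
  rw [ContinuousMap.norm_le _ (by positivity)]
  intro k
  have hk : ‖h k‖ < δ := (h.norm_coe_le_norm k).trans_lt hh
  have key := (convex_ball (α k) δ).norm_image_sub_le_of_norm_hasFDerivWithin_le'
    (f := f) (f' := fun y => fderiv ℝ f y) (φ := fderiv ℝ f (α k)) (C := ε)
    (x := α k) (y := α k + h k)
    (fun y _ => ((hf.differentiable one_ne_zero) y).hasFDerivAt.hasFDerivWithinAt)
    (fun y hy => by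
      rw [← dist_eq_norm, dist_comm]
      exact (hunif _ ⟨k, rfl⟩ y (by rw [dist_comm]; exact hy)).le)
    (Metric.mem_ball_self hδ) (by simpa [dist_eq_norm] using hk)
  simp only [add_sub_cancel_left] at key
  exact key.trans (mul_le_mul_of_nonneg_left (h.norm_coe_le_norm k) hε.le)

/-- The derivative of a superposition operator is `pointwiseApply` after the superposition operator
of `fderiv ℝ f`. The induction therefore has to range over all target spaces, since it passes from
`G` to `E →L[ℝ] G`. -/
theorem contDiff_superposition_nat (n : ℕ) : ∀ {G : Type u} [NormedAddCommGroup G]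
    [NormedSpace ℝ G] (f : E → G) (hf : ContDiff ℝ ∞ f),
    ContDiff ℝ n (superposition (K := K) f hf.continuous) := by
  induction n with
  | zero => exact fun f hf => contDiff_zero.2 (continuous_superposition f hf.continuous)
  | succ n ih =>
    intro G _ _ f hf
    have h1 : ContDiff ℝ 1 f := hf.of_le (by exact_mod_cast le_top)
    have h2 : ContDiff ℝ ∞ (fderiv ℝ f) := hf.fderiv_right (by simp)
    have := contDiff_succ_iff_hasFDerivAt (𝕜 := ℝ) (n := n)
      (f := superposition (K := K) f hf.continuous)
    push_cast
    refine this.2 ⟨_, ?_, hasFDerivAt_superposition f h1⟩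
    exact pointwiseApply.contDiff.comp (ih (fderiv ℝ f) h2)

theorem contDiff_superposition (f : E → G) (hf : ContDiff ℝ ∞ f) :
    ContDiff ℝ ∞ (superposition (K := K) f hf.continuous) :=
  contDiff_infty.2 fun n => contDiff_superposition_nat n f hf

end Superposition

/-! ### Smooth local flows from the inverse function theorem -/

section Flow

variable {E : Type*} [NormedAddCommGroup E] [NormedSpace ℝ E] [CompleteSpace E]

/-- The primitive vanishing at `0` of a continuous function on the unit interval. -/
def unitPrimitive : C(unitInterval, E) →L[ℝ] C(unitInterval, E) :=
  LinearMap.mkContinuous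
    { toFun := fun β => ⟨fun s => ∫ τ in (0 : ℝ)..s, IccExtend zero_le_one β τ, by
        have h : Continuous fun s : ℝ => ∫ τ in (0 : ℝ)..s, IccExtend zero_le_one β τ :=
          intervalIntegral.continuous_primitive
            (fun a b => (β.2.Icc_extend').intervalIntegrable a b) 0
        exact h.comp continuous_subtype_val⟩
      map_add' := fun β β' => by
        ext s
        simp only [ContinuousMap.coe_mk, ContinuousMap.add_apply]
        exact intervalIntegral.integral_add (μ := MeasureTheory.volume)
          ((β.2.Icc_extend' (h := zero_le_one)).intervalIntegrable 0 s)
          ((β'.2.Icc_extend' (h := zero_le_one)).intervalIntegrable 0 s)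
      map_smul' := fun c β => by
        ext s
        simp only [ContinuousMap.coe_mk, ContinuousMap.smul_apply, RingHom.id_apply]
        exact intervalIntegral.integral_smul c _ } 1
    (fun β => by
      rw [one_mul, ContinuousMap.norm_le _ (norm_nonneg _)]
      intro s
      refine (intervalIntegral.norm_integral_le_of_norm_le_const (C := ‖β‖) ?_).trans ?_
      · exact fun x _ => β.norm_coe_le_norm _
      · have h0 := s.2.1
        have h1 := s.2.2
        rw [sub_zero, abs_of_nonneg h0]
        exact mul_le_of_le_one_right (norm_nonneg _) h1)

theorem unitPrimitive_apply (β : C(unitInterval, E)) (s : unitInterval) :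
    unitPrimitive β s = ∫ τ in (0 : ℝ)..s, IccExtend zero_le_one β τ := rfl

/-- The inclusion of the constant functions. -/
def constCLM : E →L[ℝ] C(unitInterval, E) :=
  LinearMap.mkContinuous
    { toFun := ContinuousMap.const unitInterval
      map_add' := fun _ _ => rfl
      map_smul' := fun _ _ => rfl } 1
    (fun x => by
      rw [one_mul, ContinuousMap.norm_le _ (norm_nonneg _)]
      exact fun _ => le_rfl)

@[simp]
theorem constCLM_apply (x : E) (s : unitInterval) : constCLM x s = x := rfl

/-- The map whose fibres over `((t, x), 0)` are the solutions of `α = x + t ∫ f ∘ α`. -/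
def picardMap (f : E → E) (hf : Continuous f) (u : (ℝ × E) × C(unitInterval, E)) :
    (ℝ × E) × C(unitInterval, E) :=
  (u.1, u.2 - constCLM u.1.2 - u.1.1 • unitPrimitive (superposition f hf u.2))

theorem contDiff_picardMap (f : E → E) (hf : ContDiff ℝ ∞ f) :
    ContDiff ℝ ∞ (picardMap f hf.continuous) := by
  have h1 : ContDiff ℝ ∞ (fun u : (ℝ × E) × C(unitInterval, E) =>
      unitPrimitive (superposition f hf.continuous u.2)) :=
    unitPrimitive.contDiff.comp ((contDiff_superposition f hf).comp contDiff_snd)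
  have h2 : ContDiff ℝ ∞ (fun u : (ℝ × E) × C(unitInterval, E) => constCLM u.1.2) :=
    (constCLM (E := E)).contDiff.comp
      (contDiff_snd.comp (contDiff_fst (E := ℝ × E) (F := C(unitInterval, E))))
  exact contDiff_fst.prodMk ((contDiff_snd.sub h2).sub ((contDiff_fst.comp contDiff_fst).smul h1))

/-- The derivative of `picardMap` at a constant path at time `0`. -/
def picardDeriv (c : C(unitInterval, E)) :
    ((ℝ × E) × C(unitInterval, E)) ≃L[ℝ] (ℝ × E) × C(unitInterval, E) :=
  ContinuousLinearEquiv.equivOfInverse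
    ((ContinuousLinearMap.fst ℝ (ℝ × E) C(unitInterval, E)).prod
      (ContinuousLinearMap.snd ℝ (ℝ × E) C(unitInterval, E)
        - constCLM ∘L (ContinuousLinearMap.snd ℝ ℝ E ∘L ContinuousLinearMap.fst ℝ (ℝ × E) _)
        - (ContinuousLinearMap.fst ℝ ℝ E ∘L ContinuousLinearMap.fst ℝ (ℝ × E) _).smulRight c))
    ((ContinuousLinearMap.fst ℝ (ℝ × E) C(unitInterval, E)).prod
      (ContinuousLinearMap.snd ℝ (ℝ × E) C(unitInterval, E)
        + constCLM ∘L (ContinuousLinearMap.snd ℝ ℝ E ∘L ContinuousLinearMap.fst ℝ (ℝ × E) _)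
        + (ContinuousLinearMap.fst ℝ ℝ E ∘L ContinuousLinearMap.fst ℝ (ℝ × E) _).smulRight c))
    (fun u => by ext <;> simp; abel) (fun u => by ext <;> simp; abel)

/-- At time 0 the factor `t` kills the derivative of the integral with respect to the path; only the
increment of `t` times the integral itself survives. The derivative is thus triangular with identity
blocks on the diagonal, hence invertible. -/
theorem hasFDerivAt_picardMap (f : E → E) (hf : ContDiff ℝ ∞ f) (x : E) :
    HasFDerivAt (picardMap f hf.continuous)
      (picardDeriv (unitPrimitive (superposition f hf.continuous (constCLM x))) :
        ((ℝ × E) × C(unitInterval, E)) →L[ℝ] _) ((0, x), constCLM x) := by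
  have h1 : ContDiff ℝ ∞ (fun u : (ℝ × E) × C(unitInterval, E) =>
      unitPrimitive (superposition f hf.continuous u.2)) :=
    unitPrimitive.contDiff.comp ((contDiff_superposition f hf).comp contDiff_snd)
  have h1' := ((h1.differentiable (by simp)) ((0, x), constCLM x)).hasFDerivAt
  have hl : HasFDerivAt (fun u : (ℝ × E) × C(unitInterval, E) => u.1.1)
      (ContinuousLinearMap.fst ℝ ℝ E ∘L ContinuousLinearMap.fst ℝ (ℝ × E) C(unitInterval, E))
      ((0, x), constCLM x) :=
    (ContinuousLinearMap.fst ℝ ℝ E ∘L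
      ContinuousLinearMap.fst ℝ (ℝ × E) C(unitInterval, E)).hasFDerivAt
  have hx : HasFDerivAt (fun u : (ℝ × E) × C(unitInterval, E) => constCLM u.1.2)
      (constCLM ∘L (ContinuousLinearMap.snd ℝ ℝ E ∘L
        ContinuousLinearMap.fst ℝ (ℝ × E) C(unitInterval, E))) ((0, x), constCLM x) :=
    (constCLM ∘L (ContinuousLinearMap.snd ℝ ℝ E ∘L
      ContinuousLinearMap.fst ℝ (ℝ × E) C(unitInterval, E))).hasFDerivAt
  refine (hasFDerivAt_fst.prodMk ((hasFDerivAt_snd.sub hx).sub (hl.smul h1'))).congr_fderiv ?_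
  ext u <;> simp [picardDeriv]

/-- Pointwise, the fixed-point equation is an integral equation, to which the fundamental theorem of
calculus applies. Time is rescaled to the unit interval, whence the factor `t` in the velocity. -/
theorem unitPrimitive_solution {f : E → E} (hf : Continuous f) {t : ℝ} {x : E}
    {α : C(unitInterval, E)}
    (h : α = constCLM x + t • unitPrimitive (superposition f hf α)) :
    ∀ s ∈ Icc (0 : ℝ) 1, HasDerivWithinAt (IccExtend zero_le_one α)
      (t • f (IccExtend zero_le_one α s)) (Icc 0 1) s := by
  intro s hs
  have hc : Continuous (IccExtend zero_le_one α) := α.2.Icc_extend'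
  have h1 : HasDerivAt (fun s : ℝ => x + t • ∫ τ in (0 : ℝ)..s, f (IccExtend zero_le_one α τ))
      (t • f (IccExtend zero_le_one α s)) s :=
    ((intervalIntegral.integral_hasDerivAt_right ((hf.comp hc).intervalIntegrable _ _)
      ((hf.comp hc).stronglyMeasurableAtFilter _ _) (hf.comp hc).continuousAt).const_smul
        t).const_add x
  refine h1.hasDerivWithinAt.congr_of_mem ?_ hs
  intro r hr
  rw [IccExtend_of_mem _ _ hr]
  conv_lhs => rw [h]
  rfl

theorem scaled_ode_unique {f : E → E} {K : NNReal}
    (hK : LipschitzWith K f) {t : ℝ} {α β : ℝ → E}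
    (hα : ∀ s ∈ Icc (0 : ℝ) 1, HasDerivWithinAt α (t • f (α s)) (Icc 0 1) s)
    (hβ : ∀ s ∈ Icc (0 : ℝ) 1, HasDerivWithinAt β (t • f (β s)) (Icc 0 1) s)
    (h0 : α 0 = β 0) : EqOn α β (Icc 0 1) := by
  refine ODE_solution_unique (v := fun _ y => t • f y) (K := ‖t‖₊ * K)
    (fun _ => (lipschitzWith_smul t).comp hK)
    (fun s hs => (hα s hs).continuousWithinAt) (fun s hs => ?_)
    (fun s hs => (hβ s hs).continuousWithinAt) (fun s hs => ?_) h0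
  · exact (hα s (Ico_subset_Icc_self hs)).mono_of_mem_nhdsWithin (Icc_mem_nhdsGE_of_mem hs)
  · exact (hβ s (Ico_subset_Icc_self hs)).mono_of_mem_nhdsWithin (Icc_mem_nhdsGE_of_mem hs)

/-- The slowed path r ↦ α(s r) starts at `x` and has velocity t s f, which is the equation for `β`;
uniqueness for Lipschitz fields identifies the two. This turns the parameter `t` of the fixed-point
problem into genuine time. -/
theorem picard_path_rescale {f : E → E} (hf : Continuous f) {K : NNReal} (hK : LipschitzWith K f)
    {t s : ℝ} (hs : s ∈ Icc (0 : ℝ) 1) {x : E} {α β : C(unitInterval, E)}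
    (hα : α = constCLM x + t • unitPrimitive (superposition f hf α))
    (hβ : β = constCLM x + (t * s) • unitPrimitive (superposition f hf β)) :
    β 1 = α ⟨s, hs⟩ := by
  have hα' := unitPrimitive_solution hf hα
  have hβ' := unitPrimitive_solution hf hβ
  have hmaps : MapsTo (fun r : ℝ => s * r) (Icc 0 1) (Icc 0 1) := fun r hr =>
    ⟨mul_nonneg hs.1 hr.1, mul_le_one₀ hs.2 hr.1 hr.2⟩
  have key := scaled_ode_unique hK (t := t * s)
    (α := fun r => IccExtend zero_le_one α (s * r)) (β := IccExtend zero_le_one β)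
    (fun r hr => by
      have h1 : HasDerivWithinAt (fun r : ℝ => s * r) s (Icc 0 1) r := by
        simpa using (hasDerivWithinAt_id r (Icc 0 1)).const_mul s
      have := (hα' (s * r) (hmaps hr)).scomp r h1 hmaps
      rwa [smul_smul, mul_comm s t] at this) hβ'
    (by
      have hz : (0 : ℝ) ∈ Icc (0 : ℝ) 1 := left_mem_Icc.2 zero_le_one
      have ea : α ⟨0, hz⟩ = x := by
        rw [hα]; simp [unitPrimitive_apply]
      have eb : β ⟨0, hz⟩ = x := by
        rw [hβ]; simp [unitPrimitive_apply]
      simp only [mul_zero]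
      rw [IccExtend_of_mem _ _ hz, IccExtend_of_mem _ _ hz, ea, eb])
  have h1 : (1 : ℝ) ∈ Icc (0 : ℝ) 1 := right_mem_Icc.2 zero_le_one
  have := key h1
  simp only [mul_one] at this
  rw [IccExtend_of_mem _ _ hs, IccExtend_of_mem _ _ h1] at this
  exact this.symm

/-- `picardMap` is a local diffeomorphism at the constant path, and the preimage of `(p, 0)` under
it is a solution of the fixed-point equation with parameters `p`. -/
theorem exists_contDiffOn_picard_paths {f : E → E} (hf : ContDiff ℝ ∞ f) (x₀ : E) :
    ∃ ε > 0, ∃ α : ℝ × E → C(unitInterval, E),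
      ContDiffOn ℝ ∞ α (Ioo (-ε) ε ×ˢ Metric.ball x₀ ε) ∧
      ∀ p ∈ Ioo (-ε) ε ×ˢ Metric.ball x₀ ε,
        α p = constCLM p.2 + p.1 • unitPrimitive (superposition f hf.continuous (α p)) := by
  set P := picardMap f hf.continuous with hP
  have hPs : ContDiff ℝ ∞ P := contDiff_picardMap f hf
  set u₀ : (ℝ × E) × C(unitInterval, E) := ((0, x₀), constCLM x₀) with hu₀
  have hder := hasFDerivAt_picardMap f hf x₀
  set φ := hPs.contDiffAt.toOpenPartialHomeomorph P hder (by simp) with hφ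
  have hφP : (φ : _ → _) = P := rfl
  have hmem : u₀ ∈ φ.source :=
    hPs.contDiffAt.mem_toOpenPartialHomeomorph_source hder (by simp)
  have hPu : P u₀ = ((0, x₀), 0) := by simp [hP, picardMap, hu₀]
  have htgt : ((0, x₀), 0) ∈ φ.target := by
    rw [← hPu, ← hφP]; exact φ.map_source hmem
  have hsymm : φ.symm ((0, x₀), 0) = u₀ := by
    rw [← hPu, ← hφP]; exact φ.left_inv hmem
  -- Invertibility of the derivative is an open condition. It is needed at all nearby points, not
  -- only at `u₀`, to make the local inverse smooth on a whole neighbourhood.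
  have hinv : ∀ᶠ u in 𝓝 u₀, (fderiv ℝ P u).IsInvertible := by
    have hc : ContinuousAt (fderiv ℝ P) u₀ := (hPs.continuous_fderiv (by simp)).continuousAt
    have h0 : fderiv ℝ P u₀ = _ := hder.fderiv
    have := hc.eventually (p := fun A => A.IsInvertible) (by
      rw [h0]
      exact (ContinuousLinearEquiv.nhds _))
    exact this
  have hev : ∀ᶠ w in 𝓝 (((0, x₀), 0) : (ℝ × E) × C(unitInterval, E)),
      w ∈ φ.target ∧ (fderiv ℝ P (φ.symm w)).IsInvertible := by
    refine Filter.Eventually.and (φ.open_target.mem_nhds htgt) ?_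
    exact (φ.continuousAt_symm htgt).eventually (by rw [hsymm]; exact hinv)
  have hcont : ContinuousAt (fun p : ℝ × E => (p, (0 : C(unitInterval, E)))) (0, x₀) := by
    fun_prop
  have hev' := hcont.eventually hev
  obtain ⟨ε, hε, hball⟩ := Metric.eventually_nhds_iff_ball.1 hev'
  have hsub : ∀ p ∈ Ioo (-ε) ε ×ˢ Metric.ball x₀ ε, p ∈ Metric.ball ((0 : ℝ), x₀) ε := by
    rintro ⟨t, x⟩ ⟨ht, hx⟩
    rw [← ball_prod_same, Real.ball_eq_Ioo]
    simpa using And.intro ht hx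
  refine ⟨ε, hε, fun p => (φ.symm (p, 0)).2, ?_, ?_⟩
  · intro p hp
    obtain ⟨h1, A, hA⟩ := hball p (hsub p hp)
    have h2 : ContDiffAt ℝ ∞ φ.symm (p, 0) :=
      φ.contDiffAt_symm (f₀' := A) h1 (by
        rw [hA]
        exact ((hPs.differentiable (by simp)) _).hasFDerivAt) hPs.contDiffAt
    have h3 : ContDiffAt ℝ ∞ (fun p : ℝ × E => (p, (0 : C(unitInterval, E)))) p :=
      contDiffAt_id.prodMk contDiffAt_const
    exact (contDiffAt_snd.comp p (h2.comp p h3)).contDiffWithinAt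
  · intro p hp
    obtain ⟨h1, -⟩ := hball p (hsub p hp)
    have h2 : P (φ.symm (p, 0)) = (p, 0) := φ.right_inv h1
    have h3 : (φ.symm (p, 0)).1 = p := congrArg Prod.fst h2
    have h4 := congrArg Prod.snd h2
    simp only [hP, picardMap] at h4
    rw [h3, sub_sub, sub_eq_zero] at h4
    exact h4

/-- The flow is the endpoint `s = 1` of the Picard path, and evaluation is continuous linear, so
smoothness is inherited from the paths. -/
theorem exists_contDiffOn_flow_of_lipschitz {f : E → E} (hf : ContDiff ℝ ∞ f) {K : NNReal}
    (hK : LipschitzWith K f) (x₀ : E) :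
    ∃ ε > 0, ∃ Θ : ℝ × E → E, ContDiffOn ℝ ∞ Θ (Ioo (-ε) ε ×ˢ Metric.ball x₀ ε) ∧
      ∀ x ∈ Metric.ball x₀ ε, Θ (0, x) = x ∧
        ∀ t ∈ Ioo (-ε) ε, HasDerivAt (fun t => Θ (t, x)) (f (Θ (t, x))) t := by
  obtain ⟨ε, hε, α, hα, hsol⟩ := exists_contDiffOn_picard_paths hf x₀
  have hΘ : ContDiffOn ℝ ∞ (fun p => α p 1) (Ioo (-ε) ε ×ˢ Metric.ball x₀ ε) :=
    (ContinuousMap.evalCLM (M := E) ℝ (1 : unitInterval)).contDiff.comp_contDiffOn hα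
  refine ⟨ε, hε, fun p => α p 1, hΘ, fun x hx => ⟨?_, fun t ht => ?_⟩⟩
  · have := congrArg (fun β : C(unitInterval, E) => β 1)
      (hsol (0, x) ⟨by simpa using hε, hx⟩)
    simpa using this
  · have hc : ContinuousOn (fun t => f (α (t, x) 1)) (Ioo (-ε) ε) :=
      hf.continuous.comp_continuousOn (hΘ.continuousOn.comp (by fun_prop)
        (fun t ht => ⟨ht, hx⟩))
    -- By rescaling, the path at time `s` is the endpoint for the parameter `t * s`. The
    -- substitution τ = t s turns the Picard equation into the integral equation of the flow in `t`.
    have hint : ∀ t ∈ Ioo (-ε) ε, α (t, x) 1 = x + ∫ τ in (0 : ℝ)..t, f (α (τ, x) 1) := by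
      intro t ht
      have h1 := congrArg (fun β : C(unitInterval, E) => β 1) (hsol (t, x) ⟨ht, hx⟩)
      simp only [ContinuousMap.add_apply, constCLM_apply, ContinuousMap.smul_apply,
        unitPrimitive_apply] at h1
      rw [h1]
      congr 1
      have h2 : ∫ τ in (0 : ℝ)..(1 : unitInterval),
          IccExtend zero_le_one (superposition f hf.continuous (α (t, x))) τ
          = ∫ τ in (0 : ℝ)..1, f (α (t * τ, x) 1) := by
        refine intervalIntegral.integral_congr fun s hs => ?_
        rw [uIcc_of_le (by simp)] at hs
        have hs' : s ∈ Icc (0 : ℝ) 1 := hs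
        have hts : t * s ∈ Ioo (-ε) ε := by
          rw [mem_Ioo, ← abs_lt] at ht ⊢
          rw [abs_mul, abs_of_nonneg hs'.1]
          exact (mul_le_of_le_one_right (abs_nonneg t) hs'.2).trans_lt ht
        simp only [IccExtend_of_mem _ _ hs']
        have := picard_path_rescale hf.continuous hK hs' (hsol (t, x) ⟨ht, hx⟩)
          (hsol (t * s, x) ⟨hts, hx⟩)
        simp only [this]
        rfl
      rw [h2]
      have := intervalIntegral.smul_integral_comp_mul_left (a := 0) (b := 1)
        (fun τ => f (α (τ, x) 1)) t
      simpa using this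
    have hnhds : Ioo (-ε) ε ∈ 𝓝 t := Ioo_mem_nhds ht.1 ht.2
    have hd : HasDerivAt (fun t => x + ∫ τ in (0 : ℝ)..t, f (α (τ, x) 1)) (f (α (t, x) 1)) t := by
      have hsub : uIcc 0 t ⊆ Ioo (-ε) ε := by
        intro r hr
        rcases le_total 0 t with h | h
        · rw [uIcc_of_le h] at hr
          exact ⟨by linarith [hr.1], hr.2.trans_lt ht.2⟩
        · rw [uIcc_of_ge h] at hr
          exact ⟨ht.1.trans_le hr.1, by linarith [hr.2]⟩
      exact (intervalIntegral.integral_hasDerivAt_right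
        ((hc.mono hsub).intervalIntegrable)
        (hc.stronglyMeasurableAtFilter isOpen_Ioo t ht) (hc.continuousAt hnhds)).const_add x
    refine hd.congr_of_eventuallyEq ?_
    filter_upwards [hnhds] with t ht using hint t ht

/-- Local flows of smooth vector fields on open sets are smooth. -/
theorem exists_contDiffOn_flow [FiniteDimensional ℝ E] {f : E → E} {Ω : Set E} (hΩ : IsOpen Ω)
    (hf : ContDiffOn ℝ ∞ f Ω) {x₀ : E} (hx₀ : x₀ ∈ Ω) :
    ∃ ε > 0, ∃ Θ : ℝ × E → E, ContDiffOn ℝ ∞ Θ (Ioo (-ε) ε ×ˢ Metric.ball x₀ ε) ∧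
      ∀ x ∈ Metric.ball x₀ ε, Θ (0, x) = x ∧
        ∀ t ∈ Ioo (-ε) ε, Θ (t, x) ∈ Ω ∧ HasDerivAt (fun t => Θ (t, x)) (f (Θ (t, x))) t := by
  obtain ⟨r, hr, hrΩ⟩ := Metric.isOpen_iff.1 hΩ x₀ hx₀
  -- Cutting `f` off inside `Ω` makes it compactly supported, hence globally Lipschitz. Only the
  -- inner ball of radius `r / 4`, where the cutoff is 1, matters later.
  let χ : ContDiffBump x₀ := ⟨r / 4, r / 2, by positivity, by linarith⟩
  have hsupp : tsupport χ ⊆ Ω := by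
    rw [χ.tsupport_eq]
    exact (Metric.closedBall_subset_ball (by simp only [χ]; linarith)).trans hrΩ
  have hg : ContDiff ℝ ∞ (fun x => χ x • f x) := by
    rw [contDiff_iff_contDiffAt]
    intro x
    by_cases hx : x ∈ tsupport χ
    · exact χ.contDiffAt.smul (hf.contDiffAt (hΩ.mem_nhds (hsupp hx)))
    · refine contDiffAt_const (c := (0 : E)) |>.congr_of_eventuallyEq ?_
      filter_upwards [(isClosed_tsupport χ).isOpen_compl.mem_nhds hx] with y hy
      rw [image_eq_zero_of_notMem_tsupport hy, zero_smul]
  have hcs : HasCompactSupport (fun x => χ x • f x) := χ.hasCompactSupport.smul_right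
  obtain ⟨K, hK⟩ := hg.lipschitzWith_of_hasCompactSupport hcs (by simp)
  obtain ⟨ε, hε, Θ, hΘ, hflow⟩ := exists_contDiffOn_flow_of_lipschitz hg hK x₀
  have hΘ0 : Θ (0, x₀) = x₀ := (hflow x₀ (Metric.mem_ball_self hε)).1
  have hopen : IsOpen (Ioo (-ε) ε ×ˢ Metric.ball x₀ ε) := isOpen_Ioo.prod Metric.isOpen_ball
  have hmem : ((0 : ℝ), x₀) ∈ Ioo (-ε) ε ×ˢ Metric.ball x₀ ε :=
    ⟨by simpa using hε, Metric.mem_ball_self hε⟩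
  have hcont : ContinuousAt Θ (0, x₀) := hΘ.continuousOn.continuousAt (hopen.mem_nhds hmem)
  -- After shrinking, trajectories stay where the cutoff equals 1, so they are trajectories of `f`
  -- itself.
  have hev : ∀ᶠ p in 𝓝 ((0 : ℝ), x₀), Θ p ∈ Metric.ball x₀ (r / 4) :=
    hcont.eventually (by rw [hΘ0]; exact Metric.ball_mem_nhds _ (by positivity))
  obtain ⟨ε', hε', hball⟩ := Metric.eventually_nhds_iff_ball.1 hev
  have hle : Ioo (-min ε ε') (min ε ε') ×ˢ Metric.ball x₀ (min ε ε') ⊆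
      Ioo (-ε) ε ×ˢ Metric.ball x₀ ε :=
    prod_mono (Ioo_subset_Ioo (neg_le_neg (min_le_left _ _)) (min_le_left _ _))
      (Metric.ball_subset_ball (min_le_left _ _))
  refine ⟨min ε ε', lt_min hε hε', Θ, hΘ.mono hle, fun x hx => ?_⟩
  have hx' : x ∈ Metric.ball x₀ ε := Metric.ball_subset_ball (min_le_left _ _) hx
  refine ⟨(hflow x hx').1, fun t ht => ?_⟩
  have hb : Θ (t, x) ∈ Metric.ball x₀ (r / 4) := by
    apply hball
    rw [← ball_prod_same, Real.ball_eq_Ioo]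
    refine ⟨?_, Metric.ball_subset_ball (min_le_right _ _) hx⟩
    rw [zero_sub, zero_add]
    exact Ioo_subset_Ioo (neg_le_neg (min_le_right _ _)) (min_le_right _ _) ht
  refine ⟨hrΩ (Metric.ball_subset_ball (by linarith) hb), ?_⟩
  have := (hflow x hx').2 t (hle (show (t, x) ∈ _ from ⟨ht, hx⟩)).1
  rwa [χ.one_of_mem_closedBall (Metric.ball_subset_closedBall hb), one_smul] at this

end Flow

namespace PushforwardBundle

/-! ### Tangent vectors of the total space of a vector bundle -/

section TotalSpace

variable {EZ : Type*} [NormedAddCommGroup EZ] [NormedSpace ℝ EZ]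
  {Z : Type*} [TopologicalSpace Z] [ChartedSpace EZ Z] [IsManifold 𝓘(ℝ, EZ) ∞ Z]
  {FF : Type*} [NormedAddCommGroup FF] [NormedSpace ℝ FF]
  {F : Z → Type*} [TopologicalSpace (TotalSpace FF F)] [∀ z, TopologicalSpace (F z)]
  [∀ z, AddCommGroup (F z)] [∀ z, Module ℝ (F z)]
  [FiberBundle FF F] [VectorBundle ℝ FF F] [ContMDiffVectorBundle ∞ FF F 𝓘(ℝ, EZ)]

/-- Points in one fibre are separated in a trivialization, the others in the base. Uniqueness of
integral curves in `F` relies on this. -/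
theorem t2Space_totalSpace [T2Space Z] : T2Space (TotalSpace FF F) := by
  refine ⟨fun v w hvw => ?_⟩
  have hπ : Continuous (π FF F) := FiberBundle.continuous_proj FF F
  by_cases h : v.proj = w.proj
  · set e := trivializationAt FF F v.proj
    have hv : v ∈ e.source := FiberBundle.mem_trivializationAt_proj_source
    have hw : w ∈ e.source := by rw [e.mem_source, ← h]; exact e.mem_source.1 hv
    have hne : e v ≠ e w := fun h' => hvw (e.toOpenPartialHomeomorph.injOn hv hw h')
    obtain ⟨s, t, hs, ht, hvs, hwt, hst⟩ := t2_separation hne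
    refine ⟨_, _, e.continuousOn.isOpen_inter_preimage e.open_source hs,
      e.continuousOn.isOpen_inter_preimage e.open_source ht, ⟨hv, hvs⟩, ⟨hw, hwt⟩, ?_⟩
    rw [Set.disjoint_left] at hst ⊢
    exact fun x hx hx' => hst hx.2 hx'.2
  · obtain ⟨s, t, hs, ht, hvs, hwt, hst⟩ := t2_separation h
    exact ⟨_, _, hs.preimage hπ, ht.preimage hπ, hvs, hwt, hst.preimage _⟩

/-- The derivative of the fibre coordinate of the trivialization `e`. -/
def fibDeriv (e : Trivialization FF (π FF F)) (v : TotalSpace FF F)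
    (ξ : TangentSpace (𝓘(ℝ, EZ).prod 𝓘(ℝ, FF)) v) : FF :=
  mfderiv (𝓘(ℝ, EZ).prod 𝓘(ℝ, FF)) 𝓘(ℝ, FF) (fun y : TotalSpace FF F => (e y).2) v ξ

/-- The derivative of the bundle projection. -/
def projDeriv (v : TotalSpace FF F)
    (ξ : TangentSpace (𝓘(ℝ, EZ).prod 𝓘(ℝ, FF)) v) : TangentSpace 𝓘(ℝ, EZ) v.proj :=
  mfderiv (𝓘(ℝ, EZ).prod 𝓘(ℝ, FF)) 𝓘(ℝ, EZ) (fun y : TotalSpace FF F => y.proj) v ξ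

/-- The tangent vector at `v` with prescribed projection and fibre coordinate. -/
def tangentOf (e : Trivialization FF (π FF F)) (v : TotalSpace FF F)
    (X : TangentSpace 𝓘(ℝ, EZ) v.proj) (c : FF) :
    TangentSpace (𝓘(ℝ, EZ).prod 𝓘(ℝ, FF)) v :=
  (mfderiv (𝓘(ℝ, EZ).prod 𝓘(ℝ, FF)) (𝓘(ℝ, EZ).prod 𝓘(ℝ, FF))
    e.toOpenPartialHomeomorph.symm (v.proj, (e v).2) ((X, c) : EZ × FF) : EZ × FF)

variable (e : Trivialization FF (π FF F)) [MemTrivializationAtlas e]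

theorem contMDiffAt_fibCoord {v : TotalSpace FF F} (hv : v.proj ∈ e.baseSet) :
    ContMDiffAt (𝓘(ℝ, EZ).prod 𝓘(ℝ, FF)) 𝓘(ℝ, FF) ∞ (fun y : TotalSpace FF F => (e y).2) v :=
  ((e.contMDiffAt_iff (IB := 𝓘(ℝ, EZ)) (n := ∞) (f := id) (e.mem_source.2 hv)).1
    contMDiffAt_id).2

theorem mdifferentiableAt_fibCoord {v : TotalSpace FF F} (hv : v.proj ∈ e.baseSet) :
    MDifferentiableAt (𝓘(ℝ, EZ).prod 𝓘(ℝ, FF)) 𝓘(ℝ, FF) (fun y : TotalSpace FF F => (e y).2) v :=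
  (contMDiffAt_fibCoord e hv).mdifferentiableAt (by simp)

theorem mdifferentiableAt_proj' (v : TotalSpace FF F) :
    MDifferentiableAt (𝓘(ℝ, EZ).prod 𝓘(ℝ, FF)) 𝓘(ℝ, EZ) (fun y : TotalSpace FF F => y.proj) v :=
  Bundle.mdifferentiableAt_proj F

theorem mdifferentiableAt_triv_symm {z : Z} (hz : z ∈ e.baseSet) (c : FF) :
    MDifferentiableAt (𝓘(ℝ, EZ).prod 𝓘(ℝ, FF)) (𝓘(ℝ, EZ).prod 𝓘(ℝ, FF))
      e.toOpenPartialHomeomorph.symm (z, c) :=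
  ((e.contMDiffOn_symm (IB := 𝓘(ℝ, EZ)) (n := ∞)).contMDiffAt
    (e.open_target.mem_nhds (e.mem_target.2 hz))).mdifferentiableAt (by simp)

variable {e}

/-- The chain rule for the composition of a trivialization with its inverse, which is the identity
near `v`. -/
theorem tangentOf_projDeriv_fibDeriv {v : TotalSpace FF F} (hv : v.proj ∈ e.baseSet)
    (ξ : TangentSpace (𝓘(ℝ, EZ).prod 𝓘(ℝ, FF)) v) :
    tangentOf e v (projDeriv v ξ) (fibDeriv e v ξ) = ξ := by
  have h1 : HasMFDerivAt (𝓘(ℝ, EZ).prod 𝓘(ℝ, FF)) (𝓘(ℝ, EZ).prod 𝓘(ℝ, FF))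
      (fun y : TotalSpace FF F => (y.proj, (e y).2)) v _ :=
    (mdifferentiableAt_proj' (EZ := EZ) v).hasMFDerivAt.prodMk
      (mdifferentiableAt_fibCoord (EZ := EZ) e hv).hasMFDerivAt
  have h2 := (mdifferentiableAt_triv_symm (EZ := EZ) e hv (e v).2).hasMFDerivAt
  have h3 := HasMFDerivAt.comp v h2 h1
  have h4 : (e.toOpenPartialHomeomorph.symm ∘ fun y : TotalSpace FF F => (y.proj, (e y).2))
      =ᶠ[𝓝 v] id := by
    filter_upwards [e.open_source.mem_nhds (e.mem_source.2 hv)] with y hy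
    exact e.symm_apply_mk_proj hy
  have h5 := (h3.congr_of_eventuallyEq h4.symm).mfderiv
  rw [mfderiv_id] at h5
  have h6 := congrArg (fun A => A ξ) h5
  exact h6.symm

/-- The working principle for all identities in the tangent bundle of `F`: compare the projections
to `TZ` and the derivatives of one fibre coordinate. -/
theorem tangent_ext {v : TotalSpace FF F} (hv : v.proj ∈ e.baseSet)
    {ξ η : TangentSpace (𝓘(ℝ, EZ).prod 𝓘(ℝ, FF)) v} (h1 : projDeriv v ξ = projDeriv v η)
    (h2 : fibDeriv e v ξ = fibDeriv e v η) : ξ = η := by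
  rw [← tangentOf_projDeriv_fibDeriv hv ξ, h1, h2, tangentOf_projDeriv_fibDeriv hv]

theorem projDeriv_add (v : TotalSpace FF F) (ξ η : TangentSpace (𝓘(ℝ, EZ).prod 𝓘(ℝ, FF)) v) :
    projDeriv v (ξ + η) = projDeriv v ξ + projDeriv v η := map_add _ _ _

theorem projDeriv_sub (v : TotalSpace FF F) (ξ η : TangentSpace (𝓘(ℝ, EZ).prod 𝓘(ℝ, FF)) v) :
    projDeriv v (ξ - η) = projDeriv v ξ - projDeriv v η := map_sub _ _ _

theorem projDeriv_smul (v : TotalSpace FF F) (c : ℝ)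
    (ξ : TangentSpace (𝓘(ℝ, EZ).prod 𝓘(ℝ, FF)) v) :
    projDeriv v (c • ξ) = c • projDeriv v ξ := map_smul _ _ _

theorem fibDeriv_add (v : TotalSpace FF F) (ξ η : TangentSpace (𝓘(ℝ, EZ).prod 𝓘(ℝ, FF)) v) :
    fibDeriv e v (ξ + η) = fibDeriv e v ξ + fibDeriv e v η :=
  map_add (mfderiv (𝓘(ℝ, EZ).prod 𝓘(ℝ, FF)) 𝓘(ℝ, FF) (fun y : TotalSpace FF F => (e y).2) v) _ _

theorem fibDeriv_sub (v : TotalSpace FF F) (ξ η : TangentSpace (𝓘(ℝ, EZ).prod 𝓘(ℝ, FF)) v) :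
    fibDeriv e v (ξ - η) = fibDeriv e v ξ - fibDeriv e v η :=
  map_sub (mfderiv (𝓘(ℝ, EZ).prod 𝓘(ℝ, FF)) 𝓘(ℝ, FF) (fun y : TotalSpace FF F => (e y).2) v) _ _

theorem fibDeriv_smul (v : TotalSpace FF F) (c : ℝ)
    (ξ : TangentSpace (𝓘(ℝ, EZ).prod 𝓘(ℝ, FF)) v) :
    fibDeriv e v (c • ξ) = c • fibDeriv e v ξ :=
  map_smul (mfderiv (𝓘(ℝ, EZ).prod 𝓘(ℝ, FF)) 𝓘(ℝ, FF) (fun y : TotalSpace FF F => (e y).2) v) _ _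

/-! Velocities of maps into the total space -/

section Maps

variable {EN HN : Type*} [NormedAddCommGroup EN] [NormedSpace ℝ EN] [TopologicalSpace HN]
  {IN : ModelWithCorners ℝ EN HN} {N : Type*} [TopologicalSpace N] [ChartedSpace HN N]

theorem projDeriv_mfderiv {f : N → TotalSpace FF F} {n : N}
    (hf : MDifferentiableAt IN (𝓘(ℝ, EZ).prod 𝓘(ℝ, FF)) f n) (X : TangentSpace IN n) :
    projDeriv (f n) (mfderiv IN (𝓘(ℝ, EZ).prod 𝓘(ℝ, FF)) f n X) =
      mfderiv IN 𝓘(ℝ, EZ) (fun n => (f n).proj) n X := by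
  have := mfderiv_comp n (mdifferentiableAt_proj' (EZ := EZ) (f n)) hf
  exact (congrArg (fun A => A X) this).symm

theorem fibDeriv_mfderiv {f : N → TotalSpace FF F} {n : N}
    (hf : MDifferentiableAt IN (𝓘(ℝ, EZ).prod 𝓘(ℝ, FF)) f n) (hn : (f n).proj ∈ e.baseSet)
    (X : TangentSpace IN n) :
    fibDeriv e (f n) (mfderiv IN (𝓘(ℝ, EZ).prod 𝓘(ℝ, FF)) f n X) =
      mfderiv IN 𝓘(ℝ, FF) (fun n => (e (f n)).2) n X := by
  have := mfderiv_comp n (mdifferentiableAt_fibCoord (EZ := EZ) e hn) hf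
  exact (congrArg (fun A => A X) this).symm

end Maps

theorem mdifferentiableAt_vertCurve {z : Z} (v w : F z) :
    MDifferentiableAt 𝓘(ℝ, ℝ) (𝓘(ℝ, EZ).prod 𝓘(ℝ, FF))
      (fun t : ℝ => (⟨z, v + t • w⟩ : TotalSpace FF F)) 0 := by
  set e := trivializationAt FF F z
  have hz : z ∈ e.baseSet := FiberBundle.mem_baseSet_trivializationAt' z
  rw [e.mdifferentiableAt_totalSpace_iff 𝓘(ℝ, EZ) _ (e.mem_source.2 hz)]
  refine ⟨mdifferentiableAt_const, ?_⟩
  have : (fun t : ℝ => (e ⟨z, v + t • w⟩).2) = fun t : ℝ => (e ⟨z, v⟩).2 + t • (e ⟨z, w⟩).2 := by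
    ext t
    rw [(e.linear ℝ hz).map_add, (e.linear ℝ hz).map_smul]
  rw [this, mdifferentiableAt_iff_differentiableAt]
  fun_prop

theorem projDeriv_vertLift {z : Z} (v w : F z) :
    projDeriv (⟨z, v⟩ : TotalSpace FF F) (vertLift EZ FF v w) = 0 := by
  have h0 : (⟨z, v + (0 : ℝ) • w⟩ : TotalSpace FF F) = ⟨z, v⟩ := by simp
  have h := projDeriv_mfderiv (mdifferentiableAt_vertCurve (EZ := EZ) (FF := FF) v w) (1 : ℝ)
  have hc : mfderiv 𝓘(ℝ, ℝ) 𝓘(ℝ, EZ)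
      (fun t : ℝ => (⟨z, v + t • w⟩ : TotalSpace FF F).proj) 0 = 0 := mfderiv_const
  rw [hc] at h
  -- The velocity sits at `⟨z, v + 0 • w⟩`, which equals `⟨z, v⟩` only propositionally. All these
  -- tangent spaces are `EZ × FF` by definition, so the base point can be generalized and
  -- substituted.
  have key : ∀ (y y' : TotalSpace FF F) (hw : y = y') (ξ : EZ × FF),
      (projDeriv (EZ := EZ) y ξ : EZ) = (projDeriv (EZ := EZ) y' ξ : EZ) := by
    rintro w _ rfl ξ; rfl
  exact (key _ _ h0 _).symm.trans h

theorem fibDeriv_vertLift {z : Z} (hz : z ∈ e.baseSet) (v w : F z) :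
    fibDeriv e (⟨z, v⟩ : TotalSpace FF F) (vertLift EZ FF v w) = (e ⟨z, w⟩).2 := by
  have h0 : (⟨z, v + (0 : ℝ) • w⟩ : TotalSpace FF F) = ⟨z, v⟩ := by simp
  have h := fibDeriv_mfderiv (e := e) (mdifferentiableAt_vertCurve (EZ := EZ) (FF := FF) v w)
    hz (1 : ℝ)
  have hc : HasDerivAt (fun t : ℝ => (e ⟨z, v + t • w⟩).2) (e ⟨z, w⟩).2 0 := by
    have : (fun t : ℝ => (e ⟨z, v + t • w⟩).2) =
        fun t : ℝ => (e ⟨z, v⟩).2 + t • (e ⟨z, w⟩).2 := by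
      ext t
      rw [(e.linear ℝ hz).map_add, (e.linear ℝ hz).map_smul]
    rw [this]
    simpa using ((hasDerivAt_id (0 : ℝ)).smul_const (e ⟨z, w⟩).2).const_add (e ⟨z, v⟩).2
  have key : ∀ (y y' : TotalSpace FF F) (hw : y = y') (ξ : EZ × FF),
      fibDeriv (EZ := EZ) e y ξ = fibDeriv (EZ := EZ) e y' ξ := by
    rintro w _ rfl ξ; rfl
  refine (key _ _ h0 _).symm.trans (h.trans ?_)
  rw [mfderiv_eq_fderiv]
  exact hc.deriv

theorem vertLift_injective {z : Z} {v w w' : F z}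
    (h : vertLift EZ FF v w = vertLift EZ FF v w') : w = w' := by
  set e := trivializationAt FF F z
  have hz : z ∈ e.baseSet := FiberBundle.mem_baseSet_trivializationAt' z
  have h1 := congrArg (fibDeriv (EZ := EZ) e (⟨z, v⟩ : TotalSpace FF F)) h
  rw [fibDeriv_vertLift hz, fibDeriv_vertLift hz] at h1
  exact (e.linearEquivAt ℝ z hz).injective h1

/-- A vector with zero projection is determined by its fibre coordinate, and a linear trivialization
realizes every such coordinate by an element of `F z`. -/
theorem exists_vertLift_eq {z : Z} {v : F z}
    {ξ : TangentSpace (𝓘(ℝ, EZ).prod 𝓘(ℝ, FF)) (⟨z, v⟩ : TotalSpace FF F)}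
    (h : projDeriv (⟨z, v⟩ : TotalSpace FF F) ξ = 0) : ∃ w : F z, vertLift EZ FF v w = ξ := by
  set e := trivializationAt FF F z
  have hz : z ∈ e.baseSet := FiberBundle.mem_baseSet_trivializationAt' z
  refine ⟨(e.linearEquivAt ℝ z hz).symm (fibDeriv e _ ξ), tangent_ext (e := e) hz ?_ ?_⟩
  · rw [projDeriv_vertLift, h]
  · rw [fibDeriv_vertLift hz]
    exact (e.linearEquivAt ℝ z hz).apply_symm_apply _

theorem vertLift_neg {z : Z} (v w : F z) : vertLift EZ FF v (-w) = - vertLift EZ FF v w := by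
  set e := trivializationAt FF F z
  have hz : z ∈ e.baseSet := FiberBundle.mem_baseSet_trivializationAt' z
  refine tangent_ext (e := e) hz ?_ ?_
  · rw [← zero_sub (vertLift EZ FF v w), projDeriv_sub, projDeriv_vertLift, projDeriv_vertLift,
      sub_zero]
    exact (map_zero _).symm
  · rw [← zero_sub (vertLift EZ FF v w), fibDeriv_sub, fibDeriv_vertLift hz, fibDeriv_vertLift hz,
      (e.linear ℝ hz).map_neg]
    have : fibDeriv (EZ := EZ) e (⟨z, v⟩ : TotalSpace FF F) 0 = 0 :=
      map_zero (mfderiv (𝓘(ℝ, EZ).prod 𝓘(ℝ, FF)) 𝓘(ℝ, FF)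
        (fun y : TotalSpace FF F => (e y).2) _)
    rw [this, zero_sub]

end TotalSpace

/-! ### Derivatives of smooth maps and smooth families of linear maps -/

section General

variable {E₁ H₁ : Type*} [NormedAddCommGroup E₁] [NormedSpace ℝ E₁] [TopologicalSpace H₁]
  {I₁ : ModelWithCorners ℝ E₁ H₁} {M₁ : Type*} [TopologicalSpace M₁] [ChartedSpace H₁ M₁]
  [IsManifold I₁ ∞ M₁]
  {E₂ H₂ : Type*} [NormedAddCommGroup E₂] [NormedSpace ℝ E₂] [TopologicalSpace H₂]
  {I₂ : ModelWithCorners ℝ E₂ H₂} {M₂ : Type*} [TopologicalSpace M₂] [ChartedSpace H₂ M₂]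
  [IsManifold I₂ ∞ M₂]
  {E₃ H₃ : Type*} [NormedAddCommGroup E₃] [NormedSpace ℝ E₃] [TopologicalSpace H₃]
  {I₃ : ModelWithCorners ℝ E₃ H₃} {M₃ : Type*} [TopologicalSpace M₃] [ChartedSpace H₃ M₃]

theorem contMDiffAt_tangentMap_of_isOpen {f : M₁ → M₂} {s : Set M₁} (hs : IsOpen s)
    (hf : ContMDiffOn I₁ I₂ ∞ f s) {p : TangentBundle I₁ M₁} (hp : p.1 ∈ s) :
    ContMDiffAt I₁.tangent I₂.tangent ∞ (tangentMap I₁ I₂ f) p := by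
  have h1 := hf.contMDiffOn_tangentMapWithin (m := ∞) (by simp) hs.uniqueMDiffOn
  have hpre : π E₁ (TangentSpace I₁) ⁻¹' s ∈ 𝓝 p :=
    (hs.preimage (FiberBundle.continuous_proj E₁ (TangentSpace I₁))).mem_nhds hp
  refine (h1.contMDiffAt hpre).congr_of_eventuallyEq ?_
  filter_upwards [hpre] with q hq
  simp only [tangentMap, tangentMapWithin, mfderivWithin_of_isOpen hs hq]

theorem contMDiffAt_mfderiv_apply {f : M₁ → E₂} {s : Set M₁} (hs : IsOpen s)
    (hf : ContMDiffOn I₁ 𝓘(ℝ, E₂) ∞ f s) {g : M₃ → TangentBundle I₁ M₁} {x : M₃}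
    (hg : ContMDiffAt I₃ I₁.tangent ∞ g x) (hx : (g x).1 ∈ s) :
    ContMDiffAt I₃ 𝓘(ℝ, E₂) ∞
      (fun x => (mfderiv I₁ 𝓘(ℝ, E₂) f (g x).1 (g x).2 : E₂)) x := by
  have h1 := (contMDiffAt_tangentMap_of_isOpen hs hf hx).comp x hg
  exact ((contMDiff_snd_tangentBundle_modelSpace E₂ 𝓘(ℝ, E₂)).contMDiffAt).comp x h1

variable {𝕂 : Type*} [RCLike 𝕂]
  {F₁ : Type*} [NormedAddCommGroup F₁] [NormedSpace ℝ F₁] [NormedSpace 𝕂 F₁]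
  [IsScalarTower ℝ 𝕂 F₁] [FiniteDimensional ℝ F₁]
  {F₂ : Type*} [NormedAddCommGroup F₂] [NormedSpace ℝ F₂] [NormedSpace 𝕂 F₂]
  [IsScalarTower ℝ 𝕂 F₂]

theorem finiteDimensional_of_real : FiniteDimensional 𝕂 F₁ := FiniteDimensional.right ℝ 𝕂 F₁

variable (𝕂) in
/-- A linear map on a finite-dimensional space, reconstructed from its values on a basis. -/
def clmOf (α : F₁ → F₂) : F₁ →L[𝕂] F₂ :=
  haveI : FiniteDimensional 𝕂 F₁ := finiteDimensional_of_real
  ∑ i, (LinearMap.toContinuousLinearMap ((Module.finBasis 𝕂 F₁).coord i)).smulRight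
    (α (Module.finBasis 𝕂 F₁ i))

theorem clmOf_apply {α : F₁ → F₂} (h : IsLinearMap 𝕂 α) (c : F₁) : clmOf 𝕂 α c = α c := by
  have : FiniteDimensional 𝕂 F₁ := finiteDimensional_of_real
  conv_rhs => rw [← (Module.finBasis 𝕂 F₁).sum_repr c]
  have := map_sum (h.mk' α) (fun i => (Module.finBasis 𝕂 F₁).repr c i • Module.finBasis 𝕂 F₁ i)
    Finset.univ
  simp only [IsLinearMap.mk'_apply] at this
  rw [this, clmOf, sum_apply]
  refine Finset.sum_congr rfl fun i _ => ?_
  rw [h.map_smul]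
  rfl

/-- `clmOf` uses only finitely many values of the family, each entering through a continuous linear
map. Smoothness in the operator space therefore follows from smoothness on vectors. -/
theorem contMDiffAt_clmOf {α : M₃ → F₁ → F₂} {x : M₃}
    (h : ∀ c, ContMDiffAt I₃ 𝓘(ℝ, F₂) ∞ (fun y => α y c) x) :
    ContMDiffAt I₃ 𝓘(ℝ, F₁ →L[𝕂] F₂) ∞ (fun y => clmOf 𝕂 (α y)) x := by
  have : FiniteDimensional 𝕂 F₁ := finiteDimensional_of_real
  refine contMDiffAt_finsetSum fun i _ => ?_
  have hL : ContDiff ℝ ∞ (fun c : F₂ =>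
      (LinearMap.toContinuousLinearMap ((Module.finBasis 𝕂 F₁).coord i)).smulRight c) :=
    ((ContinuousLinearMap.smulRightL 𝕂 F₁ F₂
      (LinearMap.toContinuousLinearMap
        ((Module.finBasis 𝕂 F₁).coord i))).restrictScalars ℝ).contDiff
  exact hL.contMDiff.contMDiffAt.comp x (h _)

end General

/-! ### Local flows of fibrewise linear vector fields on a vector bundle -/

section LocalFlow

variable {𝕂 : Type*} [RCLike 𝕂]
  {EZ : Type*} [NormedAddCommGroup EZ] [NormedSpace ℝ EZ] [FiniteDimensional ℝ EZ]
  {Z : Type*} [TopologicalSpace Z] [ChartedSpace EZ Z] [IsManifold 𝓘(ℝ, EZ) ∞ Z]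
  {FF : Type*} [NormedAddCommGroup FF] [NormedSpace ℝ FF] [FiniteDimensional ℝ FF]
  [NormedSpace 𝕂 FF] [IsScalarTower ℝ 𝕂 FF]
  {F : Z → Type*} [TopologicalSpace (TotalSpace FF F)] [∀ z, TopologicalSpace (F z)]
  [∀ z, AddCommGroup (F z)] [∀ z, Module ℝ (F z)] [∀ z, Module 𝕂 (F z)]
  [∀ z, IsScalarTower ℝ 𝕂 (F z)]
  [FiberBundle FF F] [VectorBundle ℝ FF F] [VectorBundle 𝕂 FF F]
  [ContMDiffVectorBundle ∞ FF F 𝓘(ℝ, EZ)]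

variable (𝕂 EZ FF F) in
/-- A smooth time-dependent vector field on the total space of `F` which covers a vector field on
`Z` and is linear on fibres. -/
structure LinearField where
  /-- the vector field on the base -/
  V : ℝ → ∀ z : Z, TangentSpace 𝓘(ℝ, EZ) z
  /-- the vector field on the total space -/
  s : ℝ → ∀ v : TotalSpace FF F, TangentSpace (𝓘(ℝ, EZ).prod 𝓘(ℝ, FF)) v
  smooth_V : ContMDiff (𝓘(ℝ, ℝ).prod 𝓘(ℝ, EZ)) 𝓘(ℝ, EZ).tangent ∞
    (fun p : ℝ × Z => (⟨p.2, V p.1 p.2⟩ : TangentBundle 𝓘(ℝ, EZ) Z))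
  smooth_s : ContMDiff (𝓘(ℝ, ℝ).prod (𝓘(ℝ, EZ).prod 𝓘(ℝ, FF)))
    (𝓘(ℝ, EZ).prod 𝓘(ℝ, FF)).tangent ∞
    (fun p : ℝ × TotalSpace FF F =>
      (⟨p.2, s p.1 p.2⟩ : TangentBundle (𝓘(ℝ, EZ).prod 𝓘(ℝ, FF)) (TotalSpace FF F)))
  covers : ∀ t v, projDeriv v (s t v) = V t v.proj
  linear : ∀ (e : Trivialization FF (π FF F)) [MemTrivializationAtlas e] (t : ℝ),
    ∀ z ∈ e.baseSet, IsLinearMap 𝕂 (fun u : F z => fibDeriv e ⟨z, u⟩ (s t ⟨z, u⟩))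

namespace LinearField

variable (S : LinearField 𝕂 EZ FF F)

/-- The vector field on the base in the chart at `z₀`. -/
def chartV (z₀ : Z) (p : ℝ × EZ) : EZ :=
  mfderiv 𝓘(ℝ, EZ) 𝓘(ℝ, EZ) (extChartAt 𝓘(ℝ, EZ) z₀) ((extChartAt 𝓘(ℝ, EZ) z₀).symm p.2)
    (S.V p.1 ((extChartAt 𝓘(ℝ, EZ) z₀).symm p.2))

/-- The fibre coordinate of the vector field in the chart and the trivialization at `z₀`. -/
def chartFib (z₀ : Z) (p : ℝ × EZ) (c : FF) : FF :=
  fibDeriv (trivializationAt FF F z₀)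
    ((trivializationAt FF F z₀).toOpenPartialHomeomorph.symm
      ((extChartAt 𝓘(ℝ, EZ) z₀).symm p.2, c))
    (S.s p.1 ((trivializationAt FF F z₀).toOpenPartialHomeomorph.symm
      ((extChartAt 𝓘(ℝ, EZ) z₀).symm p.2, c)))

variable (EZ FF F) in
/-- The part of the chart at `z₀` over which `F` is trivialized. -/
def chartDomain (z₀ : Z) : Set EZ :=
  (extChartAt 𝓘(ℝ, EZ) z₀).target ∩
    (extChartAt 𝓘(ℝ, EZ) z₀).symm ⁻¹' (trivializationAt FF F z₀).baseSet

theorem isOpen_chartDomain (z₀ : Z) : IsOpen (chartDomain EZ FF F z₀) :=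
  (continuousOn_extChartAt_symm z₀).isOpen_inter_preimage (isOpen_extChartAt_target z₀)
    (trivializationAt FF F z₀).open_baseSet

theorem contMDiffAt_chart_symm (z₀ : Z) {y : EZ} (hy : y ∈ (extChartAt 𝓘(ℝ, EZ) z₀).target) :
    ContMDiffAt 𝓘(ℝ, EZ) 𝓘(ℝ, EZ) ∞ (extChartAt 𝓘(ℝ, EZ) z₀).symm y :=
  (contMDiffOn_extChartAt_symm z₀).contMDiffAt ((isOpen_extChartAt_target z₀).mem_nhds hy)

theorem contDiffAt_chartV (z₀ : Z) {p : ℝ × EZ} (hp : p.2 ∈ (extChartAt 𝓘(ℝ, EZ) z₀).target) :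
    ContDiffAt ℝ ∞ (S.chartV z₀) p := by
  rw [← contMDiffAt_iff_contDiffAt]
  have h1 : ContMDiffAt 𝓘(ℝ, ℝ × EZ) (𝓘(ℝ, ℝ).prod 𝓘(ℝ, EZ)) ∞
      (fun p : ℝ × EZ => (p.1, (extChartAt 𝓘(ℝ, EZ) z₀).symm p.2)) p :=
    contDiffAt_fst.contMDiffAt.prodMk
      ((contMDiffAt_chart_symm z₀ hp).comp p contDiffAt_snd.contMDiffAt)
  have h2 := (S.smooth_V _).comp p h1
  refine contMDiffAt_mfderiv_apply (isOpen_extChartAt_source (I := 𝓘(ℝ, EZ)) z₀)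
    (by rw [extChartAt_source]; exact contMDiffOn_extChartAt) h2 ?_
  exact (extChartAt 𝓘(ℝ, EZ) z₀).map_target hp

theorem contDiffAt_chartFib (z₀ : Z) {p : ℝ × EZ} (hp : p.2 ∈ chartDomain EZ FF F z₀) (c : FF) :
    ContDiffAt ℝ ∞ (fun p => S.chartFib z₀ p c) p := by
  rw [← contMDiffAt_iff_contDiffAt]
  set e := trivializationAt FF F z₀ with he
  have h0 : ContMDiffAt (𝓘(ℝ, EZ).prod 𝓘(ℝ, FF)) (𝓘(ℝ, EZ).prod 𝓘(ℝ, FF)) ∞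
      e.toOpenPartialHomeomorph.symm ((extChartAt 𝓘(ℝ, EZ) z₀).symm p.2, c) :=
    (e.contMDiffOn_symm (IB := 𝓘(ℝ, EZ)) (n := ∞)).contMDiffAt
      (e.open_target.mem_nhds (e.mem_target.2 hp.2))
  have h1 : ContMDiffAt 𝓘(ℝ, ℝ × EZ) (𝓘(ℝ, ℝ).prod (𝓘(ℝ, EZ).prod 𝓘(ℝ, FF))) ∞
      (fun p : ℝ × EZ => (p.1, e.toOpenPartialHomeomorph.symm
        ((extChartAt 𝓘(ℝ, EZ) z₀).symm p.2, c))) p :=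
    contDiffAt_fst.contMDiffAt.prodMk (h0.comp p
      (((contMDiffAt_chart_symm z₀ hp.1).comp p contDiffAt_snd.contMDiffAt).prodMk
        contMDiffAt_const))
  have h2 := (S.smooth_s _).comp p h1
  have hs : IsOpen e.source := e.open_source
  refine contMDiffAt_mfderiv_apply hs (f := fun y : TotalSpace FF F => (e y).2) ?_ h2 ?_
  · intro y hy
    exact (contMDiffAt_fibCoord e (e.mem_source.1 hy)).contMDiffWithinAt
  · exact e.map_target (e.mem_target.2 hp.2)

end LinearField

end LocalFlow

/-- A linear map on ℝ is its value at 1; this converts computed velocities into the form in which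
integral curves are stated. -/
theorem hasMFDerivAt_of_velocity {E₁ H₁ : Type*} [NormedAddCommGroup E₁] [NormedSpace ℝ E₁]
    [TopologicalSpace H₁] {I₁ : ModelWithCorners ℝ E₁ H₁} {M₁ : Type*} [TopologicalSpace M₁]
    [ChartedSpace H₁ M₁] {β : ℝ → M₁} {τ : ℝ} (h : MDifferentiableAt 𝓘(ℝ, ℝ) I₁ β τ)
    {X : TangentSpace I₁ (β τ)} (hX : mfderiv 𝓘(ℝ, ℝ) I₁ β τ (1 : ℝ) = X) :
    HasMFDerivAt 𝓘(ℝ, ℝ) I₁ β τ ((1 : ℝ →L[ℝ] ℝ).smulRight X) := by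
  have h1 : (1 : ℝ →L[ℝ] ℝ).smulRight X = mfderiv 𝓘(ℝ, ℝ) I₁ β τ := by
    refine ContinuousLinearMap.ext_ring (R₁ := ℝ) (M₁ := E₁) ?_
    refine Eq.trans ?_ hX.symm
    exact one_smul ℝ X
  rw [h1]
  exact h.hasMFDerivAt

section LocalFlow

variable {𝕂 : Type*} [RCLike 𝕂]
  {EZ : Type*} [NormedAddCommGroup EZ] [NormedSpace ℝ EZ] [FiniteDimensional ℝ EZ]
  {Z : Type*} [TopologicalSpace Z] [ChartedSpace EZ Z] [IsManifold 𝓘(ℝ, EZ) ∞ Z]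
  {FF : Type*} [NormedAddCommGroup FF] [NormedSpace ℝ FF] [FiniteDimensional ℝ FF]
  [NormedSpace 𝕂 FF] [IsScalarTower ℝ 𝕂 FF]
  {F : Z → Type*} [TopologicalSpace (TotalSpace FF F)] [∀ z, TopologicalSpace (F z)]
  [∀ z, AddCommGroup (F z)] [∀ z, Module ℝ (F z)] [∀ z, Module 𝕂 (F z)]
  [∀ z, IsScalarTower ℝ 𝕂 (F z)]
  [FiberBundle FF F] [VectorBundle ℝ FF F] [VectorBundle 𝕂 FF F]
  [ContMDiffVectorBundle ∞ FF F 𝓘(ℝ, EZ)]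

namespace LinearField

variable (S : LinearField 𝕂 EZ FF F)

/-- On the fibre over one point the inverse trivialization is a `𝕂`-linear equivalence, so linearity
of the field in `F z` passes to the coordinate `c`. -/
theorem isLinearMap_chartFib (z₀ : Z) {p : ℝ × EZ} (hp : p.2 ∈ chartDomain EZ FF F z₀) :
    IsLinearMap 𝕂 (S.chartFib z₀ p) := by
  set e := trivializationAt FF F z₀ with he
  set z := (extChartAt 𝓘(ℝ, EZ) z₀).symm p.2 with hz
  have hzb : z ∈ e.baseSet := hp.2
  have hL := S.linear e p.1 z hzb
  have heq : S.chartFib z₀ p = fun c =>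
      fibDeriv e ⟨z, (e.linearEquivAt 𝕂 z hzb).symm c⟩
        (S.s p.1 ⟨z, (e.linearEquivAt 𝕂 z hzb).symm c⟩) := by
    ext c
    have h1 : (⟨z, (e.linearEquivAt 𝕂 z hzb).symm c⟩ : TotalSpace FF F) =
        e.toOpenPartialHomeomorph.symm (z, c) := e.mk_symm hzb c
    rw [h1]
    rfl
  rw [heq]
  exact ⟨fun c c' => by rw [map_add, hL.map_add], fun k c => by rw [map_smul, hL.map_smul]⟩

/-- The autonomous vector field whose integral curves are the trajectories of the field in the
chart at `z₀`, together with the fundamental solutions of the linear equation on the fibres. -/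
def chartSystem (z₀ : Z) (p : ℝ × EZ × (FF →L[𝕂] FF)) : ℝ × EZ × (FF →L[𝕂] FF) :=
  (1, S.chartV z₀ (p.1, p.2.1), (clmOf 𝕂 (S.chartFib z₀ (p.1, p.2.1))) ∘L p.2.2)

theorem contDiffOn_chartSystem (z₀ : Z) :
    ContDiffOn ℝ ∞ (S.chartSystem z₀)
      {p : ℝ × EZ × (FF →L[𝕂] FF) | p.2.1 ∈ chartDomain EZ FF F z₀} := by
  intro p hp
  have hq : ContDiffAt ℝ ∞ (fun p : ℝ × EZ × (FF →L[𝕂] FF) => (p.1, p.2.1)) p := by fun_prop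
  have h1 : ContDiffAt ℝ ∞ (fun p : ℝ × EZ × (FF →L[𝕂] FF) => S.chartV z₀ (p.1, p.2.1)) p :=
    ContDiffAt.comp (g := S.chartV z₀) (f := fun p : ℝ × EZ × (FF →L[𝕂] FF) => (p.1, p.2.1)) p
      (S.contDiffAt_chartV z₀ (p := (p.1, p.2.1)) hp.1) hq
  have h2 : ContDiffAt ℝ ∞ (fun q : ℝ × EZ => clmOf 𝕂 (S.chartFib z₀ q)) (p.1, p.2.1) :=
    contMDiffAt_iff_contDiffAt.1 (contMDiffAt_clmOf fun c =>
      contMDiffAt_iff_contDiffAt.2 (S.contDiffAt_chartFib z₀ (p := (p.1, p.2.1)) hp c))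
  have h3 : ContDiffAt ℝ ∞
      (fun p : ℝ × EZ × (FF →L[𝕂] FF) => clmOf 𝕂 (S.chartFib z₀ (p.1, p.2.1))) p :=
    ContDiffAt.comp (g := fun q : ℝ × EZ => clmOf 𝕂 (S.chartFib z₀ q))
      (f := fun p : ℝ × EZ × (FF →L[𝕂] FF) => (p.1, p.2.1)) p h2 hq
  have h4 : ContDiff ℝ ∞ (fun q : (FF →L[𝕂] FF) × (FF →L[𝕂] FF) => q.1 ∘L q.2) :=
    ((ContinuousLinearMap.compL 𝕂 FF FF FF).isBoundedBilinearMap.contDiff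
      (n := ∞)).restrict_scalars ℝ
  have h5 : ContDiffAt ℝ ∞ (fun p : ℝ × EZ × (FF →L[𝕂] FF) =>
      (clmOf 𝕂 (S.chartFib z₀ (p.1, p.2.1))) ∘L p.2.2) p :=
    h4.contDiffAt.comp p (h3.prodMk (by fun_prop))
  exact (contDiffAt_const.prodMk (h1.prodMk h5)).contDiffWithinAt

/-- A curve solving the equations in coordinates is an integral curve of the field. -/
theorem hasMFDerivAt_of_chart_solution (z₀ : Z) {y : ℝ → EZ} {c : ℝ → FF} {t τ : ℝ}
    (hdom : ∀ᶠ r in 𝓝 τ, y r ∈ chartDomain EZ FF F z₀)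
    (hy : HasDerivAt y (S.chartV z₀ (t, y τ)) τ)
    (hc : HasDerivAt c (S.chartFib z₀ (t, y τ) (c τ)) τ) :
    HasMFDerivAt 𝓘(ℝ, ℝ) (𝓘(ℝ, EZ).prod 𝓘(ℝ, FF))
      (fun r => (trivializationAt FF F z₀).toOpenPartialHomeomorph.symm
        ((extChartAt 𝓘(ℝ, EZ) z₀).symm (y r), c r)) τ
      ((1 : ℝ →L[ℝ] ℝ).smulRight (S.s t ((trivializationAt FF F z₀).toOpenPartialHomeomorph.symm
        ((extChartAt 𝓘(ℝ, EZ) z₀).symm (y τ), c τ)))) := by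
  set e := trivializationAt FF F z₀ with he
  set χ := extChartAt 𝓘(ℝ, EZ) z₀ with hχ
  set β : ℝ → TotalSpace FF F := fun r => e.toOpenPartialHomeomorph.symm (χ.symm (y r), c r)
    with hβ
  have hτ := hdom.self_of_nhds
  have hproj : (fun r => (β r).proj) =ᶠ[𝓝 τ] fun r => χ.symm (y r) := by
    filter_upwards [hdom] with r hr
    exact e.proj_symm_apply' hr.2
  have hfib : (fun r => (e (β r)).2) =ᶠ[𝓝 τ] c := by
    filter_upwards [hdom] with r hr
    exact congrArg Prod.snd (e.apply_symm_apply' hr.2)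
  have hb : (β τ).proj ∈ e.baseSet := by
    rw [show (β τ).proj = χ.symm (y τ) from hproj.self_of_nhds]; exact hτ.2
  have hymd : MDifferentiableAt 𝓘(ℝ, ℝ) 𝓘(ℝ, EZ) (fun r => χ.symm (y r)) τ :=
    ((contMDiffAt_chart_symm z₀ hτ.1).mdifferentiableAt (by simp)).comp τ
      hy.differentiableAt.mdifferentiableAt
  have hmd : MDifferentiableAt 𝓘(ℝ, ℝ) (𝓘(ℝ, EZ).prod 𝓘(ℝ, FF)) β τ := by
    rw [e.mdifferentiableAt_totalSpace_iff 𝓘(ℝ, EZ) _ (e.mem_source.2 hb)]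
    exact ⟨hymd.congr_of_eventuallyEq hproj,
      hc.differentiableAt.mdifferentiableAt.congr_of_eventuallyEq hfib⟩
  have hvel : mfderiv 𝓘(ℝ, ℝ) (𝓘(ℝ, EZ).prod 𝓘(ℝ, FF)) β τ (1 : ℝ) = S.s t (β τ) := by
    refine tangent_ext (e := e) hb ?_ ?_
    · refine (projDeriv_mfderiv hmd (1 : ℝ)).trans (Eq.trans ?_ (S.covers t (β τ)).symm)
      have hz : (β τ).proj = χ.symm (y τ) := hproj.self_of_nhds
      have hsrc : χ.symm (y τ) ∈ χ.source := χ.map_target hτ.1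
      have h1 : (mfderiv 𝓘(ℝ, ℝ) 𝓘(ℝ, EZ) (fun r => (β r).proj) τ (1 : ℝ) : EZ) =
          mfderiv 𝓘(ℝ, ℝ) 𝓘(ℝ, EZ) (fun r => χ.symm (y r)) τ (1 : ℝ) := by
        rw [hproj.mfderiv_eq]; rfl
      have h2 : (S.V t (β τ).proj : EZ) = S.V t (χ.symm (y τ)) := by rw [hz]
      have h3 : mfderiv 𝓘(ℝ, ℝ) 𝓘(ℝ, EZ) (fun r => χ.symm (y r)) τ (1 : ℝ) =
          S.V t (χ.symm (y τ)) := by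
        -- The differential of the chart is injective, so the two velocities may be compared after
        -- applying it, where the left side becomes the derivative of `y`.
        have hinv := isInvertible_mfderiv_extChartAt (I := 𝓘(ℝ, EZ)) hsrc
        refine hinv.injective ?_
        have hmχ : MDifferentiableAt 𝓘(ℝ, EZ) 𝓘(ℝ, EZ) χ (χ.symm (y τ)) :=
          (contMDiffAt_extChartAt' (n := ∞)
            (by rwa [← extChartAt_source 𝓘(ℝ, EZ)])).mdifferentiableAt
            (by simp)
        have h4 := mfderiv_comp τ hmχ hymd
        have h5 : (χ ∘ fun r => χ.symm (y r)) =ᶠ[𝓝 τ] y := by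
          filter_upwards [hdom] with r hr
          exact χ.right_inv hr.1
        have h6 := h5.mfderiv_eq (I := 𝓘(ℝ, ℝ)) (I' := 𝓘(ℝ, EZ))
        rw [h4] at h6
        have h7 := congrArg (fun A => A (1 : ℝ)) h6
        refine h7.trans ?_
        rw [mfderiv_eq_fderiv]
        exact hy.deriv
      exact (h1.trans h3).trans h2.symm
    · refine (fibDeriv_mfderiv hmd hb (1 : ℝ)).trans ?_
      have h1 : (mfderiv 𝓘(ℝ, ℝ) 𝓘(ℝ, FF) (fun r => (e (β r)).2) τ (1 : ℝ) : FF) =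
          mfderiv 𝓘(ℝ, ℝ) 𝓘(ℝ, FF) c τ (1 : ℝ) := by
        rw [hfib.mfderiv_eq]; rfl
      refine h1.trans ?_
      rw [mfderiv_eq_fderiv]
      exact hc.deriv
  exact hasMFDerivAt_of_velocity hmd hvel

end LinearField

end LocalFlow

section Flow

variable {𝕂 : Type*} [RCLike 𝕂]
  {EZ : Type*} [NormedAddCommGroup EZ] [NormedSpace ℝ EZ] [FiniteDimensional ℝ EZ]
  {Z : Type*} [TopologicalSpace Z] [ChartedSpace EZ Z] [IsManifold 𝓘(ℝ, EZ) ∞ Z]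
  {FF : Type*} [NormedAddCommGroup FF] [NormedSpace ℝ FF] [FiniteDimensional ℝ FF]
  [NormedSpace 𝕂 FF] [IsScalarTower ℝ 𝕂 FF]
  {F : Z → Type*} [TopologicalSpace (TotalSpace FF F)] [∀ z, TopologicalSpace (F z)]
  [∀ z, AddCommGroup (F z)] [∀ z, Module ℝ (F z)] [∀ z, Module 𝕂 (F z)]
  [∀ z, IsScalarTower ℝ 𝕂 (F z)]
  [FiberBundle FF F] [VectorBundle ℝ FF F] [VectorBundle 𝕂 FF F]
  [ContMDiffVectorBundle ∞ FF F 𝓘(ℝ, EZ)]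

namespace LinearField

variable (S : LinearField 𝕂 EZ FF F)

/-- `G τ t v` is the value at time `t + τ` of the integral curve which is at `v` at time `t`. -/
structure IsFlowOn (ε : ℝ) (O : Set Z) (G : ℝ → ℝ → TotalSpace FF F → TotalSpace FF F) :
    Prop where
  smooth : ContMDiffOn (𝓘(ℝ, ℝ).prod (𝓘(ℝ, ℝ).prod (𝓘(ℝ, EZ).prod 𝓘(ℝ, FF))))
    (𝓘(ℝ, EZ).prod 𝓘(ℝ, FF)) ∞
    (fun p : ℝ × ℝ × TotalSpace FF F => G p.1 p.2.1 p.2.2)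
    (Ioo (-ε) ε ×ˢ Ioo (-ε) ε ×ˢ (π FF F ⁻¹' O))
  start : ∀ t ∈ Ioo (-ε) ε, ∀ v : TotalSpace FF F, v.proj ∈ O → G 0 t v = v
  deriv : ∀ τ ∈ Ioo (-ε) ε, ∀ t ∈ Ioo (-ε) ε, ∀ v : TotalSpace FF F, v.proj ∈ O →
    HasMFDerivAt 𝓘(ℝ, ℝ) (𝓘(ℝ, EZ).prod 𝓘(ℝ, FF)) (fun r => G r t v) τ
      ((1 : ℝ →L[ℝ] ℝ).smulRight (S.s (t + τ) (G τ t v)))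
  linear : ∀ τ ∈ Ioo (-ε) ε, ∀ t ∈ Ioo (-ε) ε, ∀ z ∈ O,
    ∃ (z' : Z) (L : F z →ₗ[𝕂] F z'), ∀ u, G τ t ⟨z, u⟩ = ⟨z', L u⟩

theorem IsFlowOn.mono {S : LinearField 𝕂 EZ FF F} {ε ε' : ℝ} {O : Set Z}
    {G : ℝ → ℝ → TotalSpace FF F → TotalSpace FF F}
    (h : S.IsFlowOn ε O G) (hε : ε' ≤ ε) : S.IsFlowOn ε' O G := by
  have hsub : Ioo (-ε') ε' ⊆ Ioo (-ε) ε := Ioo_subset_Ioo (neg_le_neg hε) hε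
  exact ⟨h.smooth.mono (prod_mono hsub (prod_mono hsub subset_rfl)),
    fun t ht => h.start t (hsub ht), fun τ hτ t ht => h.deriv τ (hsub hτ) t (hsub ht),
    fun τ hτ t ht => h.linear τ (hsub hτ) t (hsub ht)⟩

/-- The flow of `chartSystem` is taken near `(0, χ z₀, id)`, a starting point that does not involve
a fibre vector. The existence time is therefore uniform over the noncompact fibre. The trajectory of
`v` applies the fundamental solution to the coordinate of `v`, which makes it linear on fibres. -/
theorem exists_isFlowOn_nhds (z₀ : Z) :
    ∃ ε > 0, ∃ O : Set Z, IsOpen O ∧ z₀ ∈ O ∧ ∃ G, S.IsFlowOn ε O G := by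
  have : FiniteDimensional 𝕂 FF := finiteDimensional_of_real
  have : FiniteDimensional ℝ (FF →L[𝕂] FF) := FiniteDimensional.trans ℝ 𝕂 (FF →L[𝕂] FF)
  set e := trivializationAt FF F z₀ with he
  set χ := extChartAt 𝓘(ℝ, EZ) z₀ with hχ
  have hΩ : IsOpen {p : ℝ × EZ × (FF →L[𝕂] FF) | p.2.1 ∈ chartDomain EZ FF F z₀} :=
    (isOpen_chartDomain z₀).preimage (by fun_prop)
  have hz₀ : χ z₀ ∈ chartDomain EZ FF F z₀ := by
    refine ⟨mem_extChartAt_target z₀, ?_⟩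
    rw [mem_preimage, extChartAt_to_inv]
    exact FiberBundle.mem_baseSet_trivializationAt' z₀
  obtain ⟨ε, hε, Θ, hΘ, hflow⟩ := exists_contDiffOn_flow hΩ (S.contDiffOn_chartSystem z₀)
    (x₀ := (0, χ z₀, ContinuousLinearMap.id 𝕂 FF)) hz₀
  set O : Set Z := (χ.source ∩ χ ⁻¹' Metric.ball (χ z₀) ε) ∩ e.baseSet with hO
  have hOo : IsOpen O :=
    ((continuousOn_extChartAt z₀).isOpen_inter_preimage (isOpen_extChartAt_source z₀)
      Metric.isOpen_ball).inter e.open_baseSet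
  have hball : ∀ t ∈ Ioo (-ε) ε, ∀ z ∈ O, ((t, χ z, ContinuousLinearMap.id 𝕂 FF) :
      ℝ × EZ × (FF →L[𝕂] FF)) ∈ Metric.ball (0, χ z₀, ContinuousLinearMap.id 𝕂 FF) ε := by
    intro t ht z hz
    rw [← ball_prod_same, ← ball_prod_same, Real.ball_eq_Ioo]
    exact ⟨by simpa using ht, hz.1.2, Metric.mem_ball_self hε⟩
  -- The first component is a clock with constant speed 1, so the autonomous system evaluates the
  -- time-dependent field at `t + τ`.
  have htime : ∀ x ∈ Metric.ball ((0, χ z₀, ContinuousLinearMap.id 𝕂 FF) :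
      ℝ × EZ × (FF →L[𝕂] FF)) ε, ∀ τ ∈ Ioo (-ε) ε, (Θ (τ, x)).1 = x.1 + τ := by
    intro x hx τ hτ
    have h0 : (0 : ℝ) ∈ Ioo (-ε) ε := by simpa using hε
    have hd : ∀ r ∈ Ioo (-ε) ε, HasDerivAt (fun r => (Θ (r, x)).1 - r) 0 r := by
      intro r hr
      have h1 := ((hflow x hx).2 r hr).2
      have h2 : HasDerivAt (fun r => (Θ (r, x)).1) 1 r := h1.fst
      exact (h2.fun_sub (hasDerivAt_id' r)).congr_deriv (sub_self 1)
    have := isOpen_Ioo.is_const_of_deriv_eq_zero (isPreconnected_Ioo (a := -ε) (b := ε))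
      (f := fun r => (Θ (r, x)).1 - r)
      (fun r hr => (hd r hr).differentiableAt.differentiableWithinAt)
      (fun r hr => (hd r hr).deriv) hτ h0
    simp only [(hflow x hx).1, sub_zero] at this
    linarith
  set A : ℝ × ℝ × TotalSpace FF F → ℝ × EZ × (FF →L[𝕂] FF) := fun p =>
    Θ (p.1, (p.2.1, χ p.2.2.proj, ContinuousLinearMap.id 𝕂 FF)) with hA
  refine ⟨ε, hε, O, hOo, ⟨⟨mem_extChartAt_source z₀, Metric.mem_ball_self hε⟩,
    FiberBundle.mem_baseSet_trivializationAt' z₀⟩,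
    fun τ t v => e.toOpenPartialHomeomorph.symm
      (χ.symm (A (τ, t, v)).2.1, (A (τ, t, v)).2.2 (e v).2), ?_⟩
  refine ⟨?_, ?_, ?_, ?_⟩
  · rintro ⟨τ, t, v⟩ ⟨hτ, ht, hv⟩
    refine ContMDiffAt.contMDiffWithinAt ?_
    have hv' : v.proj ∈ O := hv
    have hdom := ((hflow _ (hball t ht v.proj hv')).2 τ hτ).1
    have hΘat : ContMDiffAt 𝓘(ℝ, ℝ × ℝ × EZ × (FF →L[𝕂] FF)) 𝓘(ℝ, ℝ × EZ × (FF →L[𝕂] FF)) ∞ Θ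
        (τ, (t, χ v.proj, ContinuousLinearMap.id 𝕂 FF)) :=
      (hΘ.contDiffAt ((isOpen_Ioo.prod Metric.isOpen_ball).mem_nhds
        ⟨hτ, hball t ht v.proj hv'⟩)).contMDiffAt
    have hproj : ContMDiffAt (𝓘(ℝ, ℝ).prod (𝓘(ℝ, ℝ).prod (𝓘(ℝ, EZ).prod 𝓘(ℝ, FF)))) 𝓘(ℝ, EZ) ∞
        (fun p : ℝ × ℝ × TotalSpace FF F => p.2.2.proj) (τ, t, v) :=
      (contMDiffAt_proj F).comp (τ, t, v) (contMDiffAt_snd.comp (τ, t, v) contMDiffAt_snd)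
    have hχat : ContMDiffAt 𝓘(ℝ, EZ) 𝓘(ℝ, EZ) ∞ χ v.proj :=
      contMDiffAt_extChartAt' (by rw [← extChartAt_source 𝓘(ℝ, EZ)]; exact hv'.1.1)
    have hin : ContMDiffAt (𝓘(ℝ, ℝ).prod (𝓘(ℝ, ℝ).prod (𝓘(ℝ, EZ).prod 𝓘(ℝ, FF))))
        𝓘(ℝ, ℝ × ℝ × EZ × (FF →L[𝕂] FF)) ∞
        (fun p : ℝ × ℝ × TotalSpace FF F =>
          (p.1, (p.2.1, χ p.2.2.proj, ContinuousLinearMap.id 𝕂 FF))) (τ, t, v) :=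
      contMDiffAt_fst.prodMk_space ((contMDiffAt_fst.comp (τ, t, v) contMDiffAt_snd).prodMk_space
        ((ContMDiffAt.comp (τ, t, v) (g := χ) hχat hproj).prodMk_space contMDiffAt_const))
    have hAat : ContMDiffAt (𝓘(ℝ, ℝ).prod (𝓘(ℝ, ℝ).prod (𝓘(ℝ, EZ).prod 𝓘(ℝ, FF))))
        𝓘(ℝ, ℝ × EZ × (FF →L[𝕂] FF)) ∞ A (τ, t, v) :=
      ContMDiffAt.comp (τ, t, v) (g := Θ) hΘat hin
    have hy : ContMDiffAt (𝓘(ℝ, ℝ).prod (𝓘(ℝ, ℝ).prod (𝓘(ℝ, EZ).prod 𝓘(ℝ, FF))))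
        𝓘(ℝ, EZ) ∞ (fun p => (A p).2.1) (τ, t, v) :=
      ContMDiffAt.comp (τ, t, v) (g := fun q : ℝ × EZ × (FF →L[𝕂] FF) => q.2.1)
        (ContDiff.contMDiff (by fun_prop)).contMDiffAt hAat
    have hL : ContMDiffAt (𝓘(ℝ, ℝ).prod (𝓘(ℝ, ℝ).prod (𝓘(ℝ, EZ).prod 𝓘(ℝ, FF))))
        𝓘(ℝ, FF →L[𝕂] FF) ∞ (fun p => (A p).2.2) (τ, t, v) :=
      ContMDiffAt.comp (τ, t, v) (g := fun q : ℝ × EZ × (FF →L[𝕂] FF) => q.2.2)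
        (ContDiff.contMDiff (by fun_prop)).contMDiffAt hAat
    have hc : ContMDiffAt (𝓘(ℝ, ℝ).prod (𝓘(ℝ, ℝ).prod (𝓘(ℝ, EZ).prod 𝓘(ℝ, FF))))
        𝓘(ℝ, FF) ∞ (fun p : ℝ × ℝ × TotalSpace FF F => (e p.2.2).2) (τ, t, v) :=
      ContMDiffAt.comp (τ, t, v) (g := fun y : TotalSpace FF F => (e y).2)
        (f := fun p : ℝ × ℝ × TotalSpace FF F => p.2.2) (contMDiffAt_fibCoord e hv'.2)
        (contMDiffAt_snd.comp (τ, t, v) contMDiffAt_snd)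
    have happ : ContDiff ℝ ∞ (fun q : (FF →L[𝕂] FF) × FF => q.1 q.2) :=
      (isBoundedBilinearMap_apply (𝕜 := 𝕂) (E := FF) (F := FF)).contDiff.restrict_scalars ℝ
    have hLc : ContMDiffAt (𝓘(ℝ, ℝ).prod (𝓘(ℝ, ℝ).prod (𝓘(ℝ, EZ).prod 𝓘(ℝ, FF))))
        𝓘(ℝ, FF) ∞ (fun p : ℝ × ℝ × TotalSpace FF F => (A p).2.2 (e p.2.2).2) (τ, t, v) :=
      ContMDiffAt.comp (τ, t, v) (g := fun q : (FF →L[𝕂] FF) × FF => q.1 q.2)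
        happ.contMDiff.contMDiffAt (hL.prodMk_space hc)
    have hbase : ContMDiffAt (𝓘(ℝ, ℝ).prod (𝓘(ℝ, ℝ).prod (𝓘(ℝ, EZ).prod 𝓘(ℝ, FF))))
        𝓘(ℝ, EZ) ∞ (fun p => χ.symm (A p).2.1) (τ, t, v) :=
      ContMDiffAt.comp (τ, t, v) (g := χ.symm) (contMDiffAt_chart_symm z₀ hdom.1) hy
    have hesymm : ContMDiffAt (𝓘(ℝ, EZ).prod 𝓘(ℝ, FF)) (𝓘(ℝ, EZ).prod 𝓘(ℝ, FF)) ∞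
        e.toOpenPartialHomeomorph.symm (χ.symm (A (τ, t, v)).2.1, (A (τ, t, v)).2.2 (e v).2) :=
      (e.contMDiffOn_symm (IB := 𝓘(ℝ, EZ)) (n := ∞)).contMDiffAt
        (e.open_target.mem_nhds (e.mem_target.2 hdom.2))
    exact ContMDiffAt.comp (τ, t, v) (g := e.toOpenPartialHomeomorph.symm) hesymm
      (hbase.prodMk hLc)
  · intro t ht v hv
    have h1 : A (0, t, v) = (t, χ v.proj, ContinuousLinearMap.id 𝕂 FF) :=
      (hflow _ (hball t ht v.proj hv)).1
    simp only [h1]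
    rw [χ.left_inv hv.1.1]
    exact e.symm_apply_mk_proj (e.mem_source.2 hv.2)
  · intro τ hτ t ht v hv
    have hx := hball t ht v.proj hv
    have hd := ((hflow _ hx).2 τ hτ).2
    have ht' := htime _ hx τ hτ
    have hev : ∀ᶠ r in 𝓝 τ, (A (r, t, v)).2.1 ∈ chartDomain EZ FF F z₀ := by
      filter_upwards [Ioo_mem_nhds hτ.1 hτ.2] with r hr using ((hflow _ hx).2 r hr).1
    have hy : HasDerivAt (fun r => (A (r, t, v)).2.1)
        (S.chartV z₀ (t + τ, (A (τ, t, v)).2.1)) τ := by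
      have : HasDerivAt (fun r => (A (r, t, v)).2.1)
        (S.chartV z₀ ((A (τ, t, v)).1, (A (τ, t, v)).2.1)) τ := hd.snd.fst
      rwa [show (A (τ, t, v)).1 = t + τ from ht'] at this
    have hc : HasDerivAt (fun r => (A (r, t, v)).2.2 (e v).2)
        (S.chartFib z₀ (t + τ, (A (τ, t, v)).2.1) ((A (τ, t, v)).2.2 (e v).2)) τ := by
      have h1 : HasDerivAt (fun r => (A (r, t, v)).2.2)
        ((clmOf 𝕂 (S.chartFib z₀ ((A (τ, t, v)).1, (A (τ, t, v)).2.1))) ∘L (A (τ, t, v)).2.2) τ :=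
        hd.snd.snd
      rw [show (A (τ, t, v)).1 = t + τ from ht'] at h1
      have hev : ∀ c : FF, HasFDerivAt (fun L : FF →L[𝕂] FF => L c)
          ((ContinuousLinearMap.apply 𝕂 FF c).restrictScalars ℝ) (A (τ, t, v)).2.2 := fun c =>
        ((ContinuousLinearMap.apply 𝕂 FF c).restrictScalars ℝ).hasFDerivAt
      have h2 := (hev (e v).2).comp_hasDerivAt τ h1
      refine h2.congr_deriv ?_
      exact clmOf_apply (S.isLinearMap_chartFib z₀ (p := (t + τ, (A (τ, t, v)).2.1))
        ((hflow _ hx).2 τ hτ).1) _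
    exact S.hasMFDerivAt_of_chart_solution z₀ hev hy hc
  · intro τ hτ t ht z hz
    have hdom := ((hflow _ (hball t ht z hz)).2 τ hτ).1
    set B := Θ (τ, (t, χ z, ContinuousLinearMap.id 𝕂 FF)) with hB
    refine ⟨χ.symm B.2.1, (e.linearEquivAt 𝕂 _ hdom.2).symm.toLinearMap ∘ₗ
      B.2.2.toLinearMap ∘ₗ (e.linearEquivAt 𝕂 z hz.2).toLinearMap, fun u => ?_⟩
    exact (e.mk_symm hdom.2 _).symm

end LinearField

end Flow

/-! ### Uniqueness of integral curves of time-dependent vector fields -/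

section IntegralCurve

variable {E₁ H₁ : Type*} [NormedAddCommGroup E₁] [NormedSpace ℝ E₁] [TopologicalSpace H₁]
  {I₁ : ModelWithCorners ℝ E₁ H₁} {N : Type*} [TopologicalSpace N] [ChartedSpace H₁ N]
  [IsManifold I₁ ∞ N]

theorem contMDiff_const_vectorField_real :
    ContMDiff 𝓘(ℝ, ℝ) 𝓘(ℝ, ℝ).tangent ∞ (fun t : ℝ => (⟨t, (1 : ℝ)⟩ : TangentBundle 𝓘(ℝ, ℝ) ℝ)) :=
  contMDiff_vectorSpace_iff_contDiff.2 contDiff_const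

/-- Integral curves of a time-dependent vector field are determined by their value at one time. -/
theorem eqOn_Ioo_of_hasMFDerivAt [T2Space N] [BoundarylessManifold I₁ N] [CompleteSpace E₁]
    {ξ : ℝ → ∀ x : N, TangentSpace I₁ x}
    (hξ : ContMDiff (𝓘(ℝ, ℝ).prod I₁) I₁.tangent ∞
      (fun p : ℝ × N => (⟨p.2, ξ p.1 p.2⟩ : TangentBundle I₁ N)))
    {β₁ β₂ : ℝ → N} {a b t₀ : ℝ} (ht₀ : t₀ ∈ Ioo a b)
    (h₁ : ∀ τ ∈ Ioo a b, HasMFDerivAt 𝓘(ℝ, ℝ) I₁ β₁ τ ((1 : ℝ →L[ℝ] ℝ).smulRight (ξ τ (β₁ τ))))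
    (h₂ : ∀ τ ∈ Ioo a b, HasMFDerivAt 𝓘(ℝ, ℝ) I₁ β₂ τ ((1 : ℝ →L[ℝ] ℝ).smulRight (ξ τ (β₂ τ))))
    (h : β₁ t₀ = β₂ t₀) : EqOn β₁ β₂ (Ioo a b) := by
  have : IsManifold I₁ 1 N := IsManifold.of_le (n := ∞) (by simp)
  -- Suspension: on `ℝ × N` the field (1, ξ) is autonomous, and τ ↦ (τ, β τ) is an integral curve of
  -- it, so the autonomous uniqueness theorem applies.
  have hv : ContMDiff (𝓘(ℝ, ℝ).prod I₁) (𝓘(ℝ, ℝ).prod I₁).tangent ∞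
      (fun x : ℝ × N => (⟨x, ((1 : ℝ), ξ x.1 x.2)⟩ : TangentBundle (𝓘(ℝ, ℝ).prod I₁) (ℝ × N))) := by
    have h1 : ContMDiff (𝓘(ℝ, ℝ).prod I₁) (𝓘(ℝ, ℝ).tangent.prod I₁.tangent) ∞
        (fun x : ℝ × N => ((⟨x.1, (1 : ℝ)⟩ : TangentBundle 𝓘(ℝ, ℝ) ℝ),
          (⟨x.2, ξ x.1 x.2⟩ : TangentBundle I₁ N))) :=
      (contMDiff_const_vectorField_real.comp contMDiff_fst).prodMk hξ
    exact (contMDiff_equivTangentBundleProd_symm (I := 𝓘(ℝ, ℝ)) (M := ℝ) (I' := I₁) (M' := N)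
      (n := ∞)).comp h1
  have key : ∀ β : ℝ → N,
      (∀ τ ∈ Ioo a b, HasMFDerivAt 𝓘(ℝ, ℝ) I₁ β τ ((1 : ℝ →L[ℝ] ℝ).smulRight (ξ τ (β τ)))) →
      IsMIntegralCurveOn (I := 𝓘(ℝ, ℝ).prod I₁) (fun τ => (τ, β τ))
        (fun x : ℝ × N => ((1 : ℝ), ξ x.1 x.2)) (Ioo a b) := by
    intro β hβ τ hτ
    refine HasMFDerivAt.hasMFDerivWithinAt ?_
    refine ((hasMFDerivAt_id τ).prodMk (hβ τ hτ)).congr_mfderiv ?_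
    refine ContinuousLinearMap.ext_ring (R₁ := ℝ) (M₁ := ℝ × E₁) ?_
    refine Prod.ext ?_ ?_
    · exact (one_smul ℝ (1 : ℝ)).symm
    · rfl
  have := isMIntegralCurveOn_Ioo_eqOn_of_contMDiff_boundaryless ht₀
    (hv.of_le (by simp)) (key β₁ h₁) (key β₂ h₂) (Prod.ext rfl h)
  exact fun τ hτ => congrArg Prod.snd (this hτ)

end IntegralCurve

/-! ### Global flows over a compact base, as paths of bundle automorphisms -/

section Flow

variable {𝕂 : Type*} [RCLike 𝕂]
  {EZ : Type*} [NormedAddCommGroup EZ] [NormedSpace ℝ EZ] [FiniteDimensional ℝ EZ]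
  {Z : Type*} [TopologicalSpace Z] [ChartedSpace EZ Z] [IsManifold 𝓘(ℝ, EZ) ∞ Z]
  [T2Space Z]
  {FF : Type*} [NormedAddCommGroup FF] [NormedSpace ℝ FF] [FiniteDimensional ℝ FF]
  [NormedSpace 𝕂 FF] [IsScalarTower ℝ 𝕂 FF]
  {F : Z → Type*} [TopologicalSpace (TotalSpace FF F)] [∀ z, TopologicalSpace (F z)]
  [∀ z, AddCommGroup (F z)] [∀ z, Module ℝ (F z)] [∀ z, Module 𝕂 (F z)]
  [∀ z, IsScalarTower ℝ 𝕂 (F z)]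
  [FiberBundle FF F] [VectorBundle ℝ FF F] [VectorBundle 𝕂 FF F]
  [ContMDiffVectorBundle ∞ FF F 𝓘(ℝ, EZ)]

namespace LinearField

variable {S : LinearField 𝕂 EZ FF F}

theorem eqOn_integralCurve (t : ℝ) {β₁ β₂ : ℝ → TotalSpace FF F} {a b τ₀ : ℝ}
    (hτ₀ : τ₀ ∈ Ioo a b)
    (h₁ : ∀ τ ∈ Ioo a b, HasMFDerivAt 𝓘(ℝ, ℝ) (𝓘(ℝ, EZ).prod 𝓘(ℝ, FF)) β₁ τ
      ((1 : ℝ →L[ℝ] ℝ).smulRight (S.s (t + τ) (β₁ τ))))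
    (h₂ : ∀ τ ∈ Ioo a b, HasMFDerivAt 𝓘(ℝ, ℝ) (𝓘(ℝ, EZ).prod 𝓘(ℝ, FF)) β₂ τ
      ((1 : ℝ →L[ℝ] ℝ).smulRight (S.s (t + τ) (β₂ τ))))
    (h : β₁ τ₀ = β₂ τ₀) : EqOn β₁ β₂ (Ioo a b) := by
  have : T2Space (TotalSpace FF F) := t2Space_totalSpace
  have : IsManifold (𝓘(ℝ, EZ).prod 𝓘(ℝ, FF)) ∞ (TotalSpace FF F) :=
    Bundle.TotalSpace.isManifold FF F
  have hs : ContMDiff (𝓘(ℝ, ℝ).prod (𝓘(ℝ, EZ).prod 𝓘(ℝ, FF)))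
      (𝓘(ℝ, EZ).prod 𝓘(ℝ, FF)).tangent ∞
      (fun p : ℝ × TotalSpace FF F => (⟨p.2, S.s (t + p.1) p.2⟩ :
        TangentBundle (𝓘(ℝ, EZ).prod 𝓘(ℝ, FF)) (TotalSpace FF F))) := by
    have h1 : ContMDiff 𝓘(ℝ, ℝ) 𝓘(ℝ, ℝ) ∞ (fun r : ℝ => t + r) :=
      ContDiff.contMDiff (by fun_prop)
    exact S.smooth_s.comp ((h1.comp contMDiff_fst).prodMk contMDiff_snd)
  exact eqOn_Ioo_of_hasMFDerivAt (ξ := fun τ => S.s (t + τ)) hs hτ₀ h₁ h₂ h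

variable {ε : ℝ} {O : Set Z} {G : ℝ → ℝ → TotalSpace FF F → TotalSpace FF F}

/-- Two local flows follow integral curves with the same start, so they agree on overlaps; this is
what allows them to be glued. -/
theorem IsFlowOn.eq_of_mem (h : S.IsFlowOn ε O G) {O' : Set Z}
    {G' : ℝ → ℝ → TotalSpace FF F → TotalSpace FF F} (h' : S.IsFlowOn ε O' G') {τ t : ℝ}
    (hτ : τ ∈ Ioo (-ε) ε) (ht : t ∈ Ioo (-ε) ε) {v : TotalSpace FF F} (hv : v.proj ∈ O)
    (hv' : v.proj ∈ O') : G τ t v = G' τ t v := by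
  have h0 : (0 : ℝ) ∈ Ioo (-ε) ε := by
    have := hτ.1.trans hτ.2
    constructor <;> linarith
  exact eqOn_integralCurve t h0 (fun τ hτ => h.deriv τ hτ t ht v hv)
    (fun τ hτ => h'.deriv τ hτ t ht v hv') ((h.start t ht v hv).trans (h'.start t ht v hv').symm) hτ

/-- On a compact base all trajectories exist for a common time. -/
theorem exists_isFlowOn_univ [CompactSpace Z] (S : LinearField 𝕂 EZ FF F) :
    ∃ ε > 0, ∃ G, S.IsFlowOn ε univ G := by
  have key : ∃ ε > 0, ∀ z ∈ (univ : Set Z), ∃ O : Set Z, IsOpen O ∧ z ∈ O ∧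
      ∃ G, S.IsFlowOn ε O G := by
    -- Having a common existence time passes to subsets and, by taking minima, to unions of two
    -- sets. It holds near each point, so compactness gives it on all of `Z`.
    refine isCompact_univ.induction_on (p := fun s : Set Z => ∃ ε > 0, ∀ z ∈ s, ∃ O : Set Z,
      IsOpen O ∧ z ∈ O ∧ ∃ G, S.IsFlowOn ε O G) ⟨1, one_pos, by simp⟩ ?_ ?_ ?_
    · rintro s s' hs ⟨ε, hε, h⟩
      exact ⟨ε, hε, fun z hz => h z (hs hz)⟩
    · rintro s s' ⟨ε, hε, h⟩ ⟨ε', hε', h'⟩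
      refine ⟨min ε ε', lt_min hε hε', ?_⟩
      rintro z (hz | hz)
      · obtain ⟨O, hO, hzO, G, hG⟩ := h z hz
        exact ⟨O, hO, hzO, G, hG.mono (min_le_left _ _)⟩
      · obtain ⟨O, hO, hzO, G, hG⟩ := h' z hz
        exact ⟨O, hO, hzO, G, hG.mono (min_le_right _ _)⟩
    · intro z _
      obtain ⟨ε, hε, O, hO, hzO, G, hG⟩ := S.exists_isFlowOn_nhds z
      exact ⟨O, mem_nhdsWithin_of_mem_nhds (hO.mem_nhds hzO), ε, hε,
        fun z' hz' => ⟨O, hO, hz', G, hG⟩⟩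
  obtain ⟨ε, hε, h⟩ := key
  choose O hO hzO G hG using fun z => h z (mem_univ z)
  -- Each vector follows the local flow chosen for its own base point. Near a given point this
  -- agrees with one fixed local flow by uniqueness, so no smoothness is lost through the choice.
  refine ⟨ε, hε, fun τ t v => G v.proj τ t v, ?_, ?_, ?_, ?_⟩
  · rintro ⟨τ, t, v⟩ ⟨hτ, ht, -⟩
    refine ContMDiffAt.contMDiffWithinAt ?_
    have hopen : IsOpen (Ioo (-ε) ε ×ˢ Ioo (-ε) ε ×ˢ (π FF F ⁻¹' (O v.proj))) :=
      isOpen_Ioo.prod (isOpen_Ioo.prod ((hO v.proj).preimage (FiberBundle.continuous_proj FF F)))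
    have hmem : (τ, t, v) ∈ Ioo (-ε) ε ×ˢ Ioo (-ε) ε ×ˢ (π FF F ⁻¹' (O v.proj)) :=
      ⟨hτ, ht, hzO v.proj⟩
    refine ((hG v.proj).smooth.contMDiffAt (hopen.mem_nhds hmem)).congr_of_eventuallyEq ?_
    filter_upwards [hopen.mem_nhds hmem] with p hp
    exact (hG _).eq_of_mem (hG _) hp.1 hp.2.1 (hzO _) hp.2.2
  · exact fun t ht v _ => (hG v.proj).start t ht v (hzO _)
  · exact fun τ hτ t ht v _ => (hG v.proj).deriv τ hτ t ht v (hzO _)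
  · exact fun τ hτ t ht z _ => (hG z).linear τ hτ t ht z (hzO _)

theorem IsFlowOn.hasMFDerivAt_comp_add (h : S.IsFlowOn ε univ G) {r t τ : ℝ}
    (hτ : r + τ ∈ Ioo (-ε) ε) (ht : t ∈ Ioo (-ε) ε) (v : TotalSpace FF F) :
    HasMFDerivAt 𝓘(ℝ, ℝ) (𝓘(ℝ, EZ).prod 𝓘(ℝ, FF)) (fun τ => G (r + τ) t v) τ
      ((1 : ℝ →L[ℝ] ℝ).smulRight (S.s (t + r + τ) (G (r + τ) t v))) := by
  have h1 : HasMFDerivAt 𝓘(ℝ, ℝ) 𝓘(ℝ, ℝ) (fun τ : ℝ => r + τ) τ (1 : ℝ →L[ℝ] ℝ) :=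
    ((hasFDerivAt_id τ).const_add r).hasMFDerivAt
  have h2 := HasMFDerivAt.comp τ (h.deriv (r + τ) hτ t ht v (mem_univ _)) h1
  rw [add_assoc]
  exact h2

/-- Flowing from `t` to `t'` and back retraces a single integral curve: both sides solve the
equation started at time `t'`. -/
theorem IsFlowOn.cancel (h : S.IsFlowOn ε univ G) {t t' : ℝ} (ht : t ∈ Ioo (-ε) ε)
    (ht' : t' ∈ Ioo (-ε) ε) (hd : t' - t ∈ Ioo (-ε) ε) (v : TotalSpace FF F) :
    G (t - t') t' (G (t' - t) t v) = v := by
  obtain ⟨hd1, hd2⟩ := hd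
  have hε : -ε < ε := ht.1.trans ht.2
  -- This interval consists of the τ for which both τ and `t' - t + τ` are admissible elapsed times;
  -- it contains the initial time 0 and the target `t - t'`.
  have h0 : (0 : ℝ) ∈ Ioo (max (-ε) (-ε - (t' - t))) (min ε (ε - (t' - t))) :=
    ⟨max_lt (by linarith) (by linarith), lt_min (by linarith) (by linarith)⟩
  have h1 : t - t' ∈ Ioo (max (-ε) (-ε - (t' - t))) (min ε (ε - (t' - t))) :=
    ⟨max_lt (by linarith) (by linarith), lt_min (by linarith) (by linarith)⟩
  have := eqOn_integralCurve (S := S) t' (β₁ := fun τ => G τ t' (G (t' - t) t v))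
    (β₂ := fun τ => G (t' - t + τ) t v) h0
    (fun τ hτ => h.deriv τ ⟨(le_max_left _ _).trans_lt hτ.1, hτ.2.trans_le (min_le_left _ _)⟩ t' ht'
      _ (mem_univ _))
    (fun τ hτ => by
      have h2 : t' - t + τ ∈ Ioo (-ε) ε := by
        have := (le_max_right _ _).trans_lt hτ.1
        have := hτ.2.trans_le (min_le_right _ _)
        constructor <;> linarith
      have h3 := h.hasMFDerivAt_comp_add h2 ht v
      rwa [show t + (t' - t) + τ = t' + τ by ring] at h3)
    (by
      simp only [add_zero]
      exact h.start t' ht' _ (mem_univ _)) h1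
  refine this.trans ?_
  simp only [sub_add_sub_cancel, sub_self]
  exact h.start t ht v (mem_univ _)

/-- The common image fibre is pinned down as the one containing the image of the zero vector, which
provides a canonical formula for the base flow. -/
theorem IsFlowOn.exists_linearMap (h : S.IsFlowOn ε univ G) {τ t : ℝ} (hτ : τ ∈ Ioo (-ε) ε)
    (ht : t ∈ Ioo (-ε) ε) (z : Z) :
    ∃ L : F z →ₗ[𝕂] F (G τ t ⟨z, 0⟩).proj, ∀ u, G τ t ⟨z, u⟩ = ⟨(G τ t ⟨z, 0⟩).proj, L u⟩ := by
  obtain ⟨z', L, hL⟩ := h.linear τ hτ t ht z (mem_univ z)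
  obtain rfl : (G τ t ⟨z, 0⟩).proj = z' := by rw [hL]
  exact ⟨L, hL⟩

theorem IsFlowOn.proj_eq (h : S.IsFlowOn ε univ G) {τ t : ℝ} (hτ : τ ∈ Ioo (-ε) ε)
    (ht : t ∈ Ioo (-ε) ε) (v : TotalSpace FF F) :
    (G τ t v).proj = (G τ t ⟨v.proj, 0⟩).proj := by
  obtain ⟨L, hL⟩ := h.exists_linearMap hτ ht v.proj
  exact (congrArg TotalSpace.proj (hL v.2) :)

theorem IsFlowOn.contMDiff (h : S.IsFlowOn ε univ G) {τ t : ℝ} (hτ : τ ∈ Ioo (-ε) ε)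
    (ht : t ∈ Ioo (-ε) ε) :
    ContMDiff (𝓘(ℝ, EZ).prod 𝓘(ℝ, FF)) (𝓘(ℝ, EZ).prod 𝓘(ℝ, FF)) ∞ (G τ t) := by
  rw [← contMDiffOn_univ]
  exact h.smooth.comp (contMDiff_const.prodMk (contMDiff_const.prodMk contMDiff_id)).contMDiffOn
    fun v _ => ⟨hτ, ht, mem_univ _⟩

theorem IsFlowOn.contMDiff_base (h : S.IsFlowOn ε univ G) {τ t : ℝ} (hτ : τ ∈ Ioo (-ε) ε)
    (ht : t ∈ Ioo (-ε) ε) :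
    ContMDiff 𝓘(ℝ, EZ) 𝓘(ℝ, EZ) ∞ (fun z : Z => (G τ t ⟨z, 0⟩).proj) :=
  (contMDiff_proj F).comp ((h.contMDiff hτ ht).comp (contMDiff_zeroSection ℝ F))

/-- The inverse of the flow from 0 to `t` is the flow from `t` back to 0. For this reason the
initial time is an argument of the flow, and the base inverse is given by an explicit formula that
is smooth in `t`. -/
theorem IsFlowOn.exists_bundleAut (h : S.IsFlowOn ε univ G) {t : ℝ} (ht : t ∈ Ioo (-ε) ε) :
    ∃ g : BundleAut 𝕂 EZ FF F, (∀ v, g.toFun v = G t 0 v) ∧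
      ∀ z, g.base.symm z = (G (-t) t ⟨z, 0⟩).proj := by
  have hε : -ε < ε := ht.1.trans ht.2
  have h0 : (0 : ℝ) ∈ Ioo (-ε) ε := by constructor <;> linarith
  have ht' : -t ∈ Ioo (-ε) ε := ⟨neg_lt_neg ht.2, by linarith [ht.1]⟩
  have c1 : ∀ v, G (-t) t (G t 0 v) = v := fun v => by
    simpa using h.cancel h0 ht (by simpa using ht) v
  have c2 : ∀ v, G t 0 (G (-t) t v) = v := fun v => by
    simpa using h.cancel ht h0 (by simpa using ht') v
  have l1 : ∀ z, (G (-t) t ⟨(G t 0 ⟨z, 0⟩).proj, 0⟩).proj = z := fun z => by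
    rw [← h.proj_eq ht' ht, c1]
  have l2 : ∀ z, (G t 0 ⟨(G (-t) t ⟨z, 0⟩).proj, 0⟩).proj = z := fun z => by
    rw [← h.proj_eq ht h0, c2]
  choose L hL using fun z => h.exists_linearMap ht h0 z
  have hbij : ∀ z, Function.Bijective (L z) := by
    intro z
    constructor
    · intro u u' hu
      have h1 : G t 0 ⟨z, u⟩ = G t 0 ⟨z, u'⟩ :=
        (hL z u).trans ((congrArg _ hu).trans (hL z u').symm)
      have h2 := congrArg (G (-t) t) h1
      rw [c1, c1] at h2
      exact TotalSpace.mk_injective z h2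
    · intro w
      -- Naming the preimage as a variable allows its base point, known only propositionally, to be
      -- replaced by `z`.
      obtain ⟨y, hy⟩ : ∃ y, y = G (-t) t ⟨(G t 0 ⟨z, 0⟩).proj, w⟩ := ⟨_, rfl⟩
      have hy1 : y.proj = z := by rw [hy, h.proj_eq ht' ht, l1]
      have hy2 : G t 0 y = ⟨(G t 0 ⟨z, 0⟩).proj, w⟩ := by rw [hy, c2]
      obtain ⟨z', u⟩ := y
      obtain rfl : z' = z := hy1
      exact ⟨u, TotalSpace.mk_injective _ ((hL z' u).symm.trans hy2)⟩
  refine ⟨⟨⟨⟨fun z => (G t 0 ⟨z, 0⟩).proj, fun z => (G (-t) t ⟨z, 0⟩).proj, l1, l2⟩,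
    h.contMDiff_base ht h0, h.contMDiff_base ht' ht⟩,
    fun z => LinearEquiv.ofBijective (L z) (hbij z), ?_⟩, ?_, fun z => rfl⟩
  · refine (h.contMDiff ht h0).congr ?_
    rintro ⟨z, u⟩
    exact (hL z u).symm
  · rintro ⟨z, u⟩
    exact (hL z u).symm

/-- The joint smoothness of the inverse diffeomorphisms is recorded separately, because the action
on sections evaluates at φ_t⁻¹(z). -/
theorem exists_flow [CompactSpace Z] (S : LinearField 𝕂 EZ FF F) :
    ∃ ε > 0, ∃ g : ℝ → BundleAut 𝕂 EZ FF F,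
      ContMDiffOn (𝓘(ℝ, ℝ).prod (𝓘(ℝ, EZ).prod 𝓘(ℝ, FF))) (𝓘(ℝ, EZ).prod 𝓘(ℝ, FF)) ∞
        (fun p : ℝ × TotalSpace FF F => (g p.1).toFun p.2) (Ioo (-ε) ε ×ˢ univ) ∧
      ContMDiffOn (𝓘(ℝ, ℝ).prod 𝓘(ℝ, EZ)) 𝓘(ℝ, EZ) ∞
        (fun p : ℝ × Z => (g p.1).base.symm p.2) (Ioo (-ε) ε ×ˢ univ) ∧
      (∀ v, (g 0).toFun v = v) ∧
      ∀ t ∈ Ioo (-ε) ε, ∀ v, HasMFDerivAt 𝓘(ℝ, ℝ) (𝓘(ℝ, EZ).prod 𝓘(ℝ, FF))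
        (fun r => (g r).toFun v) t ((1 : ℝ →L[ℝ] ℝ).smulRight (S.s t ((g t).toFun v))) := by
  obtain ⟨ε, hε, G, h⟩ := S.exists_isFlowOn_univ
  have h0 : (0 : ℝ) ∈ Ioo (-ε) ε := by constructor <;> linarith
  choose g hg hg' using fun (t : ℝ) (ht : t ∈ Ioo (-ε) ε) => h.exists_bundleAut ht
  classical
  -- A path in the group is a function on all of ℝ; outside the existence interval it takes an
  -- arbitrary value.
  set g' : ℝ → BundleAut 𝕂 EZ FF F :=
    fun t => if ht : t ∈ Ioo (-ε) ε then g t ht else g 0 h0 with hg'_def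
  have e1 : ∀ t ∈ Ioo (-ε) ε, ∀ v, (g' t).toFun v = G t 0 v := by
    intro t ht v
    simp only [hg'_def, dif_pos ht, hg]
  have e2 : ∀ t ∈ Ioo (-ε) ε, ∀ z, (g' t).base.symm z = (G (-t) t ⟨z, 0⟩).proj := by
    intro t ht z
    simp only [hg'_def, dif_pos ht, hg']
  refine ⟨ε, hε, g', ?_, ?_, ?_, ?_⟩
  · refine ContMDiffOn.congr (f := fun p : ℝ × TotalSpace FF F => G p.1 0 p.2) ?_
      fun p hp => e1 p.1 hp.1 p.2
    exact h.smooth.comp (contMDiff_fst.prodMk (contMDiff_const.prodMk contMDiff_snd)).contMDiffOn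
      fun p hp => ⟨hp.1, h0, mem_univ _⟩
  · refine ContMDiffOn.congr (f := fun p : ℝ × Z => (G (-p.1) p.1 ⟨p.2, 0⟩).proj) ?_
      fun p hp => e2 p.1 hp.1 p.2
    have hn : ContMDiff (𝓘(ℝ, ℝ).prod 𝓘(ℝ, EZ)) 𝓘(ℝ, ℝ) ∞ (fun p : ℝ × Z => -p.1) :=
      (ContDiff.contMDiff contDiff_neg).comp contMDiff_fst
    exact (contMDiff_proj F).comp_contMDiffOn (h.smooth.comp (hn.prodMk (contMDiff_fst.prodMk
      ((contMDiff_zeroSection ℝ F).comp contMDiff_snd))).contMDiffOn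
      fun p hp => ⟨⟨neg_lt_neg hp.1.2, by linarith [hp.1.1]⟩, hp.1, mem_univ _⟩)
  · intro v
    rw [e1 0 h0]
    exact h.start 0 h0 v (mem_univ _)
  · intro t ht v
    have hd := h.deriv t ht 0 h0 v (mem_univ _)
    have hev : (fun r => (g' r).toFun v) =ᶠ[𝓝 t] fun r => G r 0 v := by
      filter_upwards [Ioo_mem_nhds ht.1 ht.2] with r hr using e1 r hr v
    rw [e1 t ht]
    rw [zero_add] at hd
    exact hd.congr_of_eventuallyEq hev

end LinearField

end Flow

/-! ### The connection form of a covariant derivative in a fibrewise linear coordinate -/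

section ConnectionForm

variable {𝕂 : Type*} [RCLike 𝕂]
  {EM : Type*} [NormedAddCommGroup EM] [NormedSpace ℝ EM] [FiniteDimensional ℝ EM]
  {M : Type*} [TopologicalSpace M] [ChartedSpace EM M] [IsManifold 𝓘(ℝ, EM) ∞ M]
  {FE : Type*} [NormedAddCommGroup FE] [NormedSpace ℝ FE] [FiniteDimensional ℝ FE]
  [NormedSpace 𝕂 FE] [IsScalarTower ℝ 𝕂 FE]
  {E : M → Type*} [TopologicalSpace (TotalSpace FE E)] [∀ m, TopologicalSpace (E m)]
  [∀ m, AddCommGroup (E m)] [∀ m, Module ℝ (E m)] [∀ m, Module 𝕂 (E m)]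
  [∀ m, IsScalarTower ℝ 𝕂 (E m)]
  [∀ m, IsTopologicalAddGroup (E m)] [∀ m, ContinuousSMul ℝ (E m)]
  [FiberBundle FE E] [VectorBundle ℝ FE E] [VectorBundle 𝕂 FE E]
  [ContMDiffVectorBundle ∞ FE E 𝓘(ℝ, EM)]
  (nablaE : CovariantDerivative 𝓘(ℝ, EM) FE E)

/-- A covariant derivative with smooth coefficients maps locally defined smooth sections to smooth
sections. -/
theorem contMDiffAt_covariantDerivative [T2Space M]
    (hsmooth : CovariantDerivative.ContMDiffCovariantDerivative nablaE ∞)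
    {W : Set M} (hW : IsOpen W) {r : ∀ m, E m}
    (hr : ContMDiffOn 𝓘(ℝ, EM) (𝓘(ℝ, EM).prod 𝓘(ℝ, FE)) ∞
      (fun m => (⟨m, r m⟩ : TotalSpace FE E)) W) {m : M} (hm : m ∈ W) :
    ContMDiffAt 𝓘(ℝ, EM) (𝓘(ℝ, EM).prod 𝓘(ℝ, EM →L[ℝ] FE)) ∞
      (fun m => (⟨m, nablaE r m⟩ : TotalSpace (EM →L[ℝ] FE)
        fun m => TangentSpace 𝓘(ℝ, EM) m →L[ℝ] E m)) m := by
  -- The smoothness assumption is applied to global sections. Multiplying by a bump function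
  -- supported in `W` and equal to 1 near `m` makes `r` global, and locality of `nablaE` removes the
  -- bump afterwards.
  obtain ⟨f, -, hf⟩ := (SmoothBumpFunction.nhds_basis_tsupport (I := 𝓘(ℝ, EM)) m).mem_iff.1
    (hW.mem_nhds hm)
  have h1 : ContMDiff 𝓘(ℝ, EM) (𝓘(ℝ, EM).prod 𝓘(ℝ, FE)) ∞
      (fun m => (⟨m, ((f : M → ℝ) • r) m⟩ : TotalSpace FE E)) :=
    ContMDiffOn.smul_section_of_tsupport (f.contMDiff.contMDiffOn) hW hf hr
  have h2 := (hsmooth.contMDiff.contMDiff (σ := (f : M → ℝ) • r) h1.contMDiffOn).contMDiffAt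
    (x := m) univ_mem
  refine h2.congr_of_eventuallyEq ?_
  filter_upwards [f.eventuallyEq_one.eventually_nhds, hW.mem_nhds hm] with m' hm' hm'W
  have hrm : MDifferentiableAt 𝓘(ℝ, EM) (𝓘(ℝ, EM).prod 𝓘(ℝ, FE))
      (fun m => (⟨m, r m⟩ : TotalSpace FE E)) m' :=
    (hr.contMDiffAt (hW.mem_nhds hm'W)).mdifferentiableAt (by simp)
  have hfm : MDifferentiableAt 𝓘(ℝ, EM) (𝓘(ℝ, EM).prod 𝓘(ℝ, FE))
      (fun m => (⟨m, ((f : M → ℝ) • r) m⟩ : TotalSpace FE E)) m' :=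
    h1.contMDiffAt.mdifferentiableAt (by simp)
  have h3 := (nablaE.isCovariantDerivativeOn (s := univ)).congr_of_eventuallyEq hrm hfm univ_mem
    (hm'.mono fun x hx => by rw [Pi.smul_apply', hx]; simp)
  rw [h3]

variable {G : Type*} [NormedAddCommGroup G] [NormedSpace ℝ G] [NormedSpace 𝕂 G]
  [IsScalarTower ℝ 𝕂 G]

/-- The difference of `κ (∇_Y r)` and the derivative of `κ r` along `Y`. -/
def covDefect (κ : ∀ m, E m →ₗ[𝕂] G) (r : ∀ m, E m) (m : M) (Y : TangentSpace 𝓘(ℝ, EM) m) : G :=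
  κ m (nablaE r m Y) - mvfderiv 𝓘(ℝ, EM) (fun m => κ m (r m)) m Y

/-- The connection form of a covariant derivative in the fibrewise linear coordinate `κ`. -/
def connForm (κ : ∀ m, E m →ₗ[𝕂] G) (m : M) (Y : TangentSpace 𝓘(ℝ, EM) m) (u : E m) : G :=
  covDefect nablaE κ (FiberBundle.extend FE u) m Y

variable {κ : ∀ m, E m →ₗ[𝕂] G} {Ω : Set M}

theorem mdifferentiableAt_coord_section
    (hκ : ∀ y : TotalSpace FE E, y.proj ∈ Ω → ContMDiffAt (𝓘(ℝ, EM).prod 𝓘(ℝ, FE)) 𝓘(ℝ, G) ∞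
      (fun y : TotalSpace FE E => κ y.1 y.2) y)
    {r : ∀ m, E m} {m : M} (hm : m ∈ Ω)
    (hr : MDifferentiableAt 𝓘(ℝ, EM) (𝓘(ℝ, EM).prod 𝓘(ℝ, FE))
      (fun m => (⟨m, r m⟩ : TotalSpace FE E)) m) :
    MDifferentiableAt 𝓘(ℝ, EM) 𝓘(ℝ, G) (fun m => κ m (r m)) m :=
  MDifferentiableAt.comp (g := fun y : TotalSpace FE E => κ y.1 y.2)
    (f := fun m => (⟨m, r m⟩ : TotalSpace FE E)) m
    ((hκ ⟨m, r m⟩ hm).mdifferentiableAt (by simp)) hr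

/-- Both κ ∘ ∇ and d ∘ κ obey the Leibniz rule with the same term df(Y) κ(r), so the difference is
linear over functions and sees only the value of `r` at `m`. -/
theorem tensorialAt_covDefect
    (hκ : ∀ y : TotalSpace FE E, y.proj ∈ Ω → ContMDiffAt (𝓘(ℝ, EM).prod 𝓘(ℝ, FE)) 𝓘(ℝ, G) ∞
      (fun y : TotalSpace FE E => κ y.1 y.2) y)
    {m : M} (hm : m ∈ Ω) (Y : TangentSpace 𝓘(ℝ, EM) m) :
    TensorialAt 𝓘(ℝ, EM) FE (fun r => covDefect nablaE κ r m Y) m := by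
  constructor
  · intro f r hf hr
    have hd := mdifferentiableAt_coord_section hκ hm hr
    have h1 : (fun m => κ m ((f • r) m)) = fun m => f m • κ m (r m) := by
      ext m
      exact (κ m).map_smul_of_tower (f m) (r m)
    have h2 := congrArg (fun A => A Y) (mvfderiv_fun_smul hf hd)
    have h3 := congrArg (fun A => A Y)
      ((nablaE.isCovariantDerivativeOn (s := univ)).leibniz hr hf)
    simp only [covDefect]
    rw [h1]
    erw [h2, h3]
    simp only [add_apply, smul_apply,
      ContinuousLinearMap.smulRight_apply, map_add, smul_sub, (κ m).map_smul_of_tower]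
    abel
  · intro r r' hr hr'
    have h1 : (fun m => κ m ((r + r') m)) = fun m => κ m (r m) + κ m (r' m) := by
      ext m
      exact map_add (κ m) _ _
    have h2 := congrArg (fun A => A Y) (mvfderiv_fun_add
      (mdifferentiableAt_coord_section hκ hm hr) (mdifferentiableAt_coord_section hκ hm hr'))
    have h3 := congrArg (fun A => A Y)
      ((nablaE.isCovariantDerivativeOn (s := univ)).add hr hr')
    simp only [covDefect]
    rw [h1]
    erw [h2, h3]
    simp only [add_apply, map_add]
    abel

/-- `κ (∇_Y r) = d (κ r) (Y) + A (Y) r`, where `A` is the connection form in the coordinate `κ`. -/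
theorem covDefect_eq_connForm
    (hκ : ∀ y : TotalSpace FE E, y.proj ∈ Ω → ContMDiffAt (𝓘(ℝ, EM).prod 𝓘(ℝ, FE)) 𝓘(ℝ, G) ∞
      (fun y : TotalSpace FE E => κ y.1 y.2) y)
    {m : M} (hm : m ∈ Ω) (Y : TangentSpace 𝓘(ℝ, EM) m) {r : ∀ m, E m}
    (hr : MDifferentiableAt 𝓘(ℝ, EM) (𝓘(ℝ, EM).prod 𝓘(ℝ, FE))
      (fun m => (⟨m, r m⟩ : TotalSpace FE E)) m) :
    covDefect nablaE κ r m Y = connForm nablaE κ m Y (r m) := by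
  have : ContMDiffVectorBundle 1 FE E 𝓘(ℝ, EM) := ContMDiffVectorBundle.of_le (n := ∞) (by simp)
  exact (tensorialAt_covDefect nablaE hκ hm Y).pointwise hr
    (FiberBundle.mdifferentiableAt_extend ..) (by simp)

/-- The differentiable structure is real, while `c` lies in `𝕂`; a `𝕂`-linear trivialization turns
the claim into multiplication by `c` on `FE`. -/
theorem mdifferentiableAt_smul_section' (c : 𝕂) {r : ∀ m, E m} {m : M}
    (hr : MDifferentiableAt 𝓘(ℝ, EM) (𝓘(ℝ, EM).prod 𝓘(ℝ, FE))
      (fun m => (⟨m, r m⟩ : TotalSpace FE E)) m) :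
    MDifferentiableAt 𝓘(ℝ, EM) (𝓘(ℝ, EM).prod 𝓘(ℝ, FE))
      (fun m => (⟨m, (c • r) m⟩ : TotalSpace FE E)) m := by
  set e := trivializationAt FE E m with he
  have hm : m ∈ e.baseSet := FiberBundle.mem_baseSet_trivializationAt' m
  rw [e.mdifferentiableAt_totalSpace_iff 𝓘(ℝ, EM) _ (e.mem_source.2 hm)] at hr ⊢
  refine ⟨hr.1, ?_⟩
  have h1 : MDifferentiableAt 𝓘(ℝ, EM) 𝓘(ℝ, FE) (fun m => c • (e ⟨m, r m⟩).2) m :=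
    MDifferentiableAt.comp (g := fun x : FE => c • x) m
      ((c • ContinuousLinearMap.id ℝ FE).differentiableAt.mdifferentiableAt) hr.2
  refine h1.congr_of_eventuallyEq ?_
  filter_upwards [e.open_baseSet.mem_nhds hm] with m' hm'
  exact (e.linear 𝕂 hm').map_smul c (r m')

/-- Additivity follows from tensoriality, by comparing the sum of two extensions with an extension
of the sum. Homogeneity over `𝕂` needs `hlin`, since a covariant derivative is a priori only real
linear. -/
theorem isLinearMap_connForm
    (hκ : ∀ y : TotalSpace FE E, y.proj ∈ Ω → ContMDiffAt (𝓘(ℝ, EM).prod 𝓘(ℝ, FE)) 𝓘(ℝ, G) ∞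
      (fun y : TotalSpace FE E => κ y.1 y.2) y)
    (hlin : ∀ (c : 𝕂) (r : ∀ m, E m) (m : M),
      MDifferentiableAt 𝓘(ℝ, EM) (𝓘(ℝ, EM).prod 𝓘(ℝ, FE))
        (fun m => (⟨m, r m⟩ : TotalSpace FE E)) m →
      ∀ Y, nablaE (c • r) m Y = c • nablaE r m Y)
    {m : M} (hm : m ∈ Ω) (Y : TangentSpace 𝓘(ℝ, EM) m) :
    IsLinearMap 𝕂 (connForm nablaE κ m Y) := by
  have : ContMDiffVectorBundle 1 FE E 𝓘(ℝ, EM) := ContMDiffVectorBundle.of_le (n := ∞) (by simp)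
  have hext : ∀ u : E m, MDifferentiableAt 𝓘(ℝ, EM) (𝓘(ℝ, EM).prod 𝓘(ℝ, FE))
      (fun m' => (⟨m', FiberBundle.extend FE u m'⟩ : TotalSpace FE E)) m :=
    fun u => FiberBundle.mdifferentiableAt_extend ..
  constructor
  · intro u u'
    have h1 := covDefect_eq_connForm nablaE hκ hm Y
      (mdifferentiableAt_add_section (hext u) (hext u'))
    have h2 := (tensorialAt_covDefect nablaE hκ hm Y).add (hext u) (hext u')
    simp only [Pi.add_apply, FiberBundle.extend_apply_self] at h1
    exact h1.symm.trans h2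
  · intro c u
    have h1 := covDefect_eq_connForm nablaE hκ hm Y (mdifferentiableAt_smul_section' c (hext u))
    simp only [Pi.smul_apply, FiberBundle.extend_apply_self] at h1
    rw [← h1, connForm]
    simp only [covDefect]
    rw [hlin c _ m (hext u), map_smul, smul_sub]
    have hd := mdifferentiableAt_coord_section hκ hm (hext u)
    have h2 : (fun m' => κ m' ((c • FiberBundle.extend FE u) m')) =
        (c • ContinuousLinearMap.id ℝ G) ∘ fun m' => κ m' (FiberBundle.extend FE u m') := by
      ext m'
      exact map_smul (κ m') c _
    rw [h2]
    have h3 := (HasMFDerivAt.comp m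
      (c • ContinuousLinearMap.id ℝ G).hasFDerivAt.hasMFDerivAt hd.hasMFDerivAt).mfderiv
    have h4 := congrArg (fun A => A Y) h3
    exact congrArg _ h4

theorem connForm_add (m : M) (Y Y' : TangentSpace 𝓘(ℝ, EM) m) (u : E m) :
    connForm nablaE κ m (Y + Y') u = connForm nablaE κ m Y u + connForm nablaE κ m Y' u := by
  simp only [connForm, covDefect, map_add]
  abel

theorem connForm_smul (m : M) (c : ℝ) (Y : TangentSpace 𝓘(ℝ, EM) m) (u : E m) :
    connForm nablaE κ m (c • Y) u = c • connForm nablaE κ m Y u := by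
  simp only [connForm, covDefect, map_smul, smul_sub, (κ m).map_smul_of_tower]

theorem contMDiffAt_covDefect [T2Space M]
    (hsmooth : CovariantDerivative.ContMDiffCovariantDerivative nablaE ∞) (hΩ : IsOpen Ω)
    (hκ : ∀ y : TotalSpace FE E, y.proj ∈ Ω → ContMDiffAt (𝓘(ℝ, EM).prod 𝓘(ℝ, FE)) 𝓘(ℝ, G) ∞
      (fun y : TotalSpace FE E => κ y.1 y.2) y)
    {W : Set M} (hW : IsOpen W) {r : ∀ m, E m}
    (hr : ContMDiffOn 𝓘(ℝ, EM) (𝓘(ℝ, EM).prod 𝓘(ℝ, FE)) ∞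
      (fun m => (⟨m, r m⟩ : TotalSpace FE E)) W)
    {p : TangentBundle 𝓘(ℝ, EM) M} (hp : p.1 ∈ Ω) (hpW : p.1 ∈ W) :
    ContMDiffAt 𝓘(ℝ, EM).tangent 𝓘(ℝ, G) ∞
      (fun p : TangentBundle 𝓘(ℝ, EM) M => covDefect nablaE κ r p.1 p.2) p := by
  have h1 : ContMDiffAt 𝓘(ℝ, EM).tangent (𝓘(ℝ, EM).prod 𝓘(ℝ, FE)) ∞
      (fun p : TangentBundle 𝓘(ℝ, EM) M => (⟨p.1, nablaE r p.1 p.2⟩ : TotalSpace FE E)) p := by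
    refine ContMDiffAt.clm_bundle_apply (b := fun p : TangentBundle 𝓘(ℝ, EM) M => p.1)
      (ϕ := fun p => nablaE r p.1) (v := fun p => p.2) ?_ contMDiffAt_id
    exact (contMDiffAt_covariantDerivative nablaE hsmooth hW hr hpW).comp p
      (contMDiffAt_proj (TangentSpace 𝓘(ℝ, EM)))
  have h2 : ContMDiffAt 𝓘(ℝ, EM).tangent 𝓘(ℝ, G) ∞
      (fun p : TangentBundle 𝓘(ℝ, EM) M => κ p.1 (nablaE r p.1 p.2)) p :=
    ContMDiffAt.comp (g := fun y : TotalSpace FE E => κ y.1 y.2)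
      (f := fun p : TangentBundle 𝓘(ℝ, EM) M => (⟨p.1, nablaE r p.1 p.2⟩ : TotalSpace FE E)) p
      (hκ _ hp) h1
  have h3 : ContMDiffOn 𝓘(ℝ, EM) 𝓘(ℝ, G) ∞ (fun m => κ m (r m)) (Ω ∩ W) := by
    intro m hm
    exact (ContMDiffAt.comp (g := fun y : TotalSpace FE E => κ y.1 y.2)
      (f := fun m => (⟨m, r m⟩ : TotalSpace FE E)) m (hκ ⟨m, r m⟩ hm.1)
      (hr.contMDiffAt (hW.mem_nhds hm.2))).contMDiffWithinAt
  have h4 : ContMDiffAt 𝓘(ℝ, EM).tangent 𝓘(ℝ, G) ∞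
      (fun p : TangentBundle 𝓘(ℝ, EM) M =>
        (mfderiv 𝓘(ℝ, EM) 𝓘(ℝ, G) (fun m => κ m (r m)) p.1 p.2 : G)) p :=
    contMDiffAt_mfderiv_apply (hΩ.inter hW) h3 contMDiffAt_id ⟨hp, hpW⟩
  exact h2.sub h4

variable {E₃ H₃ : Type*} [NormedAddCommGroup E₃] [NormedSpace ℝ E₃] [TopologicalSpace H₃]
  {I₃ : ModelWithCorners ℝ E₃ H₃} {N : Type*} [TopologicalSpace N] [ChartedSpace H₃ N]

/-- The extensions in the definition of `connForm` are chosen vector by vector and carry no joint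
smoothness. By tensoriality they may be replaced by the local sections with constant coordinate `c`.
The form then becomes a smooth family of linear maps in `c`, applied to the coordinate of `u`. -/
theorem contMDiffAt_connForm [T2Space M]
    (hsmooth : CovariantDerivative.ContMDiffCovariantDerivative nablaE ∞) (hΩ : IsOpen Ω)
    (hκ : ∀ y : TotalSpace FE E, y.proj ∈ Ω → ContMDiffAt (𝓘(ℝ, EM).prod 𝓘(ℝ, FE)) 𝓘(ℝ, G) ∞
      (fun y : TotalSpace FE E => κ y.1 y.2) y)
    (hlin : ∀ (c : 𝕂) (r : ∀ m, E m) (m : M),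
      MDifferentiableAt 𝓘(ℝ, EM) (𝓘(ℝ, EM).prod 𝓘(ℝ, FE))
        (fun m => (⟨m, r m⟩ : TotalSpace FE E)) m →
      ∀ Y, nablaE (c • r) m Y = c • nablaE r m Y)
    {g : N → TangentBundle 𝓘(ℝ, EM) M} {u : ∀ n, E (g n).1} {n : N} (hn : (g n).1 ∈ Ω)
    (hg : ContMDiffAt I₃ 𝓘(ℝ, EM).tangent ∞ g n)
    (hu : ContMDiffAt I₃ (𝓘(ℝ, EM).prod 𝓘(ℝ, FE)) ∞
      (fun n => (⟨(g n).1, u n⟩ : TotalSpace FE E)) n) :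
    ContMDiffAt I₃ 𝓘(ℝ, G) ∞ (fun n => connForm nablaE κ (g n).1 (g n).2 (u n)) n := by
  set e := trivializationAt FE E (g n).1 with he
  have hm : (g n).1 ∈ e.baseSet := FiberBundle.mem_baseSet_trivializationAt' _
  have hσ : ∀ c : FE, ContMDiffOn 𝓘(ℝ, EM) (𝓘(ℝ, EM).prod 𝓘(ℝ, FE)) ∞
      (fun m => (⟨m, e.symm m c⟩ : TotalSpace FE E)) e.baseSet := by
    intro c m hm
    have h1 : ContMDiffAt 𝓘(ℝ, EM) (𝓘(ℝ, EM).prod 𝓘(ℝ, FE)) ∞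
        (fun m => e.toOpenPartialHomeomorph.symm (m, c)) m :=
      ((e.contMDiffOn_symm (IB := 𝓘(ℝ, EM)) (n := ∞)).contMDiffAt
        (e.open_target.mem_nhds (e.mem_target.2 hm))).comp m
        (contMDiffAt_id.prodMk contMDiffAt_const)
    refine (h1.congr_of_eventuallyEq ?_).contMDiffWithinAt
    filter_upwards [e.open_baseSet.mem_nhds hm] with m' hm'
    exact e.mk_symm hm' c
  have h1 : ContMDiffAt I₃ 𝓘(ℝ, FE →L[𝕂] G) ∞ (fun n =>
      clmOf 𝕂 fun c : FE => covDefect nablaE κ (fun m => e.symm m c) (g n).1 (g n).2) n :=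
    contMDiffAt_clmOf fun c =>
      ContMDiffAt.comp (g := fun p : TangentBundle 𝓘(ℝ, EM) M =>
        covDefect nablaE κ (fun m => e.symm m c) p.1 p.2) n
      (contMDiffAt_covDefect nablaE hsmooth hΩ hκ e.open_baseSet (hσ c) hn hm) hg
  have h2 : ContMDiffAt I₃ 𝓘(ℝ, FE) ∞ (fun n => (e ⟨(g n).1, u n⟩).2) n :=
    ContMDiffAt.comp (g := fun y : TotalSpace FE E => (e y).2) n
      (contMDiffAt_fibCoord e (v := ⟨(g n).1, u n⟩) hm) hu
  have happ : ContDiff ℝ ∞ (fun q : (FE →L[𝕂] G) × FE => q.1 q.2) :=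
    (isBoundedBilinearMap_apply (𝕜 := 𝕂) (E := FE) (F := G)).contDiff.restrict_scalars ℝ
  have h3 : ContMDiffAt I₃ 𝓘(ℝ, G) ∞ (fun n =>
      (clmOf 𝕂 fun c : FE => covDefect nablaE κ (fun m => e.symm m c) (g n).1 (g n).2)
        (e ⟨(g n).1, u n⟩).2) n :=
    ContMDiffAt.comp (g := fun q : (FE →L[𝕂] G) × FE => q.1 q.2) n happ.contMDiff.contMDiffAt
      (h1.prodMk_space h2)
  refine h3.congr_of_eventuallyEq ?_
  have hgp : ContinuousAt (fun n => (g n).1) n :=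
    (FiberBundle.continuous_proj EM (TangentSpace 𝓘(ℝ, EM) : M → Type _)).continuousAt.comp
      hg.continuousAt
  filter_upwards [hgp.preimage_mem_nhds (e.open_baseSet.mem_nhds hm),
    hgp.preimage_mem_nhds (hΩ.mem_nhds hn)] with n' hn' hn'Ω
  have h4 : ∀ c : FE, covDefect nablaE κ (fun m => e.symm m c) (g n').1 (g n').2 =
      connForm nablaE κ (g n').1 (g n').2 (e.symm (g n').1 c) := fun c =>
    covDefect_eq_connForm nablaE hκ hn'Ω _
      (((hσ c).contMDiffAt (e.open_baseSet.mem_nhds hn')).mdifferentiableAt (by simp))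
  have hL := isLinearMap_connForm nablaE hκ hlin hn'Ω (g n').2
  have hL' : IsLinearMap 𝕂 fun c : FE =>
      covDefect nablaE κ (fun m => e.symm m c) (g n').1 (g n').2 := by
    have h5 : (fun c : FE => covDefect nablaE κ (fun m => e.symm m c) (g n').1 (g n').2) =
        fun c => connForm nablaE κ (g n').1 (g n').2 ((e.linearEquivAt 𝕂 _ hn').symm c) :=
      funext h4
    rw [h5]
    exact ⟨fun c c' => by rw [map_add, hL.map_add], fun k c => by rw [map_smul, hL.map_smul]⟩
  rw [clmOf_apply hL', h4]
  congr 1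
  exact (e.symm_apply_apply_mk hn' (u n')).symm

end ConnectionForm

/-! ### The inverse of a local trivialization -/

section LocalTriv

variable {𝕂 : Type*} [RCLike 𝕂]
  {EB : Type*} [NormedAddCommGroup EB] [NormedSpace ℝ EB] [FiniteDimensional ℝ EB]
  {B : Type*} [TopologicalSpace B] [ChartedSpace EB B] [IsManifold 𝓘(ℝ, EB) ∞ B]
  {EM : Type*} [NormedAddCommGroup EM] [NormedSpace ℝ EM] [FiniteDimensional ℝ EM]
  {M : Type*} [TopologicalSpace M] [ChartedSpace EM M] [IsManifold 𝓘(ℝ, EM) ∞ M]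
  {EZ : Type*} [NormedAddCommGroup EZ] [NormedSpace ℝ EZ] [FiniteDimensional ℝ EZ]
  {Z : Type*} [TopologicalSpace Z] [ChartedSpace EZ Z] [IsManifold 𝓘(ℝ, EZ) ∞ Z]
  {FE : Type*} [NormedAddCommGroup FE] [NormedSpace ℝ FE] [FiniteDimensional ℝ FE]
  [NormedSpace 𝕂 FE] [IsScalarTower ℝ 𝕂 FE]
  {E : M → Type*} [TopologicalSpace (TotalSpace FE E)] [∀ m, TopologicalSpace (E m)]
  [∀ m, AddCommGroup (E m)] [∀ m, Module ℝ (E m)] [∀ m, Module 𝕂 (E m)]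
  [∀ m, IsScalarTower ℝ 𝕂 (E m)]
  [∀ m, IsTopologicalAddGroup (E m)] [∀ m, ContinuousSMul ℝ (E m)]
  [FiberBundle FE E] [VectorBundle ℝ FE E] [VectorBundle 𝕂 FE E]
  [ContMDiffVectorBundle ∞ FE E 𝓘(ℝ, EM)]
  {FF : Type*} [NormedAddCommGroup FF] [NormedSpace ℝ FF] [FiniteDimensional ℝ FF]
  [NormedSpace 𝕂 FF] [IsScalarTower ℝ 𝕂 FF]
  {F : Z → Type*} [TopologicalSpace (TotalSpace FF F)] [∀ z, TopologicalSpace (F z)]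
  [∀ z, AddCommGroup (F z)] [∀ z, Module ℝ (F z)] [∀ z, Module 𝕂 (F z)]
  [∀ z, IsScalarTower ℝ 𝕂 (F z)]
  [FiberBundle FF F] [VectorBundle ℝ FF F] [VectorBundle 𝕂 FF F]
  [ContMDiffVectorBundle ∞ FF F 𝓘(ℝ, EZ)]
  {pr : M → B} {U : Set B}

namespace LocalTriv

variable (T : LocalTriv 𝕂 EB EM EZ FE E FF F pr U)

/-- The trivialization as a map `U × F → E`. -/
def total (b : B) (v : TotalSpace FF F) : TotalSpace FE E := ⟨T.Φ b v.1, T.Ψ b v.1 v.2⟩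

theorem total_injective {b : B} (hb : b ∈ U) : Function.Injective (T.total b) := by
  rintro ⟨z, v⟩ ⟨z', v'⟩ h
  have h1 : T.Φ b z = T.Φ b z' := congrArg TotalSpace.proj h
  obtain rfl : z = z' := by rw [← T.ζ_Φ b hb z, h1, T.ζ_Φ b hb z']
  exact congrArg _ ((T.bijective_Ψ b hb z).1 (TotalSpace.mk_injective _ h))

theorem exists_pullFib {m : M} (hm : pr m ∈ U) :
    ∃ L : E m →ₗ[𝕂] F (T.ζ m), ∀ u, T.total (pr m) ⟨T.ζ m, L u⟩ = ⟨m, u⟩ := by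
  -- `Φ (pr m) (ζ m)` equals `m` only propositionally, so the target point is generalized and then
  -- substituted.
  have key : ∀ {z : Z} {m' : M} (ψ : F z →ₗ[𝕂] E m') (_ : Function.Bijective ψ) (_ : m' = m),
      ∃ L : E m →ₗ[𝕂] F z, ∀ u, (⟨m', ψ (L u)⟩ : TotalSpace FE E) = ⟨m, u⟩ := by
    rintro z m' ψ hψ rfl
    refine ⟨(LinearEquiv.ofBijective ψ hψ).symm.toLinearMap, fun u => ?_⟩
    congr 1
    exact (LinearEquiv.ofBijective ψ hψ).apply_symm_apply u
  exact key (T.Ψ (pr m) (T.ζ m)) (T.bijective_Ψ _ hm _) (T.Φ_ζ m hm)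

open scoped Classical in
/-- The inverse of the trivialization on the fibre of `E` over `m`. -/
def pullFib (m : M) : E m →ₗ[𝕂] F (T.ζ m) :=
  if hm : pr m ∈ U then Classical.choose (T.exists_pullFib hm) else 0

/-- The `F`-component of the inverse of the trivialization. -/
def pull (y : TotalSpace FE E) : TotalSpace FF F := ⟨T.ζ y.1, T.pullFib y.1 y.2⟩

theorem total_pull {y : TotalSpace FE E} (hy : pr y.1 ∈ U) : T.total (pr y.1) (T.pull y) = y := by
  have := Classical.choose_spec (T.exists_pullFib hy) y.2
  simp only [pull, pullFib, dif_pos hy]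
  exact this

theorem pull_total {b : B} (hb : b ∈ U) (v : TotalSpace FF F) : T.pull (T.total b v) = v := by
  have h1 : pr (T.total b v).1 = b := T.pr_Φ b hb v.1
  refine T.total_injective hb ?_
  have h2 := T.total_pull (y := T.total b v) (by rwa [h1])
  rwa [h1] at h2

theorem isOpen_preimage (T : LocalTriv 𝕂 EB EM EZ FE E FF F pr U)
    (hpr : ContMDiff 𝓘(ℝ, EM) 𝓘(ℝ, EB) ∞ pr) : IsOpen (pr ⁻¹' U) :=
  T.isOpen_U.preimage hpr.continuous

theorem contMDiffAt_ζ (hpr : ContMDiff 𝓘(ℝ, EM) 𝓘(ℝ, EB) ∞ pr) {m : M} (hm : pr m ∈ U) :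
    ContMDiffAt 𝓘(ℝ, EM) 𝓘(ℝ, EZ) ∞ T.ζ m :=
  T.smooth_ζ.contMDiffAt ((T.isOpen_preimage hpr).mem_nhds hm)

theorem contMDiffAt_Φ {b : B} (hb : b ∈ U) (z : Z) :
    ContMDiffAt (𝓘(ℝ, EB).prod 𝓘(ℝ, EZ)) 𝓘(ℝ, EM) ∞ (fun p : B × Z => T.Φ p.1 p.2) (b, z) :=
  T.smooth_Φ.contMDiffAt ((T.isOpen_U.prod isOpen_univ).mem_nhds ⟨hb, mem_univ z⟩)

theorem contMDiffAt_total {b : B} (hb : b ∈ U) (v : TotalSpace FF F) :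
    ContMDiffAt (𝓘(ℝ, EB).prod (𝓘(ℝ, EZ).prod 𝓘(ℝ, FF))) (𝓘(ℝ, EM).prod 𝓘(ℝ, FE)) ∞
      (fun p : B × TotalSpace FF F => T.total p.1 p.2) (b, v) :=
  T.smooth_Ψ.contMDiffAt ((T.isOpen_U.prod isOpen_univ).mem_nhds ⟨hb, mem_univ v⟩)

/-- In coordinates the trivialization is a smooth family of invertible operators, and inversion of
operators is smooth; hence a fibrewise bijective smooth bundle map has a smooth inverse. -/
theorem contMDiffAt_pull (hpr : ContMDiff 𝓘(ℝ, EM) 𝓘(ℝ, EB) ∞ pr) {y : TotalSpace FE E}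
    (hy : pr y.proj ∈ U) :
    ContMDiffAt (𝓘(ℝ, EM).prod 𝓘(ℝ, FE)) (𝓘(ℝ, EZ).prod 𝓘(ℝ, FF)) ∞ T.pull y := by
  have : FiniteDimensional 𝕂 FF := finiteDimensional_of_real
  set e := trivializationAt FF F (T.ζ y.1) with he
  set e' := trivializationAt FE E y.1 with he'
  have hz : T.ζ y.1 ∈ e.baseSet := FiberBundle.mem_baseSet_trivializationAt' _
  have hm : y.1 ∈ e'.baseSet := FiberBundle.mem_baseSet_trivializationAt' _
  have hζ := T.contMDiffAt_ζ hpr hy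
  have hproj : ContMDiffAt (𝓘(ℝ, EM).prod 𝓘(ℝ, FE)) 𝓘(ℝ, EZ) ∞
      (fun y : TotalSpace FE E => T.ζ y.1) y := hζ.comp y (contMDiffAt_proj E)
  rw [e.contMDiffAt_iff (IB := 𝓘(ℝ, EZ)) (n := ∞) (e.mem_source.2 hz)]
  refine ⟨hproj, ?_⟩
  -- The coordinate expression of the isomorphism over the point of `B × Z` corresponding to `m`.
  set α : M → FF → FE := fun m c =>
    (e' (T.total (pr m) (e.toOpenPartialHomeomorph.symm (T.ζ m, c)))).2 with hα
  have hαs : ∀ c, ContMDiffAt 𝓘(ℝ, EM) 𝓘(ℝ, FE) ∞ (fun m => α m c) y.1 := by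
    intro c
    have h1 : ContMDiffAt 𝓘(ℝ, EM) (𝓘(ℝ, EZ).prod 𝓘(ℝ, FF)) ∞
        (fun m => e.toOpenPartialHomeomorph.symm (T.ζ m, c)) y.1 :=
      ContMDiffAt.comp (g := e.toOpenPartialHomeomorph.symm) y.1
        ((e.contMDiffOn_symm (IB := 𝓘(ℝ, EZ)) (n := ∞)).contMDiffAt
          (e.open_target.mem_nhds (e.mem_target.2 hz))) (hζ.prodMk contMDiffAt_const)
    have h2 : ContMDiffAt 𝓘(ℝ, EM) (𝓘(ℝ, EM).prod 𝓘(ℝ, FE)) ∞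
        (fun m => T.total (pr m) (e.toOpenPartialHomeomorph.symm (T.ζ m, c))) y.1 :=
      ContMDiffAt.comp (g := fun p : B × TotalSpace FF F => T.total p.1 p.2) y.1
        (T.contMDiffAt_total hy _) (hpr.contMDiffAt.prodMk h1)
    refine ContMDiffAt.comp (g := fun y : TotalSpace FE E => (e' y).2) y.1
      (contMDiffAt_fibCoord e' ?_) h2
    have h3 : (e.toOpenPartialHomeomorph.symm (T.ζ y.1, c)).proj = T.ζ y.1 :=
      e.proj_symm_apply' hz
    change T.Φ (pr y.1) _ ∈ _
    rw [h3, T.Φ_ζ _ hy]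
    exact hm
  have hαe : ∀ m, pr m ∈ U → m ∈ e'.baseSet → T.ζ m ∈ e.baseSet →
      ∃ A : FF ≃L[𝕂] FE, α m = A := by
    intro m hmU hme' hme
    have hΦ : T.Φ (pr m) (T.ζ m) ∈ e'.baseSet := by rwa [T.Φ_ζ m hmU]
    refine ⟨(((e.linearEquivAt 𝕂 _ hme).symm.trans (LinearEquiv.ofBijective _
      (T.bijective_Ψ _ hmU (T.ζ m)))).trans (e'.linearEquivAt 𝕂 _ hΦ)).toContinuousLinearEquiv, ?_⟩
    ext c
    have h1 : (⟨T.ζ m, (e.linearEquivAt 𝕂 _ hme).symm c⟩ : TotalSpace FF F) =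
        e.toOpenPartialHomeomorph.symm (T.ζ m, c) := e.mk_symm hme c
    simp only [hα]
    rw [← h1]
    rfl
  have hev : (fun y : TotalSpace FE E => (e (T.pull y)).2) =ᶠ[𝓝 y] fun y =>
      (clmOf 𝕂 (α y.1)).inverse (e' y).2 := by
    have h1 : ContinuousAt (fun y : TotalSpace FE E => y.1) y :=
      (FiberBundle.continuous_proj FE E).continuousAt
    filter_upwards [h1.preimage_mem_nhds ((T.isOpen_preimage hpr).mem_nhds hy),
      h1.preimage_mem_nhds (e'.open_baseSet.mem_nhds hm),
      hproj.continuousAt.preimage_mem_nhds (e.open_baseSet.mem_nhds hz)] with x hx1 hx2 hx3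
    obtain ⟨A, hA⟩ := hαe x.1 hx1 hx2 hx3
    have h2 : clmOf 𝕂 (α x.1) = A := by
      ext c
      rw [clmOf_apply (by rw [hA]; exact A.toLinearMap.isLinear), hA]
      rfl
    rw [h2, ContinuousLinearMap.inverse_equiv]
    refine (A.symm_apply_eq.2 ?_).symm
    rw [← hA]
    simp only [hα]
    have h3 : e.toOpenPartialHomeomorph.symm (T.ζ x.1, (e (T.pull x)).2) = T.pull x :=
      e.symm_apply_mk_proj (x := T.pull x) (e.mem_source.2 hx3)
    rw [h3, T.total_pull hx1]
  refine ContMDiffAt.congr_of_eventuallyEq ?_ hev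
  obtain ⟨A, hA⟩ := hαe y.1 hy hm hz
  have h2 : clmOf 𝕂 (α y.1) = A := by
    ext c
    rw [clmOf_apply (by rw [hA]; exact A.toLinearMap.isLinear), hA]
    rfl
  have hinv : ContDiffAt ℝ ∞ (ContinuousLinearMap.inverse : (FF →L[𝕂] FE) → FE →L[𝕂] FF)
      (clmOf 𝕂 (α y.1)) := by
    rw [h2]
    exact (contDiffAt_map_inverse (𝕜 := 𝕂) (n := ∞) A).restrict_scalars ℝ
  have h3 : ContMDiffAt 𝓘(ℝ, EM) 𝓘(ℝ, FE →L[𝕂] FF) ∞ (fun m => (clmOf 𝕂 (α m)).inverse) y.1 :=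
    ContMDiffAt.comp (g := (ContinuousLinearMap.inverse : (FF →L[𝕂] FE) → FE →L[𝕂] FF)) y.1
      hinv.contMDiffAt (contMDiffAt_clmOf hαs)
  have h4 : ContMDiffAt (𝓘(ℝ, EM).prod 𝓘(ℝ, FE)) 𝓘(ℝ, FE →L[𝕂] FF) ∞
      (fun y : TotalSpace FE E => (clmOf 𝕂 (α y.1)).inverse) y :=
    h3.comp y (contMDiffAt_proj E)
  have happ : ContDiff ℝ ∞ (fun q : (FE →L[𝕂] FF) × FE => q.1 q.2) :=
    (isBoundedBilinearMap_apply (𝕜 := 𝕂) (E := FE) (F := FF)).contDiff.restrict_scalars ℝ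
  exact ContMDiffAt.comp (g := fun q : (FE →L[𝕂] FF) × FE => q.1 q.2) y
    happ.contMDiff.contMDiffAt (h4.prodMk_space (contMDiffAt_fibCoord e' hm))

variable (e : Trivialization FF (π FF F)) [MemTrivializationAtlas e]

/-- The fibre coordinate on `E` given by a trivialization of `F`. -/
def coord (m : M) : E m →ₗ[𝕂] FF := e.linearMapAt 𝕂 (T.ζ m) ∘ₗ T.pullFib m

/-- The set over which the fibre coordinate `coord` is defined. -/
def coordDomain : Set M := pr ⁻¹' U ∩ T.ζ ⁻¹' e.baseSet

theorem coord_apply {m : M} (hm : m ∈ T.coordDomain e) (u : E m) :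
    T.coord e m u = (e (T.pull ⟨m, u⟩)).2 :=
  congrFun (e.coe_linearMapAt_of_mem hm.2) _

theorem isOpen_coordDomain (hpr : ContMDiff 𝓘(ℝ, EM) 𝓘(ℝ, EB) ∞ pr) :
    IsOpen (T.coordDomain e) :=
  T.smooth_ζ.continuousOn.isOpen_inter_preimage (T.isOpen_preimage hpr) e.open_baseSet

theorem contMDiffAt_coord (hpr : ContMDiff 𝓘(ℝ, EM) 𝓘(ℝ, EB) ∞ pr) (y : TotalSpace FE E)
    (hy : y.proj ∈ T.coordDomain e) :
    ContMDiffAt (𝓘(ℝ, EM).prod 𝓘(ℝ, FE)) 𝓘(ℝ, FF) ∞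
      (fun y : TotalSpace FE E => T.coord e y.1 y.2) y := by
  have h1 : ContMDiffAt (𝓘(ℝ, EM).prod 𝓘(ℝ, FE)) 𝓘(ℝ, FF) ∞
      (fun y : TotalSpace FE E => (e (T.pull y)).2) y :=
    ContMDiffAt.comp (g := fun v : TotalSpace FF F => (e v).2) y
      (contMDiffAt_fibCoord e (v := T.pull y) hy.2) (T.contMDiffAt_pull hpr hy.1)
  refine h1.congr_of_eventuallyEq ?_
  filter_upwards [(FiberBundle.continuous_proj FE E).continuousAt.preimage_mem_nhds
    ((T.isOpen_coordDomain e hpr).mem_nhds hy)] with x hx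
  exact T.coord_apply e hx x.2

end LocalTriv

end LocalTriv

/-! ### Smoothness of maps into tangent bundles -/

section TangentMaps

variable {E₃ H₃ : Type*} [NormedAddCommGroup E₃] [NormedSpace ℝ E₃] [TopologicalSpace H₃]
  {I₃ : ModelWithCorners ℝ E₃ H₃} {N : Type*} [TopologicalSpace N] [ChartedSpace H₃ N]
  {G : Type*} [NormedAddCommGroup G] [NormedSpace ℝ G]

theorem contMDiffAt_tangentBundle_space {f g : N → G} {n : N}
    (hf : ContMDiffAt I₃ 𝓘(ℝ, G) ∞ f n) (hg : ContMDiffAt I₃ 𝓘(ℝ, G) ∞ g n) :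
    ContMDiffAt I₃ 𝓘(ℝ, G).tangent ∞ (fun n => (⟨f n, g n⟩ : TangentBundle 𝓘(ℝ, G) G)) n := by
  rw [Bundle.contMDiffAt_totalSpace]
  refine ⟨hf, ?_⟩
  convert! hg with y
  simp

variable {EZ : Type*} [NormedAddCommGroup EZ] [NormedSpace ℝ EZ]
  {Z : Type*} [TopologicalSpace Z] [ChartedSpace EZ Z] [IsManifold 𝓘(ℝ, EZ) ∞ Z]
  {FF : Type*} [NormedAddCommGroup FF] [NormedSpace ℝ FF]
  {F : Z → Type*} [TopologicalSpace (TotalSpace FF F)] [∀ z, TopologicalSpace (F z)]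
  [∀ z, AddCommGroup (F z)] [∀ z, Module ℝ (F z)]
  [FiberBundle FF F] [VectorBundle ℝ FF F] [ContMDiffVectorBundle ∞ FF F 𝓘(ℝ, EZ)]
  {e : Trivialization FF (π FF F)} [MemTrivializationAtlas e]

/-- The vector is recovered from its two components by the tangent map of the inverse
trivialization, which is smooth. Smoothness may thus be checked on the projection and on one fibre
coordinate. -/
theorem contMDiffAt_tangent_of_coords {g : N → TotalSpace FF F}
    {ξ : ∀ n, TangentSpace (𝓘(ℝ, EZ).prod 𝓘(ℝ, FF)) (g n)} {n : N} (hn : (g n).proj ∈ e.baseSet)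
    (hg : ContMDiffAt I₃ (𝓘(ℝ, EZ).prod 𝓘(ℝ, FF)) ∞ g n)
    (hproj : ContMDiffAt I₃ 𝓘(ℝ, EZ).tangent ∞
      (fun n => (⟨(g n).proj, projDeriv (g n) (ξ n)⟩ : TangentBundle 𝓘(ℝ, EZ) Z)) n)
    (hfib : ContMDiffAt I₃ 𝓘(ℝ, FF) ∞ (fun n => fibDeriv e (g n) (ξ n)) n) :
    ContMDiffAt I₃ (𝓘(ℝ, EZ).prod 𝓘(ℝ, FF)).tangent ∞ (fun n => (⟨g n, ξ n⟩ :
      TangentBundle (𝓘(ℝ, EZ).prod 𝓘(ℝ, FF)) (TotalSpace FF F))) n := by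
  have : IsManifold (𝓘(ℝ, EZ).prod 𝓘(ℝ, FF)) ∞ (TotalSpace FF F) :=
    Bundle.TotalSpace.isManifold FF F
  have h1 : ContMDiffAt I₃ 𝓘(ℝ, FF) ∞ (fun n => (e (g n)).2) n :=
    ContMDiffAt.comp (g := fun v : TotalSpace FF F => (e v).2) n (contMDiffAt_fibCoord e hn) hg
  have h2 := contMDiffAt_tangentBundle_space h1 hfib
  have h3 := (contMDiff_equivTangentBundleProd_symm (I := 𝓘(ℝ, EZ)) (M := Z) (I' := 𝓘(ℝ, FF))
      (M' := FF) (n := ∞)).contMDiffAt.comp n (hproj.prodMk h2)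
  have h4 := (contMDiffAt_tangentMap_of_isOpen (I₁ := 𝓘(ℝ, EZ).prod 𝓘(ℝ, FF))
    (I₂ := 𝓘(ℝ, EZ).prod 𝓘(ℝ, FF)) (f := e.toOpenPartialHomeomorph.symm) e.open_target
    (e.contMDiffOn_symm (IB := 𝓘(ℝ, EZ)) (n := ∞))
    (p := ⟨((g n).proj, (e (g n)).2), (projDeriv (g n) (ξ n), fibDeriv e (g n) (ξ n))⟩)
    (e.mem_target.2 hn)).comp n h3
  refine h4.congr_of_eventuallyEq ?_
  have hc : ContinuousAt (fun n => (g n).proj) n :=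
    (FiberBundle.continuous_proj FF F).continuousAt.comp hg.continuousAt
  filter_upwards [hc.preimage_mem_nhds (e.open_baseSet.mem_nhds hn)] with n' hn'
  have key : ∀ (v : TotalSpace FF F) (η : TangentSpace (𝓘(ℝ, EZ).prod 𝓘(ℝ, FF)) v)
      (w : TotalSpace FF F) (_ : w = v) (ζ : EZ × FF) (_ : ζ = η),
      (⟨v, η⟩ : TangentBundle (𝓘(ℝ, EZ).prod 𝓘(ℝ, FF)) (TotalSpace FF F)) = ⟨w, ζ⟩ := by
    rintro v η w rfl ζ rfl
    rfl
  exact key _ _ _ (e.symm_apply_mk_proj (e.mem_source.2 hn')) _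
    (tangentOf_projDeriv_fibDeriv hn' (ξ n'))

end TangentMaps

/-! ### The horizontal lift -/

section HorizontalLift

variable {EB : Type*} [NormedAddCommGroup EB] [NormedSpace ℝ EB]
  {B : Type*} [TopologicalSpace B] [ChartedSpace EB B]
  {EM : Type*} [NormedAddCommGroup EM] [NormedSpace ℝ EM]
  {M : Type*} [TopologicalSpace M] [ChartedSpace EM M] [IsManifold 𝓘(ℝ, EM) ∞ M]
  {pr : M → B} (H : HorizontalBundle EB EM pr)

theorem HorizontalBundle.tangentMap_projection (m : M) (Y : TangentSpace 𝓘(ℝ, EM) m) :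
    tangentMap 𝓘(ℝ, EM) 𝓘(ℝ, EB) pr ⟨m, (H.H m).projection _ (H.isCompl m) Y⟩ =
      tangentMap 𝓘(ℝ, EM) 𝓘(ℝ, EB) pr ⟨m, Y⟩ := by
  refine congrArg (TotalSpace.mk (pr m)) ?_
  set P := (H.H m).projection _ (H.isCompl m) with hP
  set dpr := mfderiv 𝓘(ℝ, EM) 𝓘(ℝ, EB) pr m with hdpr
  have h1 : Y - P Y ∈ dpr.ker := by
    rw [← Submodule.projection_apply_eq_zero_iff (H.isCompl m), map_sub, sub_eq_zero]
    exact (Submodule.projection_eq_self_iff (H.isCompl m) _).2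
      (Submodule.projection_apply_mem (H.isCompl m) Y) |>.symm
  have h2 : dpr (Y - P Y) = 0 := h1
  rw [map_sub, sub_eq_zero] at h2
  exact h2.symm

/-- The chosen lift and Y differ by a vertical vector, so they have the same horizontal projection,
and the lift is its own projection. The choice is thereby replaced by an operator that is linear on
each tangent space and smooth. -/
theorem HorizontalBundle.lift_tangentMap (m : M) (Y : TangentSpace 𝓘(ℝ, EM) m) :
    H.lift m (tangentMap 𝓘(ℝ, EM) 𝓘(ℝ, EB) pr ⟨m, Y⟩) =
      (H.H m).projection _ (H.isCompl m) Y := by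
  set dpr := mfderiv 𝓘(ℝ, EM) 𝓘(ℝ, EB) pr m with hdpr
  obtain ⟨h1, h2⟩ := Classical.epsilon_spec (p := fun Y' => Y' ∈ H.H m ∧
    tangentMap 𝓘(ℝ, EM) 𝓘(ℝ, EB) pr ⟨m, Y'⟩ = tangentMap 𝓘(ℝ, EM) 𝓘(ℝ, EB) pr ⟨m, Y⟩)
    ⟨_, Submodule.projection_apply_mem (H.isCompl m) Y, H.tangentMap_projection m Y⟩
  have h3 : dpr (H.lift m (tangentMap 𝓘(ℝ, EM) 𝓘(ℝ, EB) pr ⟨m, Y⟩)) = dpr Y :=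
    TotalSpace.mk_injective _ h2
  have h4 : H.lift m (tangentMap 𝓘(ℝ, EM) 𝓘(ℝ, EB) pr ⟨m, Y⟩) - Y ∈ dpr.ker := by
    change dpr _ = 0
    rw [map_sub, h3, sub_self]
  rw [← Submodule.projection_apply_eq_zero_iff (H.isCompl m), map_sub, sub_eq_zero] at h4
  exact ((Submodule.projection_eq_self_iff (H.isCompl m) _).2 h1).symm.trans h4

end HorizontalLift

/-! ### The horizontal lift in a local trivialization -/

section Lift

variable {𝕂 : Type*} [RCLike 𝕂]
  {EB : Type*} [NormedAddCommGroup EB] [NormedSpace ℝ EB] [FiniteDimensional ℝ EB]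
  {B : Type*} [TopologicalSpace B] [ChartedSpace EB B] [IsManifold 𝓘(ℝ, EB) ∞ B]
  {EM : Type*} [NormedAddCommGroup EM] [NormedSpace ℝ EM] [FiniteDimensional ℝ EM]
  {M : Type*} [TopologicalSpace M] [ChartedSpace EM M] [IsManifold 𝓘(ℝ, EM) ∞ M]
  {EZ : Type*} [NormedAddCommGroup EZ] [NormedSpace ℝ EZ] [FiniteDimensional ℝ EZ]
  {Z : Type*} [TopologicalSpace Z] [ChartedSpace EZ Z] [IsManifold 𝓘(ℝ, EZ) ∞ Z]
  {FE : Type*} [NormedAddCommGroup FE] [NormedSpace ℝ FE] [FiniteDimensional ℝ FE]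
  [NormedSpace 𝕂 FE] [IsScalarTower ℝ 𝕂 FE]
  {E : M → Type*} [TopologicalSpace (TotalSpace FE E)] [∀ m, TopologicalSpace (E m)]
  [∀ m, AddCommGroup (E m)] [∀ m, Module ℝ (E m)] [∀ m, Module 𝕂 (E m)]
  [∀ m, IsScalarTower ℝ 𝕂 (E m)]
  [∀ m, IsTopologicalAddGroup (E m)] [∀ m, ContinuousSMul ℝ (E m)]
  [FiberBundle FE E] [VectorBundle ℝ FE E] [VectorBundle 𝕂 FE E]
  [ContMDiffVectorBundle ∞ FE E 𝓘(ℝ, EM)]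
  {FF : Type*} [NormedAddCommGroup FF] [NormedSpace ℝ FF] [FiniteDimensional ℝ FF]
  [NormedSpace 𝕂 FF] [IsScalarTower ℝ 𝕂 FF]
  {F : Z → Type*} [TopologicalSpace (TotalSpace FF F)] [∀ z, TopologicalSpace (F z)]
  [∀ z, AddCommGroup (F z)] [∀ z, Module ℝ (F z)] [∀ z, Module 𝕂 (F z)]
  [∀ z, IsScalarTower ℝ 𝕂 (F z)]
  [FiberBundle FF F] [VectorBundle ℝ FF F] [VectorBundle 𝕂 FF F]
  [ContMDiffVectorBundle ∞ FF F 𝓘(ℝ, EZ)]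
  {pr : M → B} {U : Set B}

namespace LocalTriv

variable (T : LocalTriv 𝕂 EB EM EZ FE E FF F pr U) (H : HorizontalBundle EB EM pr)

theorem tangentMap_pr_Φ (hpr : ContMDiff 𝓘(ℝ, EM) 𝓘(ℝ, EB) ∞ pr) {b : B} (hb : b ∈ U) (z : Z)
    (X : TangentSpace (𝓘(ℝ, EB).prod 𝓘(ℝ, EZ)) (b, z)) :
    tangentMap 𝓘(ℝ, EM) 𝓘(ℝ, EB) pr ⟨T.Φ b z, mfderiv (𝓘(ℝ, EB).prod 𝓘(ℝ, EZ)) 𝓘(ℝ, EM)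
      (fun p : B × Z => T.Φ p.1 p.2) (b, z) X⟩ = ⟨b, X.1⟩ := by
  have hΦ : MDifferentiableAt (𝓘(ℝ, EB).prod 𝓘(ℝ, EZ)) 𝓘(ℝ, EM)
      (fun p : B × Z => T.Φ p.1 p.2) (b, z) := (T.contMDiffAt_Φ hb z).mdifferentiableAt (by simp)
  have h1 := tangentMap_comp_at (I := 𝓘(ℝ, EB).prod 𝓘(ℝ, EZ)) (I' := 𝓘(ℝ, EM))
    (I'' := 𝓘(ℝ, EB)) (f := fun p : B × Z => T.Φ p.1 p.2) (g := pr) ⟨(b, z), X⟩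
    (hpr.contMDiffAt.mdifferentiableAt (by simp)) hΦ
  refine h1.symm.trans ?_
  have h2 : (pr ∘ fun p : B × Z => T.Φ p.1 p.2) =ᶠ[𝓝 (b, z)] Prod.fst := by
    filter_upwards [(T.isOpen_U.prod isOpen_univ).mem_nhds ⟨hb, mem_univ z⟩] with p hp
    exact T.pr_Φ p.1 hp.1 p.2
  have h3 : tangentMap (𝓘(ℝ, EB).prod 𝓘(ℝ, EZ)) 𝓘(ℝ, EB) (pr ∘ fun p : B × Z => T.Φ p.1 p.2)
      ⟨(b, z), X⟩ = tangentMap (𝓘(ℝ, EB).prod 𝓘(ℝ, EZ)) 𝓘(ℝ, EB) Prod.fst ⟨(b, z), X⟩ := by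
    simp only [tangentMap]
    rw [h2.mfderiv_eq, h2.self_of_nhds]
  rw [h3, tangentMap_prodFst]

/-- The vector (X, 0) on the product is a linear and smooth choice of a vector over `X`; projecting
its image to the horizontal space makes linearity and smoothness of the lift visible. -/
theorem lift_eq_projection (hpr : ContMDiff 𝓘(ℝ, EM) 𝓘(ℝ, EB) ∞ pr) {b : B} (hb : b ∈ U) (z : Z)
    (X : TangentSpace 𝓘(ℝ, EB) b) :
    H.lift (T.Φ b z) ⟨b, X⟩ = (H.H _).projection _ (H.isCompl _)
      (mfderiv (𝓘(ℝ, EB).prod 𝓘(ℝ, EZ)) 𝓘(ℝ, EM) (fun p : B × Z => T.Φ p.1 p.2) (b, z)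
        ((X, 0) : EB × EZ)) := by
  have h1 := T.tangentMap_pr_Φ hpr hb z ((X, 0) : EB × EZ)
  have h2 := H.lift_tangentMap (T.Φ b z) (mfderiv (𝓘(ℝ, EB).prod 𝓘(ℝ, EZ)) 𝓘(ℝ, EM)
    (fun p : B × Z => T.Φ p.1 p.2) (b, z) ((X, 0) : EB × EZ))
  rw [h1] at h2
  exact h2

theorem tangentMap_lift (hpr : ContMDiff 𝓘(ℝ, EM) 𝓘(ℝ, EB) ∞ pr) {b : B} (hb : b ∈ U) (z : Z)
    (X : TangentSpace 𝓘(ℝ, EB) b) :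
    tangentMap 𝓘(ℝ, EM) 𝓘(ℝ, EB) pr ⟨T.Φ b z, H.lift (T.Φ b z) ⟨b, X⟩⟩ = ⟨b, X⟩ := by
  rw [T.lift_eq_projection H hpr hb, H.tangentMap_projection]
  exact T.tangentMap_pr_Φ hpr hb z ((X, 0) : EB × EZ)

theorem lift_add (hpr : ContMDiff 𝓘(ℝ, EM) 𝓘(ℝ, EB) ∞ pr) {b : B} (hb : b ∈ U) (z : Z)
    (X Y : TangentSpace 𝓘(ℝ, EB) b) :
    H.lift (T.Φ b z) ⟨b, X + Y⟩ = H.lift (T.Φ b z) ⟨b, X⟩ + H.lift (T.Φ b z) ⟨b, Y⟩ := by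
  rw [T.lift_eq_projection H hpr hb, T.lift_eq_projection H hpr hb, T.lift_eq_projection H hpr hb,
    ← map_add]
  congr 1
  have h1 : ((X + Y, 0) : EB × EZ) = (X, 0) + (Y, 0) :=
    Prod.ext rfl (add_zero (0 : EZ)).symm
  exact (congrArg _ h1).trans (map_add (mfderiv (𝓘(ℝ, EB).prod 𝓘(ℝ, EZ)) 𝓘(ℝ, EM)
    (fun p : B × Z => T.Φ p.1 p.2) (b, z)) _ _)

theorem lift_smul (hpr : ContMDiff 𝓘(ℝ, EM) 𝓘(ℝ, EB) ∞ pr) {b : B} (hb : b ∈ U) (z : Z)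
    (c : ℝ) (X : TangentSpace 𝓘(ℝ, EB) b) :
    H.lift (T.Φ b z) ⟨b, c • X⟩ = c • H.lift (T.Φ b z) ⟨b, X⟩ := by
  rw [T.lift_eq_projection H hpr hb, T.lift_eq_projection H hpr hb, ← map_smul]
  congr 1
  have h1 : ((c • X, 0) : EB × EZ) = c • (X, 0) :=
    Prod.ext rfl (smul_zero c).symm
  exact (congrArg _ h1).trans (map_smul (mfderiv (𝓘(ℝ, EB).prod 𝓘(ℝ, EZ)) 𝓘(ℝ, EM)
    (fun p : B × Z => T.Φ p.1 p.2) (b, z)) _ _)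

/-- The `Z`-component of the horizontal lift. -/
def liftZ (b : B) (X : TangentSpace 𝓘(ℝ, EB) b) (z : Z) : TangentSpace 𝓘(ℝ, EZ) z :=
  (mfderiv 𝓘(ℝ, EM) 𝓘(ℝ, EZ) T.ζ (T.Φ b z) (H.lift (T.Φ b z) ⟨b, X⟩) : EZ)

theorem tangentMap_ζ_lift {b : B} (hb : b ∈ U) (z : Z) (X : TangentSpace 𝓘(ℝ, EB) b) :
    tangentMap 𝓘(ℝ, EM) 𝓘(ℝ, EZ) T.ζ ⟨T.Φ b z, H.lift (T.Φ b z) ⟨b, X⟩⟩ =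
      ⟨z, T.liftZ H b X z⟩ := by
  have key : ∀ {w : Z} (_ : w = z) (V : EZ), (⟨w, V⟩ : TangentBundle 𝓘(ℝ, EZ) Z) = ⟨z, V⟩ := by
    rintro w rfl V
    rfl
  exact key (T.ζ_Φ b hb z) _

/-- Since `(pr, ζ)` inverts `Φ`, every tangent vector of `M` over `U` is the image under `Φ` of its
two components. For the lift, the `B`-component is `X`. -/
theorem lift_eq_mfderiv_Φ (hpr : ContMDiff 𝓘(ℝ, EM) 𝓘(ℝ, EB) ∞ pr) {b : B} (hb : b ∈ U) (z : Z)
    (X : TangentSpace 𝓘(ℝ, EB) b) :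
    H.lift (T.Φ b z) ⟨b, X⟩ =
      mfderiv (𝓘(ℝ, EB).prod 𝓘(ℝ, EZ)) 𝓘(ℝ, EM) (fun p : B × Z => T.Φ p.1 p.2) (b, z)
        ((X, T.liftZ H b X z) : EB × EZ) := by
  set m := T.Φ b z with hm
  set Y := H.lift m ⟨b, X⟩ with hY
  have hmU : pr m ∈ U := by rw [hm, T.pr_Φ b hb]; exact hb
  have hbz : (pr m, T.ζ m) = (b, z) := by rw [hm, T.pr_Φ b hb, T.ζ_Φ b hb]
  have h1 : HasMFDerivAt 𝓘(ℝ, EM) (𝓘(ℝ, EB).prod 𝓘(ℝ, EZ)) (fun m => (pr m, T.ζ m)) m _ :=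
    (hpr.contMDiffAt.mdifferentiableAt (by simp)).hasMFDerivAt.prodMk
      ((T.contMDiffAt_ζ hpr hmU).mdifferentiableAt (by simp)).hasMFDerivAt
  have hΦ : MDifferentiableAt (𝓘(ℝ, EB).prod 𝓘(ℝ, EZ)) 𝓘(ℝ, EM)
      (fun p : B × Z => T.Φ p.1 p.2) (pr m, T.ζ m) :=
    (T.contMDiffAt_Φ hmU _).mdifferentiableAt (by simp)
  have h2 := HasMFDerivAt.comp m hΦ.hasMFDerivAt h1
  have h3 : ((fun p : B × Z => T.Φ p.1 p.2) ∘ fun m => (pr m, T.ζ m)) =ᶠ[𝓝 m] id := by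
    filter_upwards [(T.isOpen_preimage hpr).mem_nhds hmU] with m' hm'
    exact T.Φ_ζ m' hm'
  have h4 := (h2.congr_of_eventuallyEq h3.symm).mfderiv
  rw [mfderiv_id] at h4
  have h5 := congrArg (fun A => A Y) h4
  refine Eq.trans (show Y = _ from h5) ?_
  have key : ∀ (p q : B × Z) (_ : p = q) (W W' : EB × EZ) (_ : W = W'),
      (mfderiv (𝓘(ℝ, EB).prod 𝓘(ℝ, EZ)) 𝓘(ℝ, EM) (fun p : B × Z => T.Φ p.1 p.2) p W : EM) =
      (mfderiv (𝓘(ℝ, EB).prod 𝓘(ℝ, EZ)) 𝓘(ℝ, EM) (fun p : B × Z => T.Φ p.1 p.2) q W' : EM) := by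
    rintro p _ rfl W _ rfl
    rfl
  have key2 : ∀ {b' : B} (X' : EB), (⟨b', X'⟩ : TangentBundle 𝓘(ℝ, EB) B) = ⟨b, X⟩ →
      X' = X := by
    rintro b' X' h
    cases h
    rfl
  refine key _ _ hbz _ _ (Prod.ext ?_ rfl)
  exact key2 _ (T.tangentMap_lift H hpr hb z X)

variable {E₃ H₃ : Type*} [NormedAddCommGroup E₃] [NormedSpace ℝ E₃] [TopologicalSpace H₃]
  {I₃ : ModelWithCorners ℝ E₃ H₃} {N : Type*} [TopologicalSpace N] [ChartedSpace H₃ N]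

theorem contMDiffAt_lift (hpr : ContMDiff 𝓘(ℝ, EM) 𝓘(ℝ, EB) ∞ pr)
    {h : N → TangentBundle 𝓘(ℝ, EB) B} {k : N → Z} {n : N} (hn : (h n).1 ∈ U)
    (hh : ContMDiffAt I₃ 𝓘(ℝ, EB).tangent ∞ h n) (hk : ContMDiffAt I₃ 𝓘(ℝ, EZ) ∞ k n) :
    ContMDiffAt I₃ 𝓘(ℝ, EM).tangent ∞ (fun n => (⟨T.Φ (h n).1 (k n),
      H.lift (T.Φ (h n).1 (k n)) ⟨(h n).1, (h n).2⟩⟩ : TangentBundle 𝓘(ℝ, EM) M)) n := by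
  have h1 : ContMDiffAt I₃ 𝓘(ℝ, EZ).tangent ∞
      (fun n => (⟨k n, 0⟩ : TangentBundle 𝓘(ℝ, EZ) Z)) n :=
    (contMDiff_zeroSection ℝ (TangentSpace 𝓘(ℝ, EZ) : Z → Type _)).contMDiffAt.comp n hk
  have h2 := (contMDiff_equivTangentBundleProd_symm (I := 𝓘(ℝ, EB)) (M := B) (I' := 𝓘(ℝ, EZ))
      (M' := Z) (n := ∞)).contMDiffAt.comp n (hh.prodMk h1)
  have h3 := (contMDiffAt_tangentMap_of_isOpen (I₁ := 𝓘(ℝ, EB).prod 𝓘(ℝ, EZ))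
    (I₂ := 𝓘(ℝ, EM)) (f := fun p : B × Z => T.Φ p.1 p.2) (T.isOpen_U.prod isOpen_univ)
    T.smooth_Φ (p := ⟨((h n).1, k n), ((h n).2, (0 : EZ))⟩) ⟨hn, mem_univ _⟩).comp n h2
  refine (H.smooth.contMDiffAt.comp n h3).congr_of_eventuallyEq ?_
  have hc : ContinuousAt (fun n => (h n).1) n :=
    (FiberBundle.continuous_proj EB (TangentSpace 𝓘(ℝ, EB) : B → Type _)).continuousAt.comp
      hh.continuousAt
  filter_upwards [hc.preimage_mem_nhds (T.isOpen_U.mem_nhds hn)] with n' hn'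
  exact congrArg (TotalSpace.mk _) (T.lift_eq_projection H hpr hn' (k n') (h n').2)

theorem contMDiffAt_liftZ (hpr : ContMDiff 𝓘(ℝ, EM) 𝓘(ℝ, EB) ∞ pr)
    {h : N → TangentBundle 𝓘(ℝ, EB) B} {k : N → Z} {n : N} (hn : (h n).1 ∈ U)
    (hh : ContMDiffAt I₃ 𝓘(ℝ, EB).tangent ∞ h n) (hk : ContMDiffAt I₃ 𝓘(ℝ, EZ) ∞ k n) :
    ContMDiffAt I₃ 𝓘(ℝ, EZ).tangent ∞
      (fun n => (⟨k n, T.liftZ H (h n).1 (h n).2 (k n)⟩ : TangentBundle 𝓘(ℝ, EZ) Z)) n := by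
  have hU : pr (T.Φ (h n).1 (k n)) ∈ U := by rw [T.pr_Φ _ hn]; exact hn
  have h1 := (contMDiffAt_tangentMap_of_isOpen (I₁ := 𝓘(ℝ, EM)) (I₂ := 𝓘(ℝ, EZ)) (f := T.ζ)
    (T.isOpen_preimage hpr) T.smooth_ζ
    (p := ⟨T.Φ (h n).1 (k n), H.lift (T.Φ (h n).1 (k n)) ⟨(h n).1, (h n).2⟩⟩) hU).comp n
    (T.contMDiffAt_lift H hpr hn hh hk)
  refine h1.congr_of_eventuallyEq ?_
  have hc : ContinuousAt (fun n => (h n).1) n :=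
    (FiberBundle.continuous_proj EB (TangentSpace 𝓘(ℝ, EB) : B → Type _)).continuousAt.comp
      hh.continuousAt
  filter_upwards [hc.preimage_mem_nhds (T.isOpen_U.mem_nhds hn)] with n' hn'
  exact (T.tangentMap_ζ_lift H hn' (k n') (h n').2).symm

end LocalTriv

end Lift

/-! ### The connection one-form of the Bismut connection -/

section BismutForm

variable {𝕂 : Type*} [RCLike 𝕂]
  {EB : Type*} [NormedAddCommGroup EB] [NormedSpace ℝ EB] [FiniteDimensional ℝ EB]
  {B : Type*} [TopologicalSpace B] [ChartedSpace EB B] [IsManifold 𝓘(ℝ, EB) ∞ B]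
  {EM : Type*} [NormedAddCommGroup EM] [NormedSpace ℝ EM] [FiniteDimensional ℝ EM]
  {M : Type*} [TopologicalSpace M] [ChartedSpace EM M] [IsManifold 𝓘(ℝ, EM) ∞ M]
  {EZ : Type*} [NormedAddCommGroup EZ] [NormedSpace ℝ EZ] [FiniteDimensional ℝ EZ]
  {Z : Type*} [TopologicalSpace Z] [ChartedSpace EZ Z] [IsManifold 𝓘(ℝ, EZ) ∞ Z]
  {FE : Type*} [NormedAddCommGroup FE] [NormedSpace ℝ FE] [FiniteDimensional ℝ FE]
  [NormedSpace 𝕂 FE] [IsScalarTower ℝ 𝕂 FE]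
  {E : M → Type*} [TopologicalSpace (TotalSpace FE E)] [∀ m, TopologicalSpace (E m)]
  [∀ m, AddCommGroup (E m)] [∀ m, Module ℝ (E m)] [∀ m, Module 𝕂 (E m)]
  [∀ m, IsScalarTower ℝ 𝕂 (E m)]
  [∀ m, IsTopologicalAddGroup (E m)] [∀ m, ContinuousSMul ℝ (E m)]
  [FiberBundle FE E] [VectorBundle ℝ FE E] [VectorBundle 𝕂 FE E]
  [ContMDiffVectorBundle ∞ FE E 𝓘(ℝ, EM)]
  {FF : Type*} [NormedAddCommGroup FF] [NormedSpace ℝ FF] [FiniteDimensional ℝ FF]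
  [NormedSpace 𝕂 FF] [IsScalarTower ℝ 𝕂 FF]
  {F : Z → Type*} [TopologicalSpace (TotalSpace FF F)] [∀ z, TopologicalSpace (F z)]
  [∀ z, AddCommGroup (F z)] [∀ z, Module ℝ (F z)] [∀ z, Module 𝕂 (F z)]
  [∀ z, IsScalarTower ℝ 𝕂 (F z)]
  [FiberBundle FF F] [VectorBundle ℝ FF F] [VectorBundle 𝕂 FF F]
  [ContMDiffVectorBundle ∞ FF F 𝓘(ℝ, EZ)]
  {pr : M → B} {U : Set B}

namespace LocalTriv

variable (T : LocalTriv 𝕂 EB EM EZ FE E FF F pr U)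
  (nablaE : CovariantDerivative 𝓘(ℝ, EM) FE E) (H : HorizontalBundle EB EM pr)

/-- The tangent map of the inverse trivialization, applied to the `∇`-horizontal lift of `Y`. -/
theorem exists_tangent_pull (hpr : ContMDiff 𝓘(ℝ, EM) 𝓘(ℝ, EB) ∞ pr) {m : M} (hm : pr m ∈ U)
    (u : E m) (Y : TangentSpace 𝓘(ℝ, EM) m) {w : TotalSpace FF F} (hw : T.pull ⟨m, u⟩ = w) :
    ∃ ξ : TangentSpace (𝓘(ℝ, EZ).prod 𝓘(ℝ, FF)) w,
      (projDeriv w ξ : EZ) = mfderiv 𝓘(ℝ, EM) 𝓘(ℝ, EZ) T.ζ m Y ∧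
      ∀ (e : Trivialization FF (π FF F)) [MemTrivializationAtlas e], w.proj ∈ e.baseSet →
        fibDeriv e w ξ = -connForm nablaE (T.coord e) m Y u := by
  obtain ⟨r, hr, rfl⟩ : ∃ r : ∀ m, E m, MDifferentiableAt 𝓘(ℝ, EM) (𝓘(ℝ, EM).prod 𝓘(ℝ, FE))
      (fun m => (⟨m, r m⟩ : TotalSpace FE E)) m ∧ r m = u := by
    have : ContMDiffVectorBundle 1 FE E 𝓘(ℝ, EM) :=
      ContMDiffVectorBundle.of_le (n := ∞) (by simp)
    exact ⟨FiberBundle.extend FE u, FiberBundle.mdifferentiableAt_extend .., by simp⟩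
  subst hw
  have hf : MDifferentiableAt 𝓘(ℝ, EM) (𝓘(ℝ, EZ).prod 𝓘(ℝ, FF))
      (fun m' => T.pull ⟨m', r m'⟩) m :=
    MDifferentiableAt.comp (g := T.pull) (f := fun m' => (⟨m', r m'⟩ : TotalSpace FE E)) m
      ((T.contMDiffAt_pull hpr hm).mdifferentiableAt (by simp)) hr
  -- η is the vertical vector representing ∇_Y r. Subtracting it from the velocity of `r` in the
  -- trivialization leaves the fibre coordinate d(κ r)(Y) - κ(∇_Y r), which is minus the connection
  -- form, for all trivializations at once.
  obtain ⟨η, hη₁, hη₂⟩ : ∃ η : TangentSpace (𝓘(ℝ, EZ).prod 𝓘(ℝ, FF)) (T.pull ⟨m, r m⟩),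
      (projDeriv (T.pull ⟨m, r m⟩) η : EZ) = 0 ∧
      ∀ (e : Trivialization FF (π FF F)) [MemTrivializationAtlas e], T.ζ m ∈ e.baseSet →
        fibDeriv e (T.pull ⟨m, r m⟩) η =
          (e (⟨T.ζ m, T.pullFib m (nablaE r m Y)⟩ : TotalSpace FF F)).2 :=
    ⟨vertLift EZ FF (T.pullFib m (r m)) (T.pullFib m (nablaE r m Y)),
      projDeriv_vertLift (EZ := EZ) (T.pullFib m (r m)) (T.pullFib m (nablaE r m Y)),
      fun e _ hz => fibDeriv_vertLift (EZ := EZ) (e := e) hz (T.pullFib m (r m))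
        (T.pullFib m (nablaE r m Y))⟩
  refine ⟨mfderiv 𝓘(ℝ, EM) (𝓘(ℝ, EZ).prod 𝓘(ℝ, FF)) (fun m' => T.pull ⟨m', r m'⟩) m Y - η,
    ?_, ?_⟩
  · refine (projDeriv_sub _ _ _).trans ?_
    rw [projDeriv_mfderiv hf]
    exact (congrArg _ hη₁).trans (sub_zero _)
  · intro e _ hz
    have hmem : m ∈ T.coordDomain e := ⟨hm, hz⟩
    refine (fibDeriv_sub _ _ _).trans ?_
    rw [fibDeriv_mfderiv hf hz]
    refine (congrArg _ (hη₂ e hz)).trans ?_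
    rw [← covDefect_eq_connForm nablaE (T.contMDiffAt_coord e hpr) hmem Y hr, covDefect, neg_sub,
      T.coord_apply e hmem]
    have hev : (fun m => T.coord e m (r m)) =ᶠ[𝓝 m] fun m => (e (T.pull ⟨m, r m⟩)).2 := by
      filter_upwards [(T.isOpen_coordDomain e hpr).mem_nhds hmem] with m' hm'
      exact T.coord_apply e hm' _
    have h1 : mvfderiv 𝓘(ℝ, EM) (fun m => T.coord e m (r m)) m Y =
        (mfderiv 𝓘(ℝ, EM) 𝓘(ℝ, FF) (fun m => (e (T.pull ⟨m, r m⟩)).2) m Y : FF) :=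
      congrArg (fun A : EM →L[ℝ] FF => A Y) hev.mfderiv_eq
    rw [h1]
    rfl

/-- The vector field on the total space of `F` which the connection one-form assigns to `X`. -/
def liftF (b : B) (X : TangentSpace 𝓘(ℝ, EB) b) (v : TotalSpace FF F) :
    TangentSpace (𝓘(ℝ, EZ).prod 𝓘(ℝ, FF)) v :=
  Classical.epsilon fun ξ => projDeriv v ξ = T.liftZ H b X v.proj ∧
    ∀ (e : Trivialization FF (π FF F)) [MemTrivializationAtlas e], v.proj ∈ e.baseSet →
      fibDeriv e v ξ = -connForm nablaE (T.coord e) (T.Φ b v.1) (H.lift (T.Φ b v.1) ⟨b, X⟩)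
        (T.Ψ b v.1 v.2)

/-- Existence is `exists_tangent_pull` at the point Ψ(v), which `pull` sends back to `v`. As the
condition covers every trivialization, no compatibility under a change of coordinates has to be
checked. -/
theorem liftF_spec (hpr : ContMDiff 𝓘(ℝ, EM) 𝓘(ℝ, EB) ∞ pr) {b : B} (hb : b ∈ U)
    (X : TangentSpace 𝓘(ℝ, EB) b) (v : TotalSpace FF F) :
    projDeriv v (T.liftF nablaE H b X v) = T.liftZ H b X v.proj ∧
    ∀ (e : Trivialization FF (π FF F)) [MemTrivializationAtlas e], v.proj ∈ e.baseSet →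
      fibDeriv e v (T.liftF nablaE H b X v) =
        -connForm nablaE (T.coord e) (T.Φ b v.1) (H.lift (T.Φ b v.1) ⟨b, X⟩) (T.Ψ b v.1 v.2) :=
  Classical.epsilon_spec (T.exists_tangent_pull nablaE hpr
    (by rw [T.pr_Φ b hb]; exact hb) (T.Ψ b v.1 v.2) (H.lift (T.Φ b v.1) ⟨b, X⟩)
    (T.pull_total hb v))

theorem mem_coordDomain {b : B} (hb : b ∈ U) {z : Z} (e : Trivialization FF (π FF F))
    (hz : z ∈ e.baseSet) : T.Φ b z ∈ T.coordDomain e := by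
  refine ⟨?_, ?_⟩
  · rw [mem_preimage, T.pr_Φ b hb]; exact hb
  · rw [mem_preimage, T.ζ_Φ b hb]; exact hz

theorem isLinearMap_liftF (hpr : ContMDiff 𝓘(ℝ, EM) 𝓘(ℝ, EB) ∞ pr)
    (hlin : ∀ (c : 𝕂) (r : ∀ m, E m) (m : M),
      MDifferentiableAt 𝓘(ℝ, EM) (𝓘(ℝ, EM).prod 𝓘(ℝ, FE))
        (fun m => (⟨m, r m⟩ : TotalSpace FE E)) m →
      ∀ Y, nablaE (c • r) m Y = c • nablaE r m Y)
    {b : B} (hb : b ∈ U) (X : TangentSpace 𝓘(ℝ, EB) b) (e : Trivialization FF (π FF F))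
    [MemTrivializationAtlas e] {z : Z} (hz : z ∈ e.baseSet) :
    IsLinearMap 𝕂 (fun u : F z => fibDeriv e ⟨z, u⟩ (T.liftF nablaE H b X ⟨z, u⟩)) := by
  have hL := isLinearMap_connForm nablaE (T.contMDiffAt_coord e hpr) hlin
    (T.mem_coordDomain hb e hz) (H.lift (T.Φ b z) ⟨b, X⟩)
  have h1 : ∀ u : F z, fibDeriv e ⟨z, u⟩ (T.liftF nablaE H b X ⟨z, u⟩) =
      -connForm nablaE (T.coord e) (T.Φ b z) (H.lift (T.Φ b z) ⟨b, X⟩) (T.Ψ b z u) :=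
    fun u => (T.liftF_spec nablaE H hpr hb X ⟨z, u⟩).2 e hz
  constructor
  · intro u u'
    rw [h1, h1, h1, map_add, hL.map_add, neg_add]
  · intro c u
    rw [h1, h1, map_smul, hL.map_smul, smul_neg]

theorem liftF_add (hpr : ContMDiff 𝓘(ℝ, EM) 𝓘(ℝ, EB) ∞ pr) {b : B} (hb : b ∈ U)
    (X Y : TangentSpace 𝓘(ℝ, EB) b) (v : TotalSpace FF F) :
    T.liftF nablaE H b (X + Y) v = T.liftF nablaE H b X v + T.liftF nablaE H b Y v := by
  set e := trivializationAt FF F v.proj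
  have hv : v.proj ∈ e.baseSet := FiberBundle.mem_baseSet_trivializationAt' _
  have hX := T.liftF_spec nablaE H hpr hb X v
  have hY := T.liftF_spec nablaE H hpr hb Y v
  have hXY := T.liftF_spec nablaE H hpr hb (X + Y) v
  refine tangent_ext (e := e) hv ?_ ?_
  · rw [projDeriv_add, hX.1, hY.1, hXY.1, liftZ, T.lift_add H hpr hb]
    exact map_add _ _ _
  · rw [fibDeriv_add, hX.2 e hv, hY.2 e hv, hXY.2 e hv, T.lift_add H hpr hb, connForm_add, neg_add]

theorem liftF_smul (hpr : ContMDiff 𝓘(ℝ, EM) 𝓘(ℝ, EB) ∞ pr) {b : B} (hb : b ∈ U) (c : ℝ)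
    (X : TangentSpace 𝓘(ℝ, EB) b) (v : TotalSpace FF F) :
    T.liftF nablaE H b (c • X) v = c • T.liftF nablaE H b X v := by
  set e := trivializationAt FF F v.proj
  have hv : v.proj ∈ e.baseSet := FiberBundle.mem_baseSet_trivializationAt' _
  have hX := T.liftF_spec nablaE H hpr hb X v
  have hcX := T.liftF_spec nablaE H hpr hb (c • X) v
  refine tangent_ext (e := e) hv ?_ ?_
  · rw [projDeriv_smul, hX.1, hcX.1, liftZ, T.lift_smul H hpr hb]
    exact map_smul _ _ _
  · rw [fibDeriv_smul, hX.2 e hv, hcX.2 e hv, T.lift_smul H hpr hb, connForm_smul, smul_neg]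

variable {E₃ H₃ : Type*} [NormedAddCommGroup E₃] [NormedSpace ℝ E₃] [TopologicalSpace H₃]
  {I₃ : ModelWithCorners ℝ E₃ H₃} {N : Type*} [TopologicalSpace N] [ChartedSpace H₃ N]

theorem contMDiffAt_liftF [T2Space M] (hpr : ContMDiff 𝓘(ℝ, EM) 𝓘(ℝ, EB) ∞ pr)
    (hsmooth : CovariantDerivative.ContMDiffCovariantDerivative nablaE ∞)
    (hlin : ∀ (c : 𝕂) (r : ∀ m, E m) (m : M),
      MDifferentiableAt 𝓘(ℝ, EM) (𝓘(ℝ, EM).prod 𝓘(ℝ, FE))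
        (fun m => (⟨m, r m⟩ : TotalSpace FE E)) m →
      ∀ Y, nablaE (c • r) m Y = c • nablaE r m Y)
    {h : N → TangentBundle 𝓘(ℝ, EB) B} {k : N → TotalSpace FF F} {n : N} (hn : (h n).1 ∈ U)
    (hh : ContMDiffAt I₃ 𝓘(ℝ, EB).tangent ∞ h n)
    (hk : ContMDiffAt I₃ (𝓘(ℝ, EZ).prod 𝓘(ℝ, FF)) ∞ k n) :
    ContMDiffAt I₃ (𝓘(ℝ, EZ).prod 𝓘(ℝ, FF)).tangent ∞
      (fun n => (⟨k n, T.liftF nablaE H (h n).1 (h n).2 (k n)⟩ :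
        TangentBundle (𝓘(ℝ, EZ).prod 𝓘(ℝ, FF)) (TotalSpace FF F))) n := by
  set e := trivializationAt FF F (k n).proj with he
  have hv : (k n).proj ∈ e.baseSet := FiberBundle.mem_baseSet_trivializationAt' _
  have hkp : ContMDiffAt I₃ 𝓘(ℝ, EZ) ∞ (fun n => (k n).proj) n :=
    (contMDiffAt_proj F).comp n hk
  have hb : ContMDiffAt I₃ 𝓘(ℝ, EB) ∞ (fun n => (h n).1) n :=
    (contMDiffAt_proj (TangentSpace 𝓘(ℝ, EB) : B → Type _)).comp n hh
  have hev := hb.continuousAt.preimage_mem_nhds (T.isOpen_U.mem_nhds hn)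
  refine contMDiffAt_tangent_of_coords (e := e) hv hk ?_ ?_
  · refine (T.contMDiffAt_liftZ H hpr hn hh hkp).congr_of_eventuallyEq ?_
    filter_upwards [hev] with n' hn'
    exact congrArg (TotalSpace.mk _) (T.liftF_spec nablaE H hpr hn' (h n').2 (k n')).1
  · have h1 := contMDiffAt_connForm nablaE (κ := T.coord e) hsmooth (T.isOpen_coordDomain e hpr)
      (T.contMDiffAt_coord e hpr) hlin
      (g := fun n => ⟨T.Φ (h n).1 (k n).1, H.lift (T.Φ (h n).1 (k n).1) ⟨(h n).1, (h n).2⟩⟩)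
      (u := fun n => T.Ψ (h n).1 (k n).1 (k n).2) (T.mem_coordDomain hn e hv)
      (T.contMDiffAt_lift H hpr hn hh hkp)
      (ContMDiffAt.comp (g := fun p : B × TotalSpace FF F => T.total p.1 p.2)
        (f := fun n => ((h n).1, k n)) n (T.contMDiffAt_total hn (k n)) (hb.prodMk hk))
    refine h1.neg.congr_of_eventuallyEq ?_
    filter_upwards [hev, hkp.continuousAt.preimage_mem_nhds (e.open_baseSet.mem_nhds hv)]
      with n' hn' hn''
    exact (T.liftF_spec nablaE H hpr hn' (h n').2 (k n')).2 e hn''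

end LocalTriv

variable (𝕂 EZ FF F) in
/-- The zero element of the Lie algebra of bundle automorphisms. -/
def BundleAutLie.zero : BundleAutLie 𝕂 EZ FF F where
  V _ := 0
  s _ := 0
  smooth_V := contMDiff_zeroSection ℝ (TangentSpace 𝓘(ℝ, EZ) : Z → Type _)
  smooth_s := by
    have : IsManifold (𝓘(ℝ, EZ).prod 𝓘(ℝ, FF)) ∞ (TotalSpace FF F) :=
      Bundle.TotalSpace.isManifold FF F
    exact contMDiff_zeroSection ℝ
      (TangentSpace (𝓘(ℝ, EZ).prod 𝓘(ℝ, FF)) : TotalSpace FF F → Type _)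
  covers _ := map_zero _
  linear z := by
    have h : ∀ v : F z, (mfderiv (𝓘(ℝ, EZ).prod 𝓘(ℝ, FF)) 𝓘(ℝ, FF)
        (fun y : TotalSpace FF F => (trivializationAt FF F z y).2) ⟨z, v⟩ 0 : FF) = 0 :=
      fun v => map_zero (mfderiv (𝓘(ℝ, EZ).prod 𝓘(ℝ, FF)) 𝓘(ℝ, FF)
        (fun y : TotalSpace FF F => (trivializationAt FF F z y).2) ⟨z, v⟩)
    have key : ∀ g : F z → FF, (∀ v, g v = 0) → IsLinearMap 𝕂 g := fun g hg =>
      ⟨fun u v => by rw [hg, hg, hg, add_zero], fun c u => by rw [hg, hg, smul_zero]⟩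
    exact key _ h

/-- The one-form must be defined on all of `B`; off `U` the zero element serves as a default. -/
theorem LocalTriv.exists_bundleAutLie [T2Space M] (T : LocalTriv 𝕂 EB EM EZ FE E FF F pr U)
    (nablaE : CovariantDerivative 𝓘(ℝ, EM) FE E) (H : HorizontalBundle EB EM pr)
    (hpr : ContMDiff 𝓘(ℝ, EM) 𝓘(ℝ, EB) ∞ pr)
    (hsmooth : CovariantDerivative.ContMDiffCovariantDerivative nablaE ∞)
    (hlin : ∀ (c : 𝕂) (r : ∀ m, E m) (m : M),
      MDifferentiableAt 𝓘(ℝ, EM) (𝓘(ℝ, EM).prod 𝓘(ℝ, FE))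
        (fun m => (⟨m, r m⟩ : TotalSpace FE E)) m →
      ∀ Y, nablaE (c • r) m Y = c • nablaE r m Y)
    (b : B) (X : TangentSpace 𝓘(ℝ, EB) b) :
    ∃ ξ : BundleAutLie 𝕂 EZ FF F, b ∈ U →
      (∀ z, ξ.V z = T.liftZ H b X z) ∧ ∀ v, ξ.s v = T.liftF nablaE H b X v := by
  by_cases hb : b ∈ U
  · have hc : ∀ {n : Z}, ContMDiffAt 𝓘(ℝ, EZ) 𝓘(ℝ, EB).tangent ∞
        (fun _ : Z => (⟨b, X⟩ : TangentBundle 𝓘(ℝ, EB) B)) n := contMDiffAt_const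
    have hc' : ∀ {n : TotalSpace FF F}, ContMDiffAt (𝓘(ℝ, EZ).prod 𝓘(ℝ, FF)) 𝓘(ℝ, EB).tangent ∞
        (fun _ : TotalSpace FF F => (⟨b, X⟩ : TangentBundle 𝓘(ℝ, EB) B)) n := contMDiffAt_const
    exact ⟨⟨T.liftZ H b X, T.liftF nablaE H b X,
      fun z => T.contMDiffAt_liftZ H hpr hb hc contMDiffAt_id,
      fun v => T.contMDiffAt_liftF nablaE H hpr hsmooth hlin hb hc' contMDiffAt_id,
      fun v => (T.liftF_spec nablaE H hpr hb X v).1,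
      fun z => T.isLinearMap_liftF nablaE H hpr hlin hb X _
        (FiberBundle.mem_baseSet_trivializationAt' z)⟩, fun _ => ⟨fun _ => rfl, fun _ => rfl⟩⟩
  · exact ⟨BundleAutLie.zero 𝕂 EZ FF F, fun h => absurd h hb⟩

theorem LocalTriv.exists_isOneForm [T2Space M] (T : LocalTriv 𝕂 EB EM EZ FE E FF F pr U)
    (nablaE : CovariantDerivative 𝓘(ℝ, EM) FE E) (H : HorizontalBundle EB EM pr)
    (hpr : ContMDiff 𝓘(ℝ, EM) 𝓘(ℝ, EB) ∞ pr)
    (hsmooth : CovariantDerivative.ContMDiffCovariantDerivative nablaE ∞)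
    (hlin : ∀ (c : 𝕂) (r : ∀ m, E m) (m : M),
      MDifferentiableAt 𝓘(ℝ, EM) (𝓘(ℝ, EM).prod 𝓘(ℝ, FE))
        (fun m => (⟨m, r m⟩ : TotalSpace FE E)) m →
      ∀ Y, nablaE (c • r) m Y = c • nablaE r m Y) :
    ∃ θ : ∀ b : B, TangentSpace 𝓘(ℝ, EB) b → BundleAutLie 𝕂 EZ FF F, IsOneForm U θ ∧
      (∀ b ∈ U, ∀ X z, (θ b X).V z = T.liftZ H b X z) ∧
      ∀ b ∈ U, ∀ X v, (θ b X).s v = T.liftF nablaE H b X v := by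
  choose θ hθ using T.exists_bundleAutLie nablaE H hpr hsmooth hlin
  refine ⟨θ, ⟨?_, ?_, ?_, ?_, ?_⟩, fun b hb X => (hθ b X hb).1, fun b hb X => (hθ b X hb).2⟩
  · intro b hb X Y z
    rw [(hθ b _ hb).1, (hθ b _ hb).1, (hθ b _ hb).1, liftZ, T.lift_add H hpr hb]
    exact map_add _ _ _
  · intro b hb c X z
    rw [(hθ b _ hb).1, (hθ b _ hb).1, liftZ, T.lift_smul H hpr hb]
    exact map_smul _ _ _
  · intro b hb X Y v
    rw [(hθ b _ hb).2, (hθ b _ hb).2, (hθ b _ hb).2, T.liftF_add nablaE H hpr hb]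
  · intro b hb c X v
    rw [(hθ b _ hb).2, (hθ b _ hb).2, T.liftF_smul nablaE H hpr hb]
  · have h1 : ContMDiffOn (𝓘(ℝ, EB).tangent.prod (𝓘(ℝ, EZ).prod 𝓘(ℝ, FF)))
        (𝓘(ℝ, EZ).prod 𝓘(ℝ, FF)).tangent ∞
        (fun p : TangentBundle 𝓘(ℝ, EB) B × TotalSpace FF F =>
          (⟨p.2, T.liftF nablaE H p.1.1 p.1.2 p.2⟩ :
            TangentBundle (𝓘(ℝ, EZ).prod 𝓘(ℝ, FF)) (TotalSpace FF F)))
        {p | p.1.1 ∈ U} := fun p hp =>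
      (T.contMDiffAt_liftF nablaE H hpr hsmooth hlin (h := Prod.fst) (k := Prod.snd) hp
        contMDiffAt_fst contMDiffAt_snd).contMDiffWithinAt
    refine h1.congr fun p hp => ?_
    exact congrArg (TotalSpace.mk _) ((hθ _ _ hp).2 _)

end BismutForm

/-! ### The Bismut connection in a local trivialization -/

section ConnectionForm

variable {𝕂 : Type*} [RCLike 𝕂]
  {EB : Type*} [NormedAddCommGroup EB] [NormedSpace ℝ EB] [FiniteDimensional ℝ EB]
  {B : Type*} [TopologicalSpace B] [ChartedSpace EB B] [IsManifold 𝓘(ℝ, EB) ∞ B]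
  {EM : Type*} [NormedAddCommGroup EM] [NormedSpace ℝ EM] [FiniteDimensional ℝ EM]
  {M : Type*} [TopologicalSpace M] [ChartedSpace EM M] [IsManifold 𝓘(ℝ, EM) ∞ M]
  {EZ : Type*} [NormedAddCommGroup EZ] [NormedSpace ℝ EZ] [FiniteDimensional ℝ EZ]
  {Z : Type*} [TopologicalSpace Z] [ChartedSpace EZ Z] [IsManifold 𝓘(ℝ, EZ) ∞ Z]
  {FE : Type*} [NormedAddCommGroup FE] [NormedSpace ℝ FE] [FiniteDimensional ℝ FE]
  [NormedSpace 𝕂 FE] [IsScalarTower ℝ 𝕂 FE]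
  {E : M → Type*} [TopologicalSpace (TotalSpace FE E)] [∀ m, TopologicalSpace (E m)]
  [∀ m, AddCommGroup (E m)] [∀ m, Module ℝ (E m)] [∀ m, Module 𝕂 (E m)]
  [∀ m, IsScalarTower ℝ 𝕂 (E m)]
  [∀ m, IsTopologicalAddGroup (E m)] [∀ m, ContinuousSMul ℝ (E m)]
  [FiberBundle FE E] [VectorBundle ℝ FE E] [VectorBundle 𝕂 FE E]
  [ContMDiffVectorBundle ∞ FE E 𝓘(ℝ, EM)]
  {FF : Type*} [NormedAddCommGroup FF] [NormedSpace ℝ FF] [FiniteDimensional ℝ FF]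
  [NormedSpace 𝕂 FF] [IsScalarTower ℝ 𝕂 FF]
  {F : Z → Type*} [TopologicalSpace (TotalSpace FF F)] [∀ z, TopologicalSpace (F z)]
  [∀ z, AddCommGroup (F z)] [∀ z, Module ℝ (F z)] [∀ z, Module 𝕂 (F z)]
  [∀ z, IsScalarTower ℝ 𝕂 (F z)]
  [FiberBundle FF F] [VectorBundle ℝ FF F] [VectorBundle 𝕂 FF F]
  [ContMDiffVectorBundle ∞ FF F 𝓘(ℝ, EZ)]
  {pr : M → B} {U : Set B}

namespace LocalTriv

variable (T : LocalTriv 𝕂 EB EM EZ FE E FF F pr U)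

theorem coord_Ψ {b : B} (hb : b ∈ U) {z : Z} (e : Trivialization FF (π FF F))
    [MemTrivializationAtlas e] (hz : z ∈ e.baseSet) (w : F z) :
    T.coord e (T.Φ b z) (T.Ψ b z w) = (e ⟨z, w⟩).2 := by
  rw [T.coord_apply e (T.mem_coordDomain hb e hz)]
  exact congrArg (fun v => (e v).2) (T.pull_total hb ⟨z, w⟩)

/-- The representative is the section pulled back through the smooth inverse trivialization, so it
is jointly smooth in the base and fibre variables. -/
theorem contMDiffAt_repr (hpr : ContMDiff 𝓘(ℝ, EM) 𝓘(ℝ, EB) ∞ pr) {r : ∀ m, E m}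
    {ρ : B → ∀ z, F z} (hr : IsSmoothSectionOn EM FE E pr U r) (hρ : T.Represents ρ r)
    {b : B} (hb : b ∈ U) (z : Z) :
    ContMDiffAt (𝓘(ℝ, EB).prod 𝓘(ℝ, EZ)) (𝓘(ℝ, EZ).prod 𝓘(ℝ, FF)) ∞
      (fun p : B × Z => (⟨p.2, ρ p.1 p.2⟩ : TotalSpace FF F)) (b, z) := by
  have hm : pr (T.Φ b z) ∈ U := by rw [T.pr_Φ b hb]; exact hb
  have h1 : ContMDiffAt 𝓘(ℝ, EM) (𝓘(ℝ, EM).prod 𝓘(ℝ, FE)) ∞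
      (fun m => (⟨m, r m⟩ : TotalSpace FE E)) (T.Φ b z) :=
    hr.contMDiffAt ((T.isOpen_preimage hpr).mem_nhds hm)
  have h2 : ContMDiffAt (𝓘(ℝ, EB).prod 𝓘(ℝ, EZ)) (𝓘(ℝ, EZ).prod 𝓘(ℝ, FF)) ∞
      (fun p : B × Z => T.pull ⟨T.Φ p.1 p.2, r (T.Φ p.1 p.2)⟩) (b, z) :=
    ContMDiffAt.comp (g := T.pull)
      (f := fun p : B × Z => (⟨T.Φ p.1 p.2, r (T.Φ p.1 p.2)⟩ : TotalSpace FE E)) (b, z)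
      (T.contMDiffAt_pull hpr hm)
      (ContMDiffAt.comp (g := fun m => (⟨m, r m⟩ : TotalSpace FE E))
        (f := fun p : B × Z => T.Φ p.1 p.2) (b, z) h1 (T.contMDiffAt_Φ hb z))
  refine h2.congr_of_eventuallyEq ?_
  filter_upwards [(T.isOpen_U.prod isOpen_univ).mem_nhds (x := (b, z)) ⟨hb, mem_univ z⟩] with p hp
  rw [hρ p.1 hp.1 p.2]
  exact (T.pull_total hp.1 ⟨p.2, ρ p.1 p.2⟩).symm

/-- The Bismut connection is `d + θ` in a local trivialization, where `θ` is given by horizontal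
lifts to `M` and to `E`. -/
theorem hasConnectionForm_bismut (nablaE : CovariantDerivative 𝓘(ℝ, EM) FE E)
    (H : HorizontalBundle EB EM pr) (hpr : ContMDiff 𝓘(ℝ, EM) 𝓘(ℝ, EB) ∞ pr)
    {θ : ∀ b : B, TangentSpace 𝓘(ℝ, EB) b → BundleAutLie 𝕂 EZ FF F}
    (hV : ∀ b ∈ U, ∀ X z, (θ b X).V z = T.liftZ H b X z)
    (hs : ∀ b ∈ U, ∀ X v, (θ b X).s v = T.liftF nablaE H b X v) :
    T.HasConnectionForm (bismut nablaE H) θ := by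
  intro r ρ hr hρ b hb X
  have hsec : ∀ z, MDifferentiableAt 𝓘(ℝ, EZ) (𝓘(ℝ, EZ).prod 𝓘(ℝ, FF))
      (fun y => (⟨y, ρ b y⟩ : TotalSpace FF F)) z := fun z =>
    MDifferentiableAt.comp (g := fun p : B × Z => (⟨p.2, ρ p.1 p.2⟩ : TotalSpace FF F))
      (f := fun y : Z => (b, y)) z ((T.contMDiffAt_repr hpr hr hρ hb z).mdifferentiableAt (by simp))
      (mdifferentiableAt_const.prodMk mdifferentiableAt_id)
  -- Both dρ(V) and s project to V, so their difference is vertical and comes from a section; this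
  -- section is the Lie derivative.
  have hτ : ∀ z, ∃ τ : F z, vertLift EZ FF (ρ b z) τ =
      mfderiv 𝓘(ℝ, EZ) (𝓘(ℝ, EZ).prod 𝓘(ℝ, FF))
        (fun y => (⟨y, ρ b y⟩ : TotalSpace FF F)) z ((θ b X).V z) - (θ b X).s ⟨z, ρ b z⟩ := by
    intro z
    refine exists_vertLift_eq ?_
    rw [projDeriv_sub, projDeriv_mfderiv (hsec z), hs b hb, (T.liftF_spec nablaE H hpr hb X _).1,
      hV b hb]
    refine sub_eq_zero.2 ?_
    exact congrArg (fun A : EZ →L[ℝ] EZ => A (T.liftZ H b X z))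
      (mfderiv_id (I := 𝓘(ℝ, EZ)) (x := z))
  choose τ hτ using hτ
  refine ⟨τ, hτ, fun z w hw => ?_⟩
  set e := trivializationAt FF F z with he
  have hz : z ∈ e.baseSet := FiberBundle.mem_baseSet_trivializationAt' z
  have hm : pr (T.Φ b z) ∈ U := by rw [T.pr_Φ b hb]; exact hb
  have hρd := (T.contMDiffAt_repr hpr hr hρ hb z).mdifferentiableAt (by simp)
  have hsec' : MDifferentiableAt 𝓘(ℝ, EB) (𝓘(ℝ, EZ).prod 𝓘(ℝ, FF))
      (fun b' => (⟨z, ρ b' z⟩ : TotalSpace FF F)) b :=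
    MDifferentiableAt.comp (g := fun p : B × Z => (⟨p.2, ρ p.1 p.2⟩ : TotalSpace FF F))
      (f := fun b' : B => (b', z)) b hρd (mdifferentiableAt_id.prodMk mdifferentiableAt_const)
  refine tangent_ext (e := e) hz ?_ ?_
  · rw [projDeriv_vertLift, projDeriv_mfderiv hsec']
    exact (congrArg (fun A : EB →L[ℝ] EZ => A X) (mfderiv_const (I := 𝓘(ℝ, EB)) (x := b)
      (I' := 𝓘(ℝ, EZ)) (c := z))).symm
  · have hdr : MDifferentiableAt 𝓘(ℝ, EM) (𝓘(ℝ, EM).prod 𝓘(ℝ, FE))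
        (fun m => (⟨m, r m⟩ : TotalSpace FE E)) (T.Φ b z) :=
      (hr.contMDiffAt ((T.isOpen_preimage hpr).mem_nhds hm)).mdifferentiableAt (by simp)
    -- the two partial derivatives of the fibre coordinate
    set h : B × Z → FF := fun p => (e ⟨p.2, ρ p.1 p.2⟩).2 with hh
    have hhd : MDifferentiableAt (𝓘(ℝ, EB).prod 𝓘(ℝ, EZ)) 𝓘(ℝ, FF) h (b, z) :=
      MDifferentiableAt.comp (g := fun v : TotalSpace FF F => (e v).2)
        (f := fun p : B × Z => (⟨p.2, ρ p.1 p.2⟩ : TotalSpace FF F)) (b, z)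
        (mdifferentiableAt_fibCoord e hz) hρd
    obtain ⟨d₁, hd₁⟩ : ∃ d : FF, d = mfderiv 𝓘(ℝ, EB) 𝓘(ℝ, FF) (fun b' => h (b', z)) b X :=
      ⟨_, rfl⟩
    obtain ⟨d₂, hd₂⟩ : ∃ d : FF, d = mfderiv 𝓘(ℝ, EZ) 𝓘(ℝ, FF) (fun y => h (b, y)) z
      (T.liftZ H b X z) := ⟨_, rfl⟩
    have hτe : (e ⟨z, τ z⟩).2 = d₂ +
        connForm nablaE (T.coord e) (T.Φ b z) (H.lift (T.Φ b z) ⟨b, X⟩) (r (T.Φ b z)) := by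
      have h1 := congrArg (fibDeriv (EZ := EZ) e (⟨z, ρ b z⟩ : TotalSpace FF F)) (hτ z)
      rw [fibDeriv_vertLift hz, fibDeriv_sub, fibDeriv_mfderiv (hsec z) hz, hs b hb,
        (T.liftF_spec nablaE H hpr hb X _).2 e hz, hV b hb] at h1
      rw [hρ b hb z]
      exact h1.trans ((congrArg (· - _) hd₂.symm).trans (sub_neg_eq_add d₂ _))
    have hwe : (e ⟨z, w⟩).2 = mvfderiv 𝓘(ℝ, EM) (fun m => T.coord e m (r m)) (T.Φ b z)
        (H.lift (T.Φ b z) ⟨b, X⟩) +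
        connForm nablaE (T.coord e) (T.Φ b z) (H.lift (T.Φ b z) ⟨b, X⟩) (r (T.Φ b z)) := by
      rw [← T.coord_Ψ hb e hz w, hw, ← covDefect_eq_connForm nablaE (T.contMDiffAt_coord e hpr)
        (T.mem_coordDomain hb e hz) _ hdr, covDefect, add_sub_cancel]
      rfl
    -- Because X^H = Φ_*(X, V), the derivative of the coordinate of `r` along X^H is the sum of its
    -- partial derivatives along `X` and along V. The second one, together with the connection form,
    -- is the Lie derivative term, and only the first remains.
    have hchain : mvfderiv 𝓘(ℝ, EM) (fun m => T.coord e m (r m)) (T.Φ b z)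
        (H.lift (T.Φ b z) ⟨b, X⟩) = d₁ + d₂ := by
      have hκ := mdifferentiableAt_coord_section (T.contMDiffAt_coord e hpr)
        (T.mem_coordDomain hb e hz) hdr
      have hcomp := mfderiv_comp (b, z) (g := fun m => T.coord e m (r m))
        (f := fun p : B × Z => T.Φ p.1 p.2) hκ
        ((T.contMDiffAt_Φ hb z).mdifferentiableAt (by simp))
      have hev : ((fun m => T.coord e m (r m)) ∘ fun p : B × Z => T.Φ p.1 p.2) =ᶠ[𝓝 (b, z)] h := by
        filter_upwards [(T.isOpen_U.prod e.open_baseSet).mem_nhds (x := (b, z)) ⟨hb, hz⟩] with p hp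
        simp only [Function.comp, hh]
        rw [hρ p.1 hp.1 p.2, T.coord_Ψ hp.1 e hp.2]
      rw [hev.mfderiv_eq] at hcomp
      rw [T.lift_eq_mfderiv_Φ H hpr hb z X]
      have h2 := congrArg (fun A : EB × EZ →L[ℝ] FF => A (X, T.liftZ H b X z)) hcomp
      rw [hd₁, hd₂]
      exact h2.symm.trans (mfderiv_prod_eq_add_apply hhd)
    rw [fibDeriv_vertLift hz, fibDeriv_mfderiv hsec' hz, (e.linear ℝ hz).map_sub, hτe, hwe, hchain,
      add_sub_add_right_eq_sub]
    exact (add_sub_cancel_right d₁ d₂).trans hd₁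

end LocalTriv

end ConnectionForm

/-! ### The Bismut connection is a connection -/

section Bismut

variable {𝕂 : Type*} [RCLike 𝕂]
  {EB : Type*} [NormedAddCommGroup EB] [NormedSpace ℝ EB] [FiniteDimensional ℝ EB]
  {B : Type*} [TopologicalSpace B] [ChartedSpace EB B] [IsManifold 𝓘(ℝ, EB) ∞ B]
  {EM : Type*} [NormedAddCommGroup EM] [NormedSpace ℝ EM] [FiniteDimensional ℝ EM]
  {M : Type*} [TopologicalSpace M] [ChartedSpace EM M] [IsManifold 𝓘(ℝ, EM) ∞ M]
  {EZ : Type*} [NormedAddCommGroup EZ] [NormedSpace ℝ EZ] [FiniteDimensional ℝ EZ]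
  {Z : Type*} [TopologicalSpace Z] [ChartedSpace EZ Z] [IsManifold 𝓘(ℝ, EZ) ∞ Z]
  {FE : Type*} [NormedAddCommGroup FE] [NormedSpace ℝ FE] [FiniteDimensional ℝ FE]
  [NormedSpace 𝕂 FE] [IsScalarTower ℝ 𝕂 FE]
  {E : M → Type*} [TopologicalSpace (TotalSpace FE E)] [∀ m, TopologicalSpace (E m)]
  [∀ m, AddCommGroup (E m)] [∀ m, Module ℝ (E m)] [∀ m, Module 𝕂 (E m)]
  [∀ m, IsScalarTower ℝ 𝕂 (E m)]
  [∀ m, IsTopologicalAddGroup (E m)] [∀ m, ContinuousSMul ℝ (E m)]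
  [FiberBundle FE E] [VectorBundle ℝ FE E] [VectorBundle 𝕂 FE E]
  [ContMDiffVectorBundle ∞ FE E 𝓘(ℝ, EM)]
  {FF : Type*} [NormedAddCommGroup FF] [NormedSpace ℝ FF] [FiniteDimensional ℝ FF]
  [NormedSpace 𝕂 FF] [IsScalarTower ℝ 𝕂 FF]
  {F : Z → Type*} [TopologicalSpace (TotalSpace FF F)] [∀ z, TopologicalSpace (F z)]
  [∀ z, AddCommGroup (F z)] [∀ z, Module ℝ (F z)] [∀ z, Module 𝕂 (F z)]
  [∀ z, IsScalarTower ℝ 𝕂 (F z)]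
  [FiberBundle FF F] [VectorBundle ℝ FF F] [VectorBundle 𝕂 FF F]
  [ContMDiffVectorBundle ∞ FF F 𝓘(ℝ, EZ)]
  {pr : M → B}

/-- Along a smooth field on `B` the horizontal lift is smooth, by the formula in a local
trivialization, and it is then inserted into the smooth section `nablaE r`. -/
theorem contMDiffOn_bismut [T2Space M] (hpr : ContMDiff 𝓘(ℝ, EM) 𝓘(ℝ, EB) ∞ pr)
    (hloc : ∀ b, ∃ U : Set B, b ∈ U ∧ Nonempty (LocalTriv 𝕂 EB EM EZ FE E FF F pr U))
    (H : HorizontalBundle EB EM pr) (nablaE : CovariantDerivative 𝓘(ℝ, EM) FE E)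
    (hsmooth : CovariantDerivative.ContMDiffCovariantDerivative nablaE ∞)
    {W : Set B} (hW : IsOpen W) {r : ∀ m, E m} (hr : IsSmoothSectionOn EM FE E pr W r)
    {X : ∀ b, TangentSpace 𝓘(ℝ, EB) b}
    (hX : ContMDiffOn 𝓘(ℝ, EB) 𝓘(ℝ, EB).tangent ∞
      (fun b => (⟨b, X b⟩ : TangentBundle 𝓘(ℝ, EB) B)) W) :
    IsSmoothSectionOn EM FE E pr W (fun m => nablaE r m (H.lift m ⟨pr m, X (pr m)⟩)) := by
  intro m hm
  obtain ⟨U, hU, ⟨T⟩⟩ := hloc (pr m)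
  have hWM : IsOpen (pr ⁻¹' W) := hW.preimage hpr.continuous
  have hh : ContMDiffAt 𝓘(ℝ, EM) 𝓘(ℝ, EB).tangent ∞
      (fun m => (⟨pr m, X (pr m)⟩ : TangentBundle 𝓘(ℝ, EB) B)) m :=
    ContMDiffAt.comp (g := fun b => (⟨b, X b⟩ : TangentBundle 𝓘(ℝ, EB) B)) m
      (hX.contMDiffAt (hW.mem_nhds hm)) hpr.contMDiffAt
  have h1 : ContMDiffAt 𝓘(ℝ, EM) 𝓘(ℝ, EM).tangent ∞
      (fun m => (⟨m, H.lift m ⟨pr m, X (pr m)⟩⟩ : TangentBundle 𝓘(ℝ, EM) M)) m := by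
    refine (T.contMDiffAt_lift H hpr hU hh (T.contMDiffAt_ζ hpr hU)).congr_of_eventuallyEq ?_
    filter_upwards [(T.isOpen_preimage hpr).mem_nhds hU] with m' hm'
    exact congrArg (fun q : M => (⟨q, H.lift q ⟨pr m', X (pr m')⟩⟩ : TangentBundle 𝓘(ℝ, EM) M))
      (T.Φ_ζ m' hm').symm
  have h2 : ContMDiffAt 𝓘(ℝ, EM) (𝓘(ℝ, EM).prod 𝓘(ℝ, FE)) ∞
      (fun m => (⟨m, nablaE r m (H.lift m ⟨pr m, X (pr m)⟩)⟩ : TotalSpace FE E)) m :=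
    ContMDiffAt.clm_bundle_apply (b := fun m : M => m) (ϕ := fun m => nablaE r m)
      (v := fun m => H.lift m ⟨pr m, X (pr m)⟩)
      (contMDiffAt_covariantDerivative nablaE hsmooth hWM hr hm) h1
  exact h2.contMDiffWithinAt

theorem tangentMap_lift (hpr : ContMDiff 𝓘(ℝ, EM) 𝓘(ℝ, EB) ∞ pr)
    (hloc : ∀ b, ∃ U : Set B, b ∈ U ∧ Nonempty (LocalTriv 𝕂 EB EM EZ FE E FF F pr U))
    (H : HorizontalBundle EB EM pr) (m : M) (X : TangentSpace 𝓘(ℝ, EB) (pr m)) :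
    tangentMap 𝓘(ℝ, EM) 𝓘(ℝ, EB) pr ⟨m, H.lift m ⟨pr m, X⟩⟩ = ⟨pr m, X⟩ := by
  obtain ⟨U, hU, ⟨T⟩⟩ := hloc (pr m)
  have h := T.tangentMap_lift H hpr hU (T.ζ m) X
  rwa [T.Φ_ζ m hU] at h

theorem isConnection_bismut [T2Space M] (hpr : ContMDiff 𝓘(ℝ, EM) 𝓘(ℝ, EB) ∞ pr)
    (hloc : ∀ b, ∃ U : Set B, b ∈ U ∧ Nonempty (LocalTriv 𝕂 EB EM EZ FE E FF F pr U))
    (H : HorizontalBundle EB EM pr) (nablaE : CovariantDerivative 𝓘(ℝ, EM) FE E)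
    (hsmooth : CovariantDerivative.ContMDiffCovariantDerivative nablaE ∞)
    (hlin : ∀ (c : 𝕂) (r : ∀ m, E m) (m : M),
      MDifferentiableAt 𝓘(ℝ, EM) (𝓘(ℝ, EM).prod 𝓘(ℝ, FE))
        (fun m => (⟨m, r m⟩ : TotalSpace FE E)) m →
      ∀ Y, nablaE (c • r) m Y = c • nablaE r m Y) :
    IsConnection 𝕂 EM FE (bismut nablaE H) := by
  have hd : ∀ {W : Set B}, IsOpen W → ∀ {r : ∀ m, E m}, IsSmoothSectionOn EM FE E pr W r →
      ∀ {m : M}, pr m ∈ W → MDifferentiableAt 𝓘(ℝ, EM) (𝓘(ℝ, EM).prod 𝓘(ℝ, FE))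
        (fun m => (⟨m, r m⟩ : TotalSpace FE E)) m := fun hW _ hr m hm =>
    (hr.contMDiffAt ((hW.preimage hpr.continuous).mem_nhds hm)).mdifferentiableAt (by simp)
  have hcov := nablaE.isCovariantDerivativeOn (s := univ)
  refine ⟨?_, ?_, ?_, ?_, ?_, ?_, ?_, ?_⟩
  · intro W hW r r' hr hr' h b hb
    ext X ⟨m, rfl⟩
    have := hcov.congr_of_eventuallyEq (hd hW hr hb) (hd hW hr' hb) univ_mem
      (by filter_upwards [(hW.preimage hpr.continuous).mem_nhds hb] with m' hm' using h m' hm')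
    exact congrArg (fun A => A (H.lift m ⟨pr m, X⟩)) this
  · intro W hW r hr b hb X m
    -- Smoothness on a fibre asks for a smooth extension to a neighbourhood in `M`; extending the
    -- single vector `X` to a local vector field on `B` provides one.
    obtain ⟨s, hs, hX⟩ := FiberBundle.exists_contMDiffOn_extend (k := ∞) 𝓘(ℝ, EB) EB
      (V := TangentSpace 𝓘(ℝ, EB)) X
    obtain ⟨W', hW's, hW', hbW'⟩ := mem_nhds_iff.1 (inter_mem hs (hW.mem_nhds hb))
    refine ⟨pr ⁻¹' W', _, hW'.preimage hpr.continuous, by rw [mem_preimage, m.2]; exact hbW',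
      contMDiffOn_bismut hpr hloc H nablaE hsmooth hW'
        (hr.mono (preimage_mono (hW's.trans inter_subset_right)))
        (hX.mono (hW's.trans inter_subset_left)), fun m' _ => ?_⟩
    have key : ∀ (b' : B) (_ : b' = b), (⟨b', FiberBundle.extend EB X b'⟩ :
        TangentBundle 𝓘(ℝ, EB) B) = ⟨b, X⟩ := by
      rintro b' rfl
      rw [FiberBundle.extend_apply_self]
    rw [bismut, key _ m'.2]
  · intro W hW r hr X hX
    exact contMDiffOn_bismut hpr hloc H nablaE hsmooth hW hr hX
  · intro W hW r hr b hb X Y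
    ext m
    obtain ⟨U, hU, ⟨T⟩⟩ := hloc b
    obtain ⟨z, hz⟩ : ∃ z, T.Φ b z = m.1 := by
      obtain ⟨m, rfl⟩ := m
      exact ⟨T.ζ m, T.Φ_ζ m hU⟩
    change nablaE r m.1 (H.lift m.1 ⟨b, X + Y⟩) = nablaE r m.1 (H.lift m.1 ⟨b, X⟩) +
      nablaE r m.1 (H.lift m.1 ⟨b, Y⟩)
    rw [← hz, T.lift_add H hpr hU, map_add]
  · intro W hW r hr b hb c X
    ext m
    obtain ⟨U, hU, ⟨T⟩⟩ := hloc b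
    obtain ⟨z, hz⟩ : ∃ z, T.Φ b z = m.1 := by
      obtain ⟨m, rfl⟩ := m
      exact ⟨T.ζ m, T.Φ_ζ m hU⟩
    change nablaE r m.1 (H.lift m.1 ⟨b, c • X⟩) = c • nablaE r m.1 (H.lift m.1 ⟨b, X⟩)
    rw [← hz, T.lift_smul H hpr hU, map_smul]
  · intro W hW r r' hr hr' b hb X
    ext ⟨m, rfl⟩
    exact congrArg (fun A => A (H.lift m ⟨pr m, X⟩)) (hcov.add (hd hW hr hb) (hd hW hr' hb))
  · intro W hW r hr b hb c X
    ext ⟨m, rfl⟩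
    exact hlin c r m (hd hW hr hb) _
  · rintro W hW r hr h hh b hb X ⟨m, rfl⟩
    have hhd : MDifferentiableAt 𝓘(ℝ, EB) 𝓘(ℝ, ℝ) h (pr m) :=
      (hh.contMDiffAt (hW.mem_nhds hb)).mdifferentiableAt (by simp)
    have hprd : MDifferentiableAt 𝓘(ℝ, EM) 𝓘(ℝ, EB) pr m :=
      hpr.contMDiffAt.mdifferentiableAt (by simp)
    have h1 := congrArg (fun A => A (H.lift m ⟨pr m, X⟩))
      (hcov.leibniz (g := fun m => h (pr m)) (hd hW hr hb) (hhd.comp m hprd))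
    -- As X^H projects to X, the derivative of h ∘ pr along X^H is dh(X), which turns the Leibniz
    -- rule on `M` into the one over `B`.
    have h2 : mvfderiv 𝓘(ℝ, EM) (fun m => h (pr m)) m (H.lift m ⟨pr m, X⟩) =
        mvfderiv 𝓘(ℝ, EB) h (pr m) X := by
      have h3 := mfderiv_comp m hhd hprd
      have h4 : (mfderiv 𝓘(ℝ, EM) 𝓘(ℝ, EB) pr m (H.lift m ⟨pr m, X⟩) : EB) = X :=
        TotalSpace.mk_injective _ (tangentMap_lift hpr hloc H m X)
      have h5 := congrArg (fun A : EM →L[ℝ] ℝ => A (H.lift m ⟨pr m, X⟩)) h3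
      refine h5.trans ?_
      exact congrArg (mfderiv 𝓘(ℝ, EB) 𝓘(ℝ, ℝ) h (pr m)) h4
    refine h1.trans ?_
    rw [← h2, add_comm]
    rfl

end Bismut

/-! ### The flow of the connection one-form along a curve -/

/-- A smooth map from the line to the interval `(-δ, δ)` which is the identity near `0`. -/
theorem exists_smooth_retract {δ : ℝ} (hδ : 0 < δ) :
    ∃ χ : ℝ → ℝ, ContDiff ℝ ∞ χ ∧ (∀ t, χ t ∈ Ioo (-δ) δ) ∧
      ∀ t ∈ Ioo (-(δ / 2)) (δ / 2), χ t = t := by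
  let f : ContDiffBump (0 : ℝ) := ⟨δ / 2, δ * (3 / 4), by positivity, by linarith⟩
  refine ⟨fun t => f t * t, f.contDiff.mul contDiff_id, fun t => ?_, fun t ht => ?_⟩
  · refine abs_lt.1 ?_
    dsimp only
    rw [abs_mul, abs_of_nonneg f.nonneg]
    rcases lt_or_ge |t| (δ * (3 / 4)) with h | h
    · calc f t * |t| ≤ 1 * |t| := mul_le_mul_of_nonneg_right f.le_one (abs_nonneg t)
        _ < δ := by linarith
    · rw [f.zero_of_le_dist (by rw [Real.dist_0_eq_abs]; exact h), zero_mul]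
      exact hδ
  · dsimp only
    rw [f.one_of_mem_closedBall (by
      rw [Metric.mem_closedBall, Real.dist_0_eq_abs]
      exact (abs_lt.2 ht).le), one_mul]

section Transport

variable {𝕂 : Type*} [RCLike 𝕂]
  {EB : Type*} [NormedAddCommGroup EB] [NormedSpace ℝ EB] [FiniteDimensional ℝ EB]
  {B : Type*} [TopologicalSpace B] [ChartedSpace EB B] [IsManifold 𝓘(ℝ, EB) ∞ B]
  {EM : Type*} [NormedAddCommGroup EM] [NormedSpace ℝ EM] [FiniteDimensional ℝ EM]
  {M : Type*} [TopologicalSpace M] [ChartedSpace EM M] [IsManifold 𝓘(ℝ, EM) ∞ M]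
  {EZ : Type*} [NormedAddCommGroup EZ] [NormedSpace ℝ EZ] [FiniteDimensional ℝ EZ]
  {Z : Type*} [TopologicalSpace Z] [ChartedSpace EZ Z] [IsManifold 𝓘(ℝ, EZ) ∞ Z]
  {FE : Type*} [NormedAddCommGroup FE] [NormedSpace ℝ FE] [FiniteDimensional ℝ FE]
  [NormedSpace 𝕂 FE] [IsScalarTower ℝ 𝕂 FE]
  {E : M → Type*} [TopologicalSpace (TotalSpace FE E)] [∀ m, TopologicalSpace (E m)]
  [∀ m, AddCommGroup (E m)] [∀ m, Module ℝ (E m)] [∀ m, Module 𝕂 (E m)]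
  [∀ m, IsScalarTower ℝ 𝕂 (E m)]
  [∀ m, IsTopologicalAddGroup (E m)] [∀ m, ContinuousSMul ℝ (E m)]
  [FiberBundle FE E] [VectorBundle ℝ FE E] [VectorBundle 𝕂 FE E]
  [ContMDiffVectorBundle ∞ FE E 𝓘(ℝ, EM)]
  {FF : Type*} [NormedAddCommGroup FF] [NormedSpace ℝ FF] [FiniteDimensional ℝ FF]
  [NormedSpace 𝕂 FF] [IsScalarTower ℝ 𝕂 FF]
  {F : Z → Type*} [TopologicalSpace (TotalSpace FF F)] [∀ z, TopologicalSpace (F z)]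
  [∀ z, AddCommGroup (F z)] [∀ z, Module ℝ (F z)] [∀ z, Module 𝕂 (F z)]
  [∀ z, IsScalarTower ℝ 𝕂 (F z)]
  [FiberBundle FF F] [VectorBundle ℝ FF F] [VectorBundle 𝕂 FF F]
  [ContMDiffVectorBundle ∞ FF F 𝓘(ℝ, EZ)]
  {pr : M → B} {U : Set B}

namespace LocalTriv

variable (T : LocalTriv 𝕂 EB EM EZ FE E FF F pr U)
  (nablaE : CovariantDerivative 𝓘(ℝ, EM) FE E) (H : HorizontalBundle EB EM pr)

/-- The flow theorem is applied to the field s determined by γ'(t), first made into a field defined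
for all times. -/
theorem exists_transport [T2Space M] [T2Space Z] [CompactSpace Z]
    (hpr : ContMDiff 𝓘(ℝ, EM) 𝓘(ℝ, EB) ∞ pr)
    (hsmooth : CovariantDerivative.ContMDiffCovariantDerivative nablaE ∞)
    (hlin : ∀ (c : 𝕂) (r : ∀ m, E m) (m : M),
      MDifferentiableAt 𝓘(ℝ, EM) (𝓘(ℝ, EM).prod 𝓘(ℝ, FE))
        (fun m => (⟨m, r m⟩ : TotalSpace FE E)) m →
      ∀ Y, nablaE (c • r) m Y = c • nablaE r m Y)
    {γ : ℝ → B} {δ : ℝ} (hδ : 0 < δ) (hγ : ContMDiffOn 𝓘(ℝ, ℝ) 𝓘(ℝ, EB) ∞ γ (Ioo (-δ) δ))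
    (hγU : ∀ t ∈ Ioo (-δ) δ, γ t ∈ U) :
    ∃ (ε : ℝ) (g : ℝ → BundleAut 𝕂 EZ FF F), 0 < ε ∧ ε ≤ δ ∧
      ContMDiffOn (𝓘(ℝ, ℝ).prod (𝓘(ℝ, EZ).prod 𝓘(ℝ, FF))) (𝓘(ℝ, EZ).prod 𝓘(ℝ, FF)) ∞
        (fun p : ℝ × TotalSpace FF F => (g p.1).toFun p.2) (Ioo (-ε) ε ×ˢ univ) ∧
      ContMDiffOn (𝓘(ℝ, ℝ).prod 𝓘(ℝ, EZ)) 𝓘(ℝ, EZ) ∞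
        (fun p : ℝ × Z => (g p.1).base.symm p.2) (Ioo (-ε) ε ×ˢ univ) ∧
      (∀ v, (g 0).toFun v = v) ∧
      (∀ t ∈ Ioo (-ε) ε, ∀ v, HasMFDerivAt 𝓘(ℝ, ℝ) (𝓘(ℝ, EZ).prod 𝓘(ℝ, FF))
        (fun r => (g r).toFun v) t ((1 : ℝ →L[ℝ] ℝ).smulRight (T.liftF nablaE H (γ t)
          (mfderiv 𝓘(ℝ, ℝ) 𝓘(ℝ, EB) γ t (1 : ℝ)) ((g t).toFun v)))) ∧
      ∀ β₁ β₂ : ℝ → TotalSpace FF F,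
        (∀ t ∈ Ioo (-ε) ε, HasMFDerivAt 𝓘(ℝ, ℝ) (𝓘(ℝ, EZ).prod 𝓘(ℝ, FF)) β₁ t
          ((1 : ℝ →L[ℝ] ℝ).smulRight (T.liftF nablaE H (γ t)
            (mfderiv 𝓘(ℝ, ℝ) 𝓘(ℝ, EB) γ t (1 : ℝ)) (β₁ t)))) →
        (∀ t ∈ Ioo (-ε) ε, HasMFDerivAt 𝓘(ℝ, ℝ) (𝓘(ℝ, EZ).prod 𝓘(ℝ, FF)) β₂ t
          ((1 : ℝ →L[ℝ] ℝ).smulRight (T.liftF nablaE H (γ t)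
            (mfderiv 𝓘(ℝ, ℝ) 𝓘(ℝ, EB) γ t (1 : ℝ)) (β₂ t)))) →
        β₁ 0 = β₂ 0 → EqOn β₁ β₂ (Ioo (-ε) ε) := by
  obtain ⟨χ, hχ, hχm, hχe⟩ := exists_smooth_retract hδ
  -- The curve is smooth only on `(-δ, δ)`, so its velocity is sampled at time `χ t`. This is γ'(χ
  -- t) and not the velocity of γ ∘ χ; it agrees with γ'(t) for |t| < δ / 2, whence the bound `δ /
  -- 2` on the existence time.
  let h : ℝ → TangentBundle 𝓘(ℝ, EB) B :=
    fun t => ⟨γ (χ t), mfderiv 𝓘(ℝ, ℝ) 𝓘(ℝ, EB) γ (χ t) (1 : ℝ)⟩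
  have hh : ∀ t, ContMDiffAt 𝓘(ℝ, ℝ) 𝓘(ℝ, EB).tangent ∞ h t := fun t =>
    ContMDiffAt.comp (g := tangentMap 𝓘(ℝ, ℝ) 𝓘(ℝ, EB) γ)
      (f := fun t => (⟨χ t, (1 : ℝ)⟩ : TangentBundle 𝓘(ℝ, ℝ) ℝ)) t
      (contMDiffAt_tangentMap_of_isOpen isOpen_Ioo hγ (hχm t))
      ((contMDiff_const_vectorField_real.comp hχ.contMDiff).contMDiffAt)
  have hU : ∀ t, (h t).1 ∈ U := fun t => hγU _ (hχm t)
  let S : LinearField 𝕂 EZ FF F :=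
    { V := fun t => T.liftZ H (h t).1 (h t).2
      s := fun t => T.liftF nablaE H (h t).1 (h t).2
      smooth_V := fun p => T.contMDiffAt_liftZ H hpr (h := fun p : ℝ × Z => h p.1) (hU p.1)
        ((hh p.1).comp p contMDiffAt_fst) contMDiffAt_snd
      smooth_s := fun p => T.contMDiffAt_liftF nablaE H hpr hsmooth hlin
        (h := fun p : ℝ × TotalSpace FF F => h p.1) (hU p.1)
        ((hh p.1).comp p contMDiffAt_fst) contMDiffAt_snd
      covers := fun t v => (T.liftF_spec nablaE H hpr (hU t) (h t).2 v).1
      linear := fun e _ t z hz => T.isLinearMap_liftF nablaE H hpr hlin (hU t) (h t).2 e hz }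
  obtain ⟨ε, hε, g, hg1, hg2, hg3, hg4⟩ := S.exists_flow
  have hS : ∀ t ∈ Ioo (-(min ε (δ / 2))) (min ε (δ / 2)), S.s t = T.liftF nablaE H (γ t)
      (mfderiv 𝓘(ℝ, ℝ) 𝓘(ℝ, EB) γ t (1 : ℝ)) := by
    intro t ht
    have h1 : χ t = t := hχe t ⟨(neg_le_neg (min_le_right _ _)).trans_lt ht.1,
      ht.2.trans_le (min_le_right _ _)⟩
    change T.liftF nablaE H (γ (χ t)) (mfderiv 𝓘(ℝ, ℝ) 𝓘(ℝ, EB) γ (χ t) (1 : ℝ)) = _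
    rw [h1]
  have hsub : Ioo (-(min ε (δ / 2))) (min ε (δ / 2)) ⊆ Ioo (-ε) ε :=
    Ioo_subset_Ioo (neg_le_neg (min_le_left _ _)) (min_le_left _ _)
  have hpos : 0 < min ε (δ / 2) := lt_min hε (by positivity)
  refine ⟨min ε (δ / 2), g, hpos, (min_le_right _ _).trans (by linarith),
    hg1.mono (prod_mono_left hsub), hg2.mono (prod_mono_left hsub), hg3, fun t ht v => ?_,
    fun β₁ β₂ h₁ h₂ h₀ => ?_⟩
  · rw [← hS t ht]
    exact hg4 t (hsub ht) v
  · refine LinearField.eqOn_integralCurve (S := S) 0 (τ₀ := 0) ⟨neg_lt_zero.2 hpos, hpos⟩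
      (fun t ht => ?_) (fun t ht => ?_) h₀
    · rw [zero_add, hS t ht]
      exact h₁ t ht
    · rw [zero_add, hS t ht]
      exact h₂ t ht

end LocalTriv

end Transport

/-! ### Parallel translation -/

section Parallel

variable {𝕂 : Type*} [RCLike 𝕂]
  {EB : Type*} [NormedAddCommGroup EB] [NormedSpace ℝ EB] [FiniteDimensional ℝ EB]
  {B : Type*} [TopologicalSpace B] [ChartedSpace EB B] [IsManifold 𝓘(ℝ, EB) ∞ B]
  {EM : Type*} [NormedAddCommGroup EM] [NormedSpace ℝ EM] [FiniteDimensional ℝ EM]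
  {M : Type*} [TopologicalSpace M] [ChartedSpace EM M] [IsManifold 𝓘(ℝ, EM) ∞ M]
  {EZ : Type*} [NormedAddCommGroup EZ] [NormedSpace ℝ EZ] [FiniteDimensional ℝ EZ]
  {Z : Type*} [TopologicalSpace Z] [ChartedSpace EZ Z] [IsManifold 𝓘(ℝ, EZ) ∞ Z]
  {FE : Type*} [NormedAddCommGroup FE] [NormedSpace ℝ FE] [FiniteDimensional ℝ FE]
  [NormedSpace 𝕂 FE] [IsScalarTower ℝ 𝕂 FE]
  {E : M → Type*} [TopologicalSpace (TotalSpace FE E)] [∀ m, TopologicalSpace (E m)]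
  [∀ m, AddCommGroup (E m)] [∀ m, Module ℝ (E m)] [∀ m, Module 𝕂 (E m)]
  [∀ m, IsScalarTower ℝ 𝕂 (E m)]
  [∀ m, IsTopologicalAddGroup (E m)] [∀ m, ContinuousSMul ℝ (E m)]
  [FiberBundle FE E] [VectorBundle ℝ FE E] [VectorBundle 𝕂 FE E]
  [ContMDiffVectorBundle ∞ FE E 𝓘(ℝ, EM)]
  {FF : Type*} [NormedAddCommGroup FF] [NormedSpace ℝ FF] [FiniteDimensional ℝ FF]
  [NormedSpace 𝕂 FF] [IsScalarTower ℝ 𝕂 FF]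
  {F : Z → Type*} [TopologicalSpace (TotalSpace FF F)] [∀ z, TopologicalSpace (F z)]
  [∀ z, AddCommGroup (F z)] [∀ z, Module ℝ (F z)] [∀ z, Module 𝕂 (F z)]
  [∀ z, IsScalarTower ℝ 𝕂 (F z)]
  [FiberBundle FF F] [VectorBundle ℝ FF F] [VectorBundle 𝕂 FF F]
  [ContMDiffVectorBundle ∞ FF F 𝓘(ℝ, EZ)]
  {pr : M → B} {U : Set B}



theorem vertLift_zero {z : Z} (v : F z) : vertLift EZ FF v 0 = 0 := by
  set e := trivializationAt FF F z
  have hz : z ∈ e.baseSet := FiberBundle.mem_baseSet_trivializationAt' z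
  refine tangent_ext (e := e) hz ?_ ?_
  · rw [projDeriv_vertLift]
    exact (map_zero _).symm
  · rw [fibDeriv_vertLift hz, (e.linear ℝ hz).map_zero]
    exact (map_zero (mfderiv (𝓘(ℝ, EZ).prod 𝓘(ℝ, FF)) 𝓘(ℝ, FF)
      (fun y : TotalSpace FF F => (e y).2) (⟨z, v⟩ : TotalSpace FF F))).symm

/-- The velocity of a family of sections evaluated along a moving point. -/
theorem hasMFDerivAt_section_comp {ρ : ℝ → ∀ z, F z} {c : ℝ → Z} {t : ℝ}
    {V : TangentSpace 𝓘(ℝ, EZ) (c t)}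
    (hρ : MDifferentiableAt (𝓘(ℝ, ℝ).prod 𝓘(ℝ, EZ)) (𝓘(ℝ, EZ).prod 𝓘(ℝ, FF))
      (fun p : ℝ × Z => (⟨p.2, ρ p.1 p.2⟩ : TotalSpace FF F)) (t, c t))
    (hc : HasMFDerivAt 𝓘(ℝ, ℝ) 𝓘(ℝ, EZ) c t ((1 : ℝ →L[ℝ] ℝ).smulRight V)) :
    HasMFDerivAt 𝓘(ℝ, ℝ) (𝓘(ℝ, EZ).prod 𝓘(ℝ, FF))
      (fun t' => (⟨c t', ρ t' (c t')⟩ : TotalSpace FF F)) t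
      ((1 : ℝ →L[ℝ] ℝ).smulRight
        (mfderiv 𝓘(ℝ, ℝ) (𝓘(ℝ, EZ).prod 𝓘(ℝ, FF))
          (fun t' => (⟨c t, ρ t' (c t)⟩ : TotalSpace FF F)) t (1 : ℝ) +
        mfderiv 𝓘(ℝ, EZ) (𝓘(ℝ, EZ).prod 𝓘(ℝ, FF))
          (fun y => (⟨y, ρ t y⟩ : TotalSpace FF F)) (c t) V)) := by
  have h1 : HasMFDerivAt 𝓘(ℝ, ℝ) (𝓘(ℝ, ℝ).prod 𝓘(ℝ, EZ)) (fun t' => (t', c t')) t _ :=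
    (hasMFDerivAt_id (I := 𝓘(ℝ, ℝ)) t).prodMk hc
  have h2 := HasMFDerivAt.comp t hρ.hasMFDerivAt h1
  refine hasMFDerivAt_of_velocity h2.mdifferentiableAt ?_
  refine (congrArg (fun A : ℝ →L[ℝ] EZ × FF => A 1) h2.mfderiv).trans ?_
  have h3 := mfderiv_prod_eq_add_apply (v := (((1 : ℝ), V) : ℝ × EZ)) hρ
  refine Eq.trans ?_ h3
  refine congrArg (mfderiv (𝓘(ℝ, ℝ).prod 𝓘(ℝ, EZ)) (𝓘(ℝ, EZ).prod 𝓘(ℝ, FF))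
      (fun p : ℝ × Z => (⟨p.2, ρ p.1 p.2⟩ : TotalSpace FF F)) (t, c t)) ?_
  exact Prod.ext rfl (one_smul ℝ (V : EZ))

namespace LocalTriv

variable (T : LocalTriv 𝕂 EB EM EZ FE E FF F pr U)

/-- A section of `F` extends to a section of `𝓔` over `U` with constant representative. -/
theorem exists_represents_const (σ : ∀ z, F z) :
    ∃ R : ∀ m, E m, (∀ m, pr m ∈ U → (⟨m, R m⟩ : TotalSpace FE E) =
      T.total (pr m) ⟨T.ζ m, σ (T.ζ m)⟩) := by
  have key : ∀ (m : M) (y : TotalSpace FE E), y.proj = m →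
      ∃ u : E m, (⟨m, u⟩ : TotalSpace FE E) = y := by
    rintro _ y rfl
    exact ⟨y.2, rfl⟩
  have h : ∀ m, ∃ u : E m, pr m ∈ U → (⟨m, u⟩ : TotalSpace FE E) =
      T.total (pr m) ⟨T.ζ m, σ (T.ζ m)⟩ := by
    intro m
    by_cases hm : pr m ∈ U
    · obtain ⟨u, hu⟩ := key m (T.total (pr m) ⟨T.ζ m, σ (T.ζ m)⟩) (T.Φ_ζ m hm)
      exact ⟨u, fun _ => hu⟩
    · exact ⟨0, fun h => absurd h hm⟩
  choose R hR using h
  exact ⟨R, hR⟩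

theorem represents_const_iff {σ : ∀ z, F z} {R : ∀ m, E m} :
    T.Represents (fun _ => σ) R ↔ ∀ m, pr m ∈ U → (⟨m, R m⟩ : TotalSpace FE E) =
      T.total (pr m) ⟨T.ζ m, σ (T.ζ m)⟩ := by
  constructor
  · intro h m hm
    have h1 : (⟨T.Φ (pr m) (T.ζ m), R (T.Φ (pr m) (T.ζ m))⟩ : TotalSpace FE E) =
        T.total (pr m) ⟨T.ζ m, σ (T.ζ m)⟩ := congrArg _ (h _ hm _)
    rwa [T.Φ_ζ m hm] at h1
  · intro h b hb z
    have h1 := h (T.Φ b z) (by rw [T.pr_Φ b hb]; exact hb)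
    rw [T.pr_Φ b hb, T.ζ_Φ b hb] at h1
    exact TotalSpace.mk_injective _ h1

theorem isSmoothSectionOn_of_represents_const (hpr : ContMDiff 𝓘(ℝ, EM) 𝓘(ℝ, EB) ∞ pr)
    {σ : ∀ z, F z} {R : ∀ m, E m}
    (hσ : ContMDiff 𝓘(ℝ, EZ) (𝓘(ℝ, EZ).prod 𝓘(ℝ, FF)) ∞ (fun z => (⟨z, σ z⟩ : TotalSpace FF F)))
    (hR : T.Represents (fun _ => σ) R) : IsSmoothSectionOn EM FE E pr U R := by
  intro m hm
  have h1 : ContMDiffAt 𝓘(ℝ, EM) (𝓘(ℝ, EM).prod 𝓘(ℝ, FE)) ∞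
      (fun m => T.total (pr m) ⟨T.ζ m, σ (T.ζ m)⟩) m :=
    ContMDiffAt.comp (g := fun p : B × TotalSpace FF F => T.total p.1 p.2)
      (f := fun m => (pr m, (⟨T.ζ m, σ (T.ζ m)⟩ : TotalSpace FF F))) m (T.contMDiffAt_total hm _)
      (hpr.contMDiffAt.prodMk (hσ.contMDiffAt.comp m (T.contMDiffAt_ζ hpr hm)))
  refine (h1.congr_of_eventuallyEq ?_).contMDiffWithinAt
  filter_upwards [(T.isOpen_preimage hpr).mem_nhds hm] with m' hm'
  exact T.represents_const_iff.1 hR m' hm'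

variable {D : CovDerivOp EB E pr}
  {θ : ∀ b : B, TangentSpace 𝓘(ℝ, EB) b → BundleAutLie 𝕂 EZ FF F}

/-- In terms of the connection one-form, a family of sections is parallel along `γ` when it solves
the transport equation `∂ρ/∂t = s ∘ ρ - dρ(V)`. -/
theorem parallel_iff (hpr : ContMDiff 𝓘(ℝ, EM) 𝓘(ℝ, EB) ∞ pr) (hD : T.HasConnectionForm D θ)
    {b : B} (hb : b ∈ U) (X : TangentSpace 𝓘(ℝ, EB) b) {σ : ∀ z, F z}
    (hσ : ContMDiff 𝓘(ℝ, EZ) (𝓘(ℝ, EZ).prod 𝓘(ℝ, FF)) ∞ (fun z => (⟨z, σ z⟩ : TotalSpace FF F)))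
    (ξ : ∀ z, TangentSpace (𝓘(ℝ, EZ).prod 𝓘(ℝ, FF)) (⟨z, σ z⟩ : TotalSpace FF F)) :
    (∀ R : ∀ m, E m, T.Represents (fun _ => σ) R → ∀ (z : Z) (w : F z),
      T.Ψ b z w = D R b X ⟨T.Φ b z, T.pr_Φ b hb z⟩ → ξ z = vertLift EZ FF (σ z) (-w)) ↔
    ∀ z, ξ z = (θ b X).s ⟨z, σ z⟩ - mfderiv 𝓘(ℝ, EZ) (𝓘(ℝ, EZ).prod 𝓘(ℝ, FF))
      (fun y => (⟨y, σ y⟩ : TotalSpace FF F)) z ((θ b X).V z) := by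
  have key : ∀ R : ∀ m, E m, T.Represents (fun _ => σ) R → ∀ (z : Z) (w : F z),
      T.Ψ b z w = D R b X ⟨T.Φ b z, T.pr_Φ b hb z⟩ →
      vertLift EZ FF (σ z) (-w) = (θ b X).s ⟨z, σ z⟩ -
        mfderiv 𝓘(ℝ, EZ) (𝓘(ℝ, EZ).prod 𝓘(ℝ, FF))
          (fun y => (⟨y, σ y⟩ : TotalSpace FF F)) z ((θ b X).V z) := by
    intro R hR z w hw
    obtain ⟨τ, hτ, hτw⟩ := hD R (fun _ => σ)
      (T.isSmoothSectionOn_of_represents_const hpr hσ hR) hR b hb X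
    -- The representative does not depend on the base point, so its derivative along `X` vanishes
    -- and ∇_X R is represented by the Lie derivative alone.
    have h1 : vertLift EZ FF (σ z) (w - τ z) = vertLift EZ FF (σ z) 0 := by
      rw [hτw z w hw, vertLift_zero]
      exact congrArg (fun A : EB →L[ℝ] EZ × FF => A X) mfderiv_const
    obtain rfl : w = τ z := sub_eq_zero.1 (vertLift_injective h1)
    rw [vertLift_neg, hτ z, neg_sub]
  constructor
  · intro h z
    -- The hypothesis quantifies over `R` and `w`; it has content because an `R` with constant
    -- representative exists and `Ψ` is surjective on fibres.
    obtain ⟨R, hR⟩ := T.exists_represents_const σ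
    rw [← T.represents_const_iff] at hR
    obtain ⟨w, hw⟩ := (T.bijective_Ψ b hb z).2 (D R b X ⟨T.Φ b z, T.pr_Φ b hb z⟩)
    rw [h R hR z w hw, key R hR z w hw]
  · intro h R hR z w hw
    rw [h z, key R hR z w hw]

end LocalTriv

end Parallel

/-! ### Parallel translation of the Bismut connection -/

section ParallelTranslation

variable {𝕂 : Type*} [RCLike 𝕂]
  {EB : Type*} [NormedAddCommGroup EB] [NormedSpace ℝ EB] [FiniteDimensional ℝ EB]
  {B : Type*} [TopologicalSpace B] [ChartedSpace EB B] [IsManifold 𝓘(ℝ, EB) ∞ B]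
  {EM : Type*} [NormedAddCommGroup EM] [NormedSpace ℝ EM] [FiniteDimensional ℝ EM]
  {M : Type*} [TopologicalSpace M] [ChartedSpace EM M] [IsManifold 𝓘(ℝ, EM) ∞ M]
  {EZ : Type*} [NormedAddCommGroup EZ] [NormedSpace ℝ EZ] [FiniteDimensional ℝ EZ]
  {Z : Type*} [TopologicalSpace Z] [ChartedSpace EZ Z] [IsManifold 𝓘(ℝ, EZ) ∞ Z]
  {FE : Type*} [NormedAddCommGroup FE] [NormedSpace ℝ FE] [FiniteDimensional ℝ FE]
  [NormedSpace 𝕂 FE] [IsScalarTower ℝ 𝕂 FE]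
  {E : M → Type*} [TopologicalSpace (TotalSpace FE E)] [∀ m, TopologicalSpace (E m)]
  [∀ m, AddCommGroup (E m)] [∀ m, Module ℝ (E m)] [∀ m, Module 𝕂 (E m)]
  [∀ m, IsScalarTower ℝ 𝕂 (E m)]
  [∀ m, IsTopologicalAddGroup (E m)] [∀ m, ContinuousSMul ℝ (E m)]
  [FiberBundle FE E] [VectorBundle ℝ FE E] [VectorBundle 𝕂 FE E]
  [ContMDiffVectorBundle ∞ FE E 𝓘(ℝ, EM)]
  {FF : Type*} [NormedAddCommGroup FF] [NormedSpace ℝ FF] [FiniteDimensional ℝ FF]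
  [NormedSpace 𝕂 FF] [IsScalarTower ℝ 𝕂 FF]
  {F : Z → Type*} [TopologicalSpace (TotalSpace FF F)] [∀ z, TopologicalSpace (F z)]
  [∀ z, AddCommGroup (F z)] [∀ z, Module ℝ (F z)] [∀ z, Module 𝕂 (F z)]
  [∀ z, IsScalarTower ℝ 𝕂 (F z)]
  [FiberBundle FF F] [VectorBundle ℝ FF F] [VectorBundle 𝕂 FF F]
  [ContMDiffVectorBundle ∞ FF F 𝓘(ℝ, EZ)]
  {pr : M → B} {U : Set B}



theorem BundleAut.mk_act (g : BundleAut 𝕂 EZ FF F) (σ : ∀ z, F z) (z : Z) :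
    (⟨g.base z, g.act σ (g.base z)⟩ : TotalSpace FF F) = g.toFun ⟨z, σ z⟩ :=
  congrArg _ (g.act_apply σ z)

theorem BundleAut.mk_act' (g : BundleAut 𝕂 EZ FF F) (σ : ∀ z, F z) (z : Z) :
    (⟨z, g.act σ z⟩ : TotalSpace FF F) = g.toFun ⟨g.base.symm z, σ (g.base.symm z)⟩ := by
  rw [← g.mk_act, g.base.apply_symm_apply]

namespace LocalTriv

variable (T : LocalTriv 𝕂 EB EM EZ FE E FF F pr U)
  {D : CovDerivOp EB E pr}
  {θ : ∀ b : B, TangentSpace 𝓘(ℝ, EB) b → BundleAutLie 𝕂 EZ FF F}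
  {γ : ℝ → B} {ε : ℝ} {g : ℝ → BundleAut 𝕂 EZ FF F}

/-- The base curve is the projection of the trajectory of the zero vector, and s covers V. -/
theorem hasMFDerivAt_base {t : ℝ} {ξ : BundleAutLie 𝕂 EZ FF F} (z : Z)
    (h : ∀ v, HasMFDerivAt 𝓘(ℝ, ℝ) (𝓘(ℝ, EZ).prod 𝓘(ℝ, FF)) (fun r => (g r).toFun v) t
      ((1 : ℝ →L[ℝ] ℝ).smulRight (ξ.s ((g t).toFun v)))) :
    HasMFDerivAt 𝓘(ℝ, ℝ) 𝓘(ℝ, EZ) (fun r => (g r).base z) t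
      ((1 : ℝ →L[ℝ] ℝ).smulRight (ξ.V ((g t).base z))) := by
  have h1 := HasMFDerivAt.comp t (mdifferentiableAt_proj' (EZ := EZ)
    ((g t).toFun ⟨z, 0⟩)).hasMFDerivAt (h ⟨z, 0⟩)
  refine hasMFDerivAt_of_velocity h1.mdifferentiableAt ?_
  refine (congrArg (fun A : ℝ →L[ℝ] EZ => A 1) h1.mfderiv).trans ?_
  refine Eq.trans ?_ (ξ.covers ((g t).toFun ⟨z, 0⟩))
  exact congrArg (projDeriv (EZ := EZ) ((g t).toFun ⟨z, 0⟩)) (one_smul ℝ (_ : EZ × FF))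

theorem contMDiff_slice {ρ : ℝ → ∀ z, F z}
    (hρ : ContMDiffOn (𝓘(ℝ, ℝ).prod 𝓘(ℝ, EZ)) (𝓘(ℝ, EZ).prod 𝓘(ℝ, FF)) ∞
      (fun p : ℝ × Z => (⟨p.2, ρ p.1 p.2⟩ : TotalSpace FF F)) (Ioo (-ε) ε ×ˢ univ))
    {t : ℝ} (ht : t ∈ Ioo (-ε) ε) :
    ContMDiff 𝓘(ℝ, EZ) (𝓘(ℝ, EZ).prod 𝓘(ℝ, FF)) ∞ (fun z => (⟨z, ρ t z⟩ : TotalSpace FF F)) := by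
  rw [← contMDiffOn_univ]
  exact hρ.comp (contMDiff_const.prodMk contMDiff_id).contMDiffOn fun z _ => ⟨ht, mem_univ z⟩

/-- A path in `𝔾` which integrates the connection one-form along `γ` is the parallel
translation. -/
theorem isParallelTranslation_of_flow (hpr : ContMDiff 𝓘(ℝ, EM) 𝓘(ℝ, EB) ∞ pr)
    (hD : T.HasConnectionForm D θ) (hγU : ∀ t ∈ Ioo (-ε) ε, γ t ∈ U) (hε : 0 < ε)
    (hg1 : ContMDiffOn (𝓘(ℝ, ℝ).prod (𝓘(ℝ, EZ).prod 𝓘(ℝ, FF))) (𝓘(ℝ, EZ).prod 𝓘(ℝ, FF)) ∞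
      (fun p : ℝ × TotalSpace FF F => (g p.1).toFun p.2) (Ioo (-ε) ε ×ˢ univ))
    (hg2 : ContMDiffOn (𝓘(ℝ, ℝ).prod 𝓘(ℝ, EZ)) 𝓘(ℝ, EZ) ∞
      (fun p : ℝ × Z => (g p.1).base.symm p.2) (Ioo (-ε) ε ×ˢ univ))
    (hg3 : ∀ v, (g 0).toFun v = v)
    (hg4 : ∀ t ∈ Ioo (-ε) ε, ∀ v, HasMFDerivAt 𝓘(ℝ, ℝ) (𝓘(ℝ, EZ).prod 𝓘(ℝ, FF))
      (fun r => (g r).toFun v) t ((1 : ℝ →L[ℝ] ℝ).smulRight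
        ((θ (γ t) (mfderiv 𝓘(ℝ, ℝ) 𝓘(ℝ, EB) γ t (1 : ℝ))).s ((g t).toFun v))))
    (hg5 : ∀ β₁ β₂ : ℝ → TotalSpace FF F,
      (∀ t ∈ Ioo (-ε) ε, HasMFDerivAt 𝓘(ℝ, ℝ) (𝓘(ℝ, EZ).prod 𝓘(ℝ, FF)) β₁ t
        ((1 : ℝ →L[ℝ] ℝ).smulRight
          ((θ (γ t) (mfderiv 𝓘(ℝ, ℝ) 𝓘(ℝ, EB) γ t (1 : ℝ))).s (β₁ t)))) →
      (∀ t ∈ Ioo (-ε) ε, HasMFDerivAt 𝓘(ℝ, ℝ) (𝓘(ℝ, EZ).prod 𝓘(ℝ, FF)) β₂ t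
        ((1 : ℝ →L[ℝ] ℝ).smulRight
          ((θ (γ t) (mfderiv 𝓘(ℝ, ℝ) 𝓘(ℝ, EB) γ t (1 : ℝ))).s (β₂ t)))) →
      β₁ 0 = β₂ 0 → EqOn β₁ β₂ (Ioo (-ε) ε)) :
    T.IsParallelTranslation D γ ε g := by
  have hopen : IsOpen (Ioo (-ε) ε ×ˢ (univ : Set Z)) := isOpen_Ioo.prod isOpen_univ
  refine ⟨hg1, hg3, fun σ hσ => ?_, fun ρ hρ t ht => ?_⟩
  · have hsm : ContMDiffOn (𝓘(ℝ, ℝ).prod 𝓘(ℝ, EZ)) (𝓘(ℝ, EZ).prod 𝓘(ℝ, FF)) ∞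
        (fun p : ℝ × Z => (⟨p.2, (g p.1).act σ p.2⟩ : TotalSpace FF F))
        (Ioo (-ε) ε ×ˢ univ) := by
      have h1 : ContMDiffOn (𝓘(ℝ, ℝ).prod 𝓘(ℝ, EZ)) (𝓘(ℝ, EZ).prod 𝓘(ℝ, FF)) ∞
          (fun p : ℝ × Z => (g p.1).toFun ⟨(g p.1).base.symm p.2, σ ((g p.1).base.symm p.2)⟩)
          (Ioo (-ε) ε ×ˢ univ) :=
        hg1.comp (contMDiffOn_fst.prodMk (hσ.comp_contMDiffOn hg2)) fun p hp => ⟨hp.1, mem_univ _⟩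
      exact h1.congr fun p _ => (g p.1).mk_act' σ p.2
    refine ⟨hsm, fun t ht htU => ?_⟩
    refine (T.parallel_iff hpr hD htU _ (contMDiff_slice (ρ := fun t => (g t).act σ) hsm ht)
      (fun z => mfderiv 𝓘(ℝ, ℝ) (𝓘(ℝ, EZ).prod 𝓘(ℝ, FF))
        (fun t' => (⟨z, (g t').act σ z⟩ : TotalSpace FF F)) t (1 : ℝ))).2 fun z => ?_
    -- Characteristics: r ↦ f_r(σ(y)) is the family f_r ∘ σ ∘ φ_r⁻¹ evaluated along the moving point
    -- φ_r(y). Its velocity is s by the flow equation and ∂ρ/∂t + dρ(V) by the chain rule; equating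
    -- the two gives the transport equation.
    obtain ⟨y, rfl⟩ : ∃ y, (g t).base y = z := (g t).base.surjective z
    have h1 := hasMFDerivAt_section_comp (ρ := fun t => (g t).act σ) (c := fun r => (g r).base y)
      ((hsm.contMDiffAt (hopen.mem_nhds ⟨ht, mem_univ _⟩)).mdifferentiableAt (by simp))
      (hasMFDerivAt_base y (hg4 t ht))
    have h2 := hg4 t ht ⟨y, σ y⟩
    have h3 : (fun r => (g r).toFun ⟨y, σ y⟩) =
        fun r => (⟨(g r).base y, (g r).act σ ((g r).base y)⟩ : TotalSpace FF F) :=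
      funext fun r => ((g r).mk_act σ y).symm
    rw [h3, ← (g t).mk_act σ y] at h2
    have h4 := congrArg (fun A : ℝ →L[ℝ] EZ × FF => A 1) (hasMFDerivAt_unique h1 h2)
    have h5 := ((one_smul ℝ (_ : EZ × FF)).symm.trans h4).trans (one_smul ℝ (_ : EZ × FF))
    exact eq_sub_of_add_eq h5
  · have h0 : (0 : ℝ) ∈ Ioo (-ε) ε := ⟨neg_lt_zero.2 hε, hε⟩
    ext z
    obtain ⟨y, rfl⟩ : ∃ y, (g t).base y = z := (g t).base.surjective z
    -- Conversely, the transport equation makes the values of a parallel family along φ_r(y) an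
    -- integral curve of s, determined by its value at time 0.
    have h1 : EqOn (fun r => (⟨(g r).base y, ρ r ((g r).base y)⟩ : TotalSpace FF F))
        (fun r => (g r).toFun ⟨y, ρ 0 y⟩) (Ioo (-ε) ε) := by
      refine hg5 _ _ (fun r hr => ?_) (fun r hr => hg4 r hr _) ?_
      · have h2 := hasMFDerivAt_section_comp (ρ := ρ) (c := fun r => (g r).base y)
          ((hρ.smooth.contMDiffAt (hopen.mem_nhds ⟨hr, mem_univ _⟩)).mdifferentiableAt (by simp))
          (hasMFDerivAt_base y (hg4 r hr))
        have h3 := (T.parallel_iff hpr hD (hγU r hr) _ (contMDiff_slice hρ.smooth hr)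
          (fun z => mfderiv 𝓘(ℝ, ℝ) (𝓘(ℝ, EZ).prod 𝓘(ℝ, FF))
            (fun t' => (⟨z, ρ t' z⟩ : TotalSpace FF F)) r (1 : ℝ))).1
          (hρ.parallel r hr (hγU r hr)) ((g r).base y)
        rw [h3, sub_add_cancel] at h2
        exact h2
      · have h2 : (g 0).base y = y := congrArg TotalSpace.proj (hg3 ⟨y, 0⟩)
        rw [hg3, h2]
    have h2 := (h1 ht).trans ((g t).mk_act (ρ 0) y).symm
    exact TotalSpace.mk_injective _ h2

/-- The velocity of t ↦ Φ(γ t, c t) is Φ_*(γ', V), which is the horizontal lift by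
`lift_eq_mfderiv_Φ`. -/
theorem mfderiv_horizontal_curve (H : HorizontalBundle EB EM pr)
    (hpr : ContMDiff 𝓘(ℝ, EM) 𝓘(ℝ, EB) ∞ pr) {c : ℝ → Z} {t : ℝ} (ht : γ t ∈ U)
    (hγ : MDifferentiableAt 𝓘(ℝ, ℝ) 𝓘(ℝ, EB) γ t)
    (hc : HasMFDerivAt 𝓘(ℝ, ℝ) 𝓘(ℝ, EZ) c t ((1 : ℝ →L[ℝ] ℝ).smulRight
      (T.liftZ H (γ t) (mfderiv 𝓘(ℝ, ℝ) 𝓘(ℝ, EB) γ t (1 : ℝ)) (c t)))) :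
    mfderiv 𝓘(ℝ, ℝ) 𝓘(ℝ, EM) (fun t' => T.Φ (γ t') (c t')) t (1 : ℝ) =
      H.lift (T.Φ (γ t) (c t)) ⟨γ t, mfderiv 𝓘(ℝ, ℝ) 𝓘(ℝ, EB) γ t (1 : ℝ)⟩ := by
  have h1 := HasMFDerivAt.comp (g := fun p : B × Z => T.Φ p.1 p.2) (f := fun t' => (γ t', c t')) t
    (((T.contMDiffAt_Φ ht (c t)).mdifferentiableAt (by simp)).hasMFDerivAt)
    (hγ.hasMFDerivAt.prodMk hc)
  refine (congrArg (fun A : ℝ →L[ℝ] EM => A 1) h1.mfderiv).trans ?_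
  rw [T.lift_eq_mfderiv_Φ H hpr ht]
  refine congrArg (mfderiv (𝓘(ℝ, EB).prod 𝓘(ℝ, EZ)) 𝓘(ℝ, EM) (fun p : B × Z => T.Φ p.1 p.2)
    (γ t, c t)) ?_
  exact Prod.ext rfl (one_smul ℝ (_ : EZ))

end LocalTriv

end ParallelTranslation

end PushforwardBundle

end

/-! ### The Bismut connection as a connection with structure group 𝔾 -/

open PushforwardBundle in
theorem mainTheorem6
    {𝕂 : Type*} [RCLike 𝕂]
    -- the closed connected manifolds `B`, `M`, `Z`
    {EB : Type*} [NormedAddCommGroup EB] [NormedSpace ℝ EB] [FiniteDimensional ℝ EB]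
    {B : Type*} [TopologicalSpace B] [ChartedSpace EB B] [IsManifold 𝓘(ℝ, EB) ∞ B]
    [T2Space B] [CompactSpace B] [ConnectedSpace B]
    {EM : Type*} [NormedAddCommGroup EM] [NormedSpace ℝ EM] [FiniteDimensional ℝ EM]
    {M : Type*} [TopologicalSpace M] [ChartedSpace EM M] [IsManifold 𝓘(ℝ, EM) ∞ M]
    [T2Space M] [CompactSpace M] [ConnectedSpace M]
    {EZ : Type*} [NormedAddCommGroup EZ] [NormedSpace ℝ EZ] [FiniteDimensional ℝ EZ]
    {Z : Type*} [TopologicalSpace Z] [ChartedSpace EZ Z] [IsManifold 𝓘(ℝ, EZ) ∞ Z]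
    [T2Space Z] [CompactSpace Z] [ConnectedSpace Z]
    -- the smooth finite-rank `𝕂`-vector bundle `E → M`
    {FE : Type*} [NormedAddCommGroup FE] [NormedSpace ℝ FE] [FiniteDimensional ℝ FE]
    [NormedSpace 𝕂 FE] [IsScalarTower ℝ 𝕂 FE]
    {E : M → Type*} [TopologicalSpace (TotalSpace FE E)] [∀ m, TopologicalSpace (E m)]
    [∀ m, AddCommGroup (E m)] [∀ m, Module ℝ (E m)] [∀ m, Module 𝕂 (E m)]
    [∀ m, IsScalarTower ℝ 𝕂 (E m)]
    [∀ m, IsTopologicalAddGroup (E m)] [∀ m, ContinuousSMul ℝ (E m)]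
    [FiberBundle FE E] [VectorBundle ℝ FE E] [VectorBundle 𝕂 FE E]
    [ContMDiffVectorBundle ∞ FE E 𝓘(ℝ, EM)]
    -- the smooth finite-rank `𝕂`-vector bundle `F → Z`
    {FF : Type*} [NormedAddCommGroup FF] [NormedSpace ℝ FF] [FiniteDimensional ℝ FF]
    [NormedSpace 𝕂 FF] [IsScalarTower ℝ 𝕂 FF]
    {F : Z → Type*} [TopologicalSpace (TotalSpace FF F)] [∀ z, TopologicalSpace (F z)]
    [∀ z, AddCommGroup (F z)] [∀ z, Module ℝ (F z)] [∀ z, Module 𝕂 (F z)]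
    [∀ z, IsScalarTower ℝ 𝕂 (F z)]
    [FiberBundle FF F] [VectorBundle ℝ FF F] [VectorBundle 𝕂 FF F]
    [ContMDiffVectorBundle ∞ FF F 𝓘(ℝ, EZ)]
    -- the fibration `Z → M → B`, over which `E` is locally modelled on `F → Z`
    (pr : M → B) (hpr : ContMDiff 𝓘(ℝ, EM) 𝓘(ℝ, EB) ∞ pr)
    (hloc : ∀ b, ∃ U : Set B, b ∈ U ∧ Nonempty (LocalTriv 𝕂 EB EM EZ FE E FF F pr U))
    -- the horizontal bundle and the connection on `E`
    (H : HorizontalBundle EB EM pr)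
    (nablaE : CovariantDerivative 𝓘(ℝ, EM) FE E)
    (hsmooth : CovariantDerivative.ContMDiffCovariantDerivative nablaE ∞)
    (hlin : ∀ (c : 𝕂) (r : ∀ m, E m) (m : M),
      MDifferentiableAt 𝓘(ℝ, EM) (𝓘(ℝ, EM).prod 𝓘(ℝ, FE))
        (fun m => (⟨m, r m⟩ : TotalSpace FE E)) m →
      ∀ Y, nablaE (c • r) m Y = c • nablaE r m Y) :
    IsGConnection 𝕂 EM EZ FE FF F (bismut nablaE H) ∧
    ∀ (U : Set B) (T : LocalTriv 𝕂 EB EM EZ FE E FF F pr U),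
      ∃ θ : ∀ b : B, TangentSpace 𝓘(ℝ, EB) b → BundleAutLie 𝕂 EZ FF F,
        IsOneForm U θ ∧ T.HasConnectionForm (bismut nablaE H) θ ∧
        -- `V` is the horizontal lift: `X^H = Φ_*(X, V)`
        (∀ b ∈ U, ∀ (X : TangentSpace 𝓘(ℝ, EB) b) (z : Z),
          H.lift (T.Φ b z) ⟨b, X⟩ =
            mfderiv (𝓘(ℝ, EB).prod 𝓘(ℝ, EZ)) 𝓘(ℝ, EM) (fun p : B × Z => T.Φ p.1 p.2) (b, z)
              ((X, (θ b X).V z) : TangentSpace 𝓘(ℝ, EB) b × TangentSpace 𝓘(ℝ, EZ) z)) ∧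
        -- `(V, s)` is the derivative at `0` of parallel translation `(φ_t, f_t)`
        ∀ b ∈ U, ∀ (X : TangentSpace 𝓘(ℝ, EB) b) (γ : ℝ → B) (δ : ℝ), 0 < δ →
          ContMDiffOn 𝓘(ℝ, ℝ) 𝓘(ℝ, EB) ∞ γ (Ioo (-δ) δ) → (∀ t ∈ Ioo (-δ) δ, γ t ∈ U) →
          tangentMap 𝓘(ℝ, ℝ) 𝓘(ℝ, EB) γ ⟨0, (1 : ℝ)⟩ = ⟨b, X⟩ →
          ∃ (ε : ℝ) (g : ℝ → BundleAut 𝕂 EZ FF F), 0 < ε ∧ ε ≤ δ ∧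
            T.IsParallelTranslation (bismut nablaE H) γ ε g ∧
            -- the underlying diffeomorphisms `φ_t` are given by horizontal transport in `M`
            (∀ t ∈ Ioo (-ε) ε, ∀ z : Z,
              mfderiv 𝓘(ℝ, ℝ) 𝓘(ℝ, EM) (fun t' => T.Φ (γ t') ((g t').base z)) t (1 : ℝ) =
                H.lift (T.Φ (γ t) ((g t).base z))
                  ⟨γ t, mfderiv 𝓘(ℝ, ℝ) 𝓘(ℝ, EB) γ t (1 : ℝ)⟩) ∧
            (∀ z : Z, tangentMap 𝓘(ℝ, ℝ) 𝓘(ℝ, EZ) (fun t => (g t).base z) ⟨0, (1 : ℝ)⟩ =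
              ⟨z, (θ b X).V z⟩) ∧
            (∀ v : TotalSpace FF F,
              tangentMap 𝓘(ℝ, ℝ) (𝓘(ℝ, EZ).prod 𝓘(ℝ, FF)) (fun t => (g t).toFun v) ⟨0, (1 : ℝ)⟩ =
                ⟨v, (θ b X).s v⟩) := by
  -- The same θ must represent the connection and be the velocity of parallel translation, so its
  -- explicit components are kept.
  have hG : ∀ (U : Set B) (T : LocalTriv 𝕂 EB EM EZ FE E FF F pr U),
      ∃ θ : ∀ b : B, TangentSpace 𝓘(ℝ, EB) b → BundleAutLie 𝕂 EZ FF F, IsOneForm U θ ∧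
        T.HasConnectionForm (bismut nablaE H) θ ∧
        (∀ b ∈ U, ∀ X z, (θ b X).V z = T.liftZ H b X z) ∧
        ∀ b ∈ U, ∀ X v, (θ b X).s v = T.liftF nablaE H b X v := by
    intro U T
    obtain ⟨θ, hθ, hV, hs⟩ := T.exists_isOneForm nablaE H hpr hsmooth hlin
    exact ⟨θ, hθ, T.hasConnectionForm_bismut nablaE H hpr hV hs, hV, hs⟩
  refine ⟨⟨isConnection_bismut hpr hloc H nablaE hsmooth hlin, fun U T => ?_⟩, fun U T => ?_⟩
  · obtain ⟨θ, hθ, hD, -⟩ := hG U T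
    exact ⟨θ, hθ, hD⟩
  obtain ⟨θ, hθ, hD, hV, hs⟩ := hG U T
  refine ⟨θ, hθ, hD, fun b hb X z => ?_, fun b hb X γ δ hδ hγ hγU hX => ?_⟩
  · rw [hV b hb]
    exact T.lift_eq_mfderiv_Φ H hpr hb z X
  obtain ⟨ε, g, hε, hεδ, hg1, hg2, hg3, hg4, hg5⟩ :=
    T.exists_transport nablaE H hpr hsmooth hlin hδ hγ hγU
  have hsub : Ioo (-ε) ε ⊆ Ioo (-δ) δ := Ioo_subset_Ioo (neg_le_neg hεδ) hεδ
  have h0 : (0 : ℝ) ∈ Ioo (-ε) ε := ⟨neg_lt_zero.2 hε, hε⟩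
  have hs' : ∀ t ∈ Ioo (-ε) ε, ∀ v,
      T.liftF nablaE H (γ t) (mfderiv 𝓘(ℝ, ℝ) 𝓘(ℝ, EB) γ t (1 : ℝ)) v =
        (θ (γ t) (mfderiv 𝓘(ℝ, ℝ) 𝓘(ℝ, EB) γ t (1 : ℝ))).s v :=
    fun t ht v => (hs _ (hγU t (hsub ht)) _ v).symm
  have hflow : ∀ t ∈ Ioo (-ε) ε, ∀ v, HasMFDerivAt 𝓘(ℝ, ℝ) (𝓘(ℝ, EZ).prod 𝓘(ℝ, FF))
      (fun r => (g r).toFun v) t ((1 : ℝ →L[ℝ] ℝ).smulRight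
        ((θ (γ t) (mfderiv 𝓘(ℝ, ℝ) 𝓘(ℝ, EB) γ t (1 : ℝ))).s ((g t).toFun v))) := by
    intro t ht v
    rw [← hs' t ht]
    exact hg4 t ht v
  have hbase := fun t (ht : t ∈ Ioo (-ε) ε) (z : Z) => LocalTriv.hasMFDerivAt_base z (hflow t ht)
  refine ⟨ε, g, hε, hεδ, ?_, fun t ht z => ?_, fun z => ?_, fun v => ?_⟩
  · refine T.isParallelTranslation_of_flow hpr hD (fun t ht => hγU t (hsub ht)) hε hg1 hg2 hg3
      hflow fun β₁ β₂ h₁ h₂ => hg5 β₁ β₂ (fun t ht => ?_) fun t ht => ?_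
    · rw [hs' t ht]
      exact h₁ t ht
    · rw [hs' t ht]
      exact h₂ t ht
  · refine T.mfderiv_horizontal_curve (c := fun t => (g t).base z) H hpr (hγU t (hsub ht))
      ((hγ.contMDiffAt (isOpen_Ioo.mem_nhds (hsub ht))).mdifferentiableAt (by simp)) ?_
    rw [← hV _ (hγU t (hsub ht))]
    exact hbase t ht z
  · have h1 : tangentMap 𝓘(ℝ, ℝ) 𝓘(ℝ, EZ) (fun t => (g t).base z) ⟨0, (1 : ℝ)⟩ =
        ⟨(g 0).base z, (θ (γ 0) (mfderiv 𝓘(ℝ, ℝ) 𝓘(ℝ, EB) γ 0 (1 : ℝ))).V ((g 0).base z)⟩ :=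
      congrArg (TotalSpace.mk _) ((congrArg (fun A : ℝ →L[ℝ] EZ => A 1)
        (hbase 0 h0 z).mfderiv).trans (one_smul ℝ (_ : EZ)))
    -- The initial point of the curve is `z` only propositionally, and γ(0) is `b` only through
    -- `hX`; equations in the total tangent bundles allow both to be rewritten.
    have h2 : (g 0).base z = z := congrArg TotalSpace.proj (hg3 ⟨z, 0⟩)
    rw [h1, h2]
    exact congrArg (fun p : TangentBundle 𝓘(ℝ, EB) B =>
      (⟨z, (θ p.1 p.2).V z⟩ : TangentBundle 𝓘(ℝ, EZ) Z)) hX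
  · have h1 : tangentMap 𝓘(ℝ, ℝ) (𝓘(ℝ, EZ).prod 𝓘(ℝ, FF)) (fun t => (g t).toFun v) ⟨0, (1 : ℝ)⟩ =
        ⟨(g 0).toFun v, (θ (γ 0) (mfderiv 𝓘(ℝ, ℝ) 𝓘(ℝ, EB) γ 0 (1 : ℝ))).s ((g 0).toFun v)⟩ :=
      congrArg (TotalSpace.mk _) ((congrArg (fun A : ℝ →L[ℝ] EZ × FF => A 1)
        (hflow 0 h0 v).mfderiv).trans (one_smul ℝ (_ : EZ × FF)))
    rw [h1, hg3]
    exact congrArg (fun p : TangentBundle 𝓘(ℝ, EB) B =>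
      (⟨v, (θ p.1 p.2).s v⟩ : TangentBundle (𝓘(ℝ, EZ).prod 𝓘(ℝ, FF)) (TotalSpace FF F))) hX
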